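/- **Theorem.** There are universal real polynomials $p$ (in 9 variables) and $q$ (in 10 variables) such that the following holds. Let $d\ge 1$ and $k$ be integers, and let $\Phi:\mathbb{R}^{d+1}\to\mathbb{R}^k$, $V:\mathbb{R}^{d+1}\to\mathbb{R}$ and $R:\mathbb{R}^k\to\mathbb{R}$ satisfy: - $\Phi$ and $V$ are differentiable and 2-homogeneous: $\Phi(c\theta)=c^2\Phi(\theta)$ and $V(c\theta)=c^2V(\theta)$ for all $c>0$; - $R$ is convex, nonnegative and twice differentiable, with $\|\nabla R\|_2\le M_R$ and $\|\nabla^2R\|_{op}\le C_R$ everywhere; - for all $\bar\theta,\bar\theta'$ in the unit sphere $\mathbb{S}^d\subset\mathbb{R}^{d+1}$ and all coordinates $i$: $\|\Phi(\bar\theta)\|_2\le B_\Phi$ and $|\Phi_i(\bar\theta)-\Phi_i(\bar\theta')|\le M_\Phi\|\bar\theta-\bar\theta'\|_2$, with $M_\Phi\ge 0$; - for all $\bar\theta\in\mathbb{S}^d$: $0<b_V\le V(\bar\theta)\le B_V$ and $\|\nabla V(\bar\theta)\|_2\le M_V$. For a probability measure $\rho$ on $\mathbb{R}^{d+1}$ with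 finite second moment put $L[\rho]=R(\int\Phi\,d\rho)+\int V\,d\rho$, $L'[\rho](\theta)=\langle\nabla R(\int\Phi\,d\rho),\Phi(\theta)\rangle+V(\theta)$ and $v[\rho](\theta)=-\nabla_\theta L'[\rho](\theta)$, and let $L^\star=\inf_\rho L[\rho]$ over all such $\rho$. Let $U^d$ be the uniform distribution on $\mathbb{S}^d$. Let $\rho_0$ be a probability measure on $\mathbb{R}^{d+1}$ with finite second moment, let $\epsilon>0$, put $\ell_\epsilon=\log\max(1/\epsilon,2)$ (so $\ell_\epsilon=\log(1/\epsilon)$ for $\epsilon\le 1/2$), and let $$\sigma=\exp\bigl(-d\,\ell_\epsilon\;p(k,M_V,M_R,M_\Phi,b_V^{-1},B_V,C_R,B_\Phi,L[\rho_0])\bigr),$$ $$t_\epsilon=\frac{d^2}{\epsilon^4}\;q(\ell_\epsilon,k,M_V,M_R,M_\Phi,b_V^{-1},B_V,C_R,B_\Phi,L[\rho_0]).$$ If $(\rho_t)_{0\le t\le t_\epsilon}$ is a solution, starting from $\rho_0$, of the perturbed Wasserstein gradient flow $$\frac{d}{dt}\rho_t=-\sigma\rho_t+\sigma U^d-\nabla\cdot(v[\rho_t]\rho_t)$$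 (a family of probability measures with finite second moment that satisfies the equation, integrated in time, against every $\varphi\in C_c^\infty(\mathbb{R}^{d+1})$), then there is $t\in[0,t_\epsilon]$ with $$L[\rho_t]-L^\star\le 2\epsilon .$$ -/

import Mathlib

open MeasureTheory
open scoped ContDiff

noncomputable section

namespace PerturbedFlow

/-- `ℝⁿ` with its Euclidean norm. -/
abbrev Euc (n : ℕ) : Type := EuclideanSpace ℝ (Fin n)

/-- (Positive) 2-homogeneity; a function with `f (c x) = c² f x` for all real `c` is a special
case. -/
def TwoHomogeneous {n : ℕ} {F : Type*} [SMul ℝ F] (f : Euc n → F) : Prop :=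
  ∀ c : ℝ, 0 < c → ∀ x, f (c • x) = c ^ 2 • f x

/-- The loss `R` is convex, nonnegative, twice differentiable, with `‖∇R‖ ≤ M_R` and
`‖∇²R‖_op ≤ C_R`. -/
structure LossRegular {k : ℕ} (R : Euc k → ℝ) (M_R C_R : ℝ) : Prop where
  convex : ConvexOn ℝ Set.univ R
  nonneg : ∀ a, 0 ≤ R a
  differentiable : Differentiable ℝ R
  differentiable_gradient : Differentiable ℝ (gradient R)
  gradient_le : ∀ a, ‖gradient R a‖ ≤ M_R
  hessian_le : ∀ a, ‖fderiv ℝ (gradient R) a‖ ≤ C_R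

/-- The features `Φ` are differentiable and, on the unit sphere, bounded by `B_Φ` with every
coordinate `M_Φ`-Lipschitz. -/
structure FeatureRegular {d k : ℕ} (Φ : Euc (d + 1) → Euc k) (B_Φ M_Φ : ℝ) : Prop where
  differentiable : Differentiable ℝ Φ
  norm_le : ∀ x ∈ Metric.sphere (0 : Euc (d + 1)) 1, ‖Φ x‖ ≤ B_Φ
  lipschitz_const_nonneg : 0 ≤ M_Φ
  lipschitz : ∀ i : Fin k, ∀ x ∈ Metric.sphere (0 : Euc (d + 1)) 1,
    ∀ y ∈ Metric.sphere (0 : Euc (d + 1)) 1, |Φ x i - Φ y i| ≤ M_Φ * ‖x - y‖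

/-- The regularizer `V` is differentiable and, on the unit sphere, `0 < b_V ≤ V ≤ B_V` and
`‖∇V‖ ≤ M_V`. -/
structure RegularizerRegular {d : ℕ} (V : Euc (d + 1) → ℝ) (b_V B_V M_V : ℝ) : Prop where
  differentiable : Differentiable ℝ V
  lower_pos : 0 < b_V
  lower : ∀ x ∈ Metric.sphere (0 : Euc (d + 1)) 1, b_V ≤ V x
  upper : ∀ x ∈ Metric.sphere (0 : Euc (d + 1)) 1, V x ≤ B_V
  gradient_le : ∀ x ∈ Metric.sphere (0 : Euc (d + 1)) 1, ‖gradient V x‖ ≤ M_V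

/-- Probability measures on `ℝⁿ` with finite second moment. These are exactly the distributions
at which the objective below is finite, when `V` is 2-homogeneous and bounded below by a positive
constant on the sphere. -/
def P₂ (n : ℕ) : Set (Measure (Euc n)) :=
  {ρ | IsProbabilityMeasure ρ ∧ Integrable (fun θ => ‖θ‖ ^ 2) ρ}

/-- `L[ρ] = R(∫ Φ dρ) + ∫ V dρ`. -/
def objective {d k : ℕ} (R : Euc k → ℝ) (Φ : Euc (d + 1) → Euc k) (V : Euc (d + 1) → ℝ)
    (ρ : Measure (Euc (d + 1))) : ℝ :=
  R (∫ θ, Φ θ ∂ρ) + ∫ θ, V θ ∂ρ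

/-- `L⋆ = inf_ρ L[ρ]`. -/
def optimalValue {d k : ℕ} (R : Euc k → ℝ) (Φ : Euc (d + 1) → Euc k)
    (V : Euc (d + 1) → ℝ) : ℝ :=
  sInf (objective R Φ V '' P₂ (d + 1))

/-- `L'[ρ](θ) = ⟨∇R(∫ Φ dρ), Φ(θ)⟩ + V(θ)`. -/
def firstVariation {d k : ℕ} (R : Euc k → ℝ) (Φ : Euc (d + 1) → Euc k) (V : Euc (d + 1) → ℝ)
    (ρ : Measure (Euc (d + 1))) (θ : Euc (d + 1)) : ℝ :=
  inner ℝ (gradient R (∫ θ', Φ θ' ∂ρ)) (Φ θ) + V θ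

/-- `v[ρ](θ) = -∇_θ L'[ρ](θ)`. -/
def velocity {d k : ℕ} (R : Euc k → ℝ) (Φ : Euc (d + 1) → Euc k) (V : Euc (d + 1) → ℝ)
    (ρ : Measure (Euc (d + 1))) (θ : Euc (d + 1)) : Euc (d + 1) :=
  -gradient (firstVariation R Φ V ρ) θ

/-- `U^d`, the uniform distribution on the unit sphere of `ℝ^{d+1}`: normalized surface measure,
seen as a measure on `ℝ^{d+1}`. -/
def uniformSphere (d : ℕ) : Measure (Euc (d + 1)) :=
  ((volume : Measure (Euc (d + 1))).toSphere Set.univ)⁻¹ •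
    ((volume : Measure (Euc (d + 1))).toSphere).map Subtype.val

/-- The action of `-σ ρ + σ U^d - ∇·(v[ρ] ρ)` on a test function `φ`. -/
def flowRHS {d k : ℕ} (R : Euc k → ℝ) (Φ : Euc (d + 1) → Euc k) (V : Euc (d + 1) → ℝ) (σ : ℝ)
    (ρ : Measure (Euc (d + 1))) (φ : Euc (d + 1) → ℝ) : ℝ :=
  -σ * (∫ θ, φ θ ∂ρ) + σ * (∫ θ, φ θ ∂(uniformSphere d))
    + ∫ θ, inner ℝ (gradient φ θ) (velocity R Φ V ρ θ) ∂ρ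

/-- `ρ` is a (weak) solution on `[0, T]` of the perturbed Wasserstein gradient flow
`dρ_t/dt = -σ ρ_t + σ U^d - ∇·(v[ρ_t] ρ_t)` in the space of probability measures with finite
second moment: the equation, integrated in time, holds against all smooth compactly supported
test functions. -/
structure IsFlowSolution {d k : ℕ} (R : Euc k → ℝ) (Φ : Euc (d + 1) → Euc k)
    (V : Euc (d + 1) → ℝ) (σ T : ℝ) (ρ : ℝ → Measure (Euc (d + 1))) : Prop where
  mem_P₂ : ∀ t ∈ Set.Icc 0 T, ρ t ∈ P₂ (d + 1)
  integrable : ∀ φ : Euc (d + 1) → ℝ, ContDiff ℝ ∞ φ → HasCompactSupport φ →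
    IntegrableOn (fun s => flowRHS R Φ V σ (ρ s) φ) (Set.Icc 0 T)
  equation : ∀ φ : Euc (d + 1) → ℝ, ContDiff ℝ ∞ φ → HasCompactSupport φ →
    ∀ t ∈ Set.Icc 0 T,
      ∫ θ, φ θ ∂(ρ t) = ∫ θ, φ θ ∂(ρ 0) + ∫ s in (0 : ℝ)..t, flowRHS R Φ V σ (ρ s) φ

end PerturbedFlow

end

/-!
The objective `L` is a convex function of the measure `ρ`, and the flow decreases it at the rate
`D = ∫ ‖v[ρ]‖² dρ`, up to a term of order `σ` caused by the perturbation. Suppose that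
`L[ρ_t] - L⋆ > 2ε` throughout. Convexity provides a competitor `ν` with
`∫ L'[ρ] dρ - ∫ L'[ρ] dν > 2ε`, so that one of two cases occurs (`dissipation_or_descent`). If
`∫ L'[ρ] dρ > ε`, Euler's identity for the 2-homogeneous function `L'[ρ]` bounds `D` from below.
Otherwise `∫ L'[ρ] dν < -ε`, and `L'[ρ] ≤ -δ` at some point of the sphere, with `δ` of order `ε`.

In the second case the perturbation has put mass of order `σ` on a spherical cap where `L'[ρ]` is
negative, and the flow expands this mass exponentially as long as `L'[ρ]` does not change much
(`exponential_growth`). Since the second moment is bounded by the objective, the growth must stop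
after a time `τ` of order `log (1/σ) / δ`. By then `∫ Φ dρ` has moved by a definite amount, which
costs energy of order `1/τ`. So energy is dissipated in every window of length `2τ`
(`le_integral_dissipation`), and after sufficiently many windows the objective would be negative.

The growth is measured by the test function `φ_t(θ) = (s(t) ‖θ‖² - L'[ρ_t](θ))₊² / ‖θ‖²`
(`capFunction`). Its derivative along `-∇L'[ρ_t]` is at least `δ φ_t` while `s(t) ≤ -δ/4`
(`le_fderiv_capFunction`), and the level `s(t)` is raised at the speed at which `L'[ρ_t]` moves, so
that `φ_t` is nondecreasing in `t`.

The functions `Φ` and `V` are differentiable, but their derivatives need not be continuous, so there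
are no characteristics, and a weak solution is all that is available. The equation is extended from
smooth test functions of compact support to all differentiable functions of quadratic growth
(`IsLinearGrowthSolution.solvesAgainst`). This works because the derivatives of the mollifications of
a differentiable Lipschitz function converge at every point (`exists_smooth_approx`), and because
the second moment stays bounded (`exists_moment_bound`). Differential inequalities in time are
replaced by inequalities over short steps with a quadratic error
(`exp_mul_le_of_discrete_growth`).

All parameters are bounded by `S = 1 + (their sum)`, so `p = 256 S` and `q = 2³⁷ ℓ² S²¹` serve as
the universal polynomials.
-/

namespace PerturbedFlow

open Filter Topology

/-! ### Discrete Grönwall estimates -/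

/-- A Grönwall lower bound for functions that satisfy the growth condition only up to a quadratic
error in the step: over `n` equal steps the errors add up to `O(1/n)`. No sign of `g` is assumed. -/
lemma exp_mul_le_of_discrete_growth {g : ℝ → ℝ} {s e δ K : ℝ} (hse : s ≤ e) (hδ : 0 ≤ δ)
    (hK : 0 ≤ K)
    (h : ∀ t ∈ Set.Icc s e, ∀ t' ∈ Set.Icc s e, t ≤ t' →
      (1 + δ * (t' - t)) * g t - K * (t' - t) ^ 2 ≤ g t') :
    Real.exp (δ * (e - s)) * g s ≤ g e := by
  have key : ∀ n : ℕ, 0 < n →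
      (1 + δ * (e - s) / n) ^ n * (g s - K * (e - s) ^ 2 * (1 / (n : ℝ))) ≤ g e := by
    intro n hn
    have hn' : (0 : ℝ) < n := by exact_mod_cast hn
    set w : ℝ := (e - s) / n with hw
    have hw0 : 0 ≤ w := div_nonneg (by linarith) hn'.le
    have hnw : n * w = e - s := by rw [hw]; field_simp
    set r : ℝ := 1 + δ * w with hr
    have hr1 : 1 ≤ r := by rw [hr]; nlinarith [mul_nonneg hδ hw0]
    have step : ∀ j : ℕ, j ≤ n → r ^ j * (g s - K * w ^ 2 * j) ≤ g (s + j * w) := by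
      intro j
      induction j with
      | zero => intro _; simp
      | succ j ih =>
        intro hj
        have ih := ih (by omega)
        have hjn : ((j : ℝ) + 1) ≤ n := by exact_mod_cast hj
        have hj0 : (0 : ℝ) ≤ j := Nat.cast_nonneg j
        have b1 : (j : ℝ) * w ≤ n * w := mul_le_mul_of_nonneg_right (by linarith) hw0
        have b2 : ((j : ℝ) + 1) * w ≤ n * w := mul_le_mul_of_nonneg_right hjn hw0
        have b3 : 0 ≤ (j : ℝ) * w := mul_nonneg hj0 hw0
        have h1 := h (s + j * w) ⟨by linarith, by linarith⟩ (s + (j + 1) * w)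
          ⟨by nlinarith, by linarith⟩ (by nlinarith)
        have e1 : s + ((j : ℝ) + 1) * w - (s + j * w) = w := by ring
        rw [e1] at h1
        have h2 : r * (r ^ j * (g s - K * w ^ 2 * j)) ≤ r * g (s + j * w) :=
          mul_le_mul_of_nonneg_left ih (by linarith)
        have h3 : 1 ≤ r ^ (j + 1) := one_le_pow₀ hr1
        have h4 : K * w ^ 2 ≤ r ^ (j + 1) * (K * w ^ 2) :=
          le_mul_of_one_le_left (by positivity) h3
        push_cast
        calc r ^ (j + 1) * (g s - K * w ^ 2 * (j + 1))
            = r * (r ^ j * (g s - K * w ^ 2 * j)) - r ^ (j + 1) * (K * w ^ 2) := by ring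
          _ ≤ _ := by linarith
    have := step n le_rfl
    rw [hnw, add_sub_cancel] at this
    convert this using 3
    · rw [hr, hw]; ring
    · rw [hw]; field_simp
  have hl : Tendsto (fun n : ℕ => (1 + δ * (e - s) / n) ^ n *
      (g s - K * (e - s) ^ 2 * (1 / (n : ℝ)))) atTop
      (𝓝 (Real.exp (δ * (e - s)) * (g s - K * (e - s) ^ 2 * 0))) :=
    (Real.tendsto_one_add_div_pow_exp _).mul
      (tendsto_const_nhds.sub (tendsto_const_nhds.mul tendsto_one_div_atTop_nhds_zero_nat))
  have := le_of_tendsto hl (eventually_atTop.2 ⟨1, fun n hn => key n hn⟩)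
  simpa using this

/-- A function whose decrease over each step is at most quadratic in its length does not
decrease. -/
lemma le_of_quadratic_defect {g : ℝ → ℝ} {s e K : ℝ} (hse : s ≤ e) (hK : 0 ≤ K)
    (h : ∀ t ∈ Set.Icc s e, ∀ t' ∈ Set.Icc s e, t ≤ t' → g t - K * (t' - t) ^ 2 ≤ g t') :
    g s ≤ g e := by
  simpa using exp_mul_le_of_discrete_growth (δ := 0) hse le_rfl hK (by simpa using h)

/-! ### Calculus of 2-homogeneous functions -/

section Homogeneous

variable {n : ℕ} {F : Type*} [NormedAddCommGroup F] [NormedSpace ℝ F] {f : Euc n → F}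

lemma exists_sphere_smul {x : Euc n} (hx : x ≠ 0) :
    ∃ y ∈ Metric.sphere (0 : Euc n) 1, x = ‖x‖ • y := by
  have hx' : ‖x‖ ≠ 0 := norm_ne_zero_iff.2 hx
  exact ⟨‖x‖⁻¹ • x, by simp [norm_smul, hx'], by rw [smul_smul, mul_inv_cancel₀ hx', one_smul]⟩

lemma TwoHomogeneous.map_zero (hf : TwoHomogeneous f) : f 0 = 0 := by
  have h := hf 2 two_pos 0
  rw [smul_zero] at h
  have h3 : (3 : ℝ) • f 0 = 0 := by
    have : (3 : ℝ) • f 0 = (2 : ℝ) ^ 2 • f 0 - f 0 := by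
      rw [show (2 : ℝ) ^ 2 = 3 + 1 by norm_num, add_smul, one_smul]; abel
    rw [this, ← h, sub_self]
  simpa using h3

lemma TwoHomogeneous.norm_le (hf : TwoHomogeneous f) {B : ℝ}
    (hB : ∀ x ∈ Metric.sphere (0 : Euc n) 1, ‖f x‖ ≤ B) (x : Euc n) : ‖f x‖ ≤ B * ‖x‖ ^ 2 := by
  rcases eq_or_ne x 0 with rfl | hx
  · simp [hf.map_zero]
  · obtain ⟨y, hy, hxy⟩ := exists_sphere_smul hx
    have hx' : 0 < ‖x‖ := norm_pos_iff.2 hx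
    have : f x = ‖x‖ ^ 2 • f y := by conv_lhs => rw [hxy, hf _ hx']
    rw [this, norm_smul, Real.norm_of_nonneg (by positivity), mul_comm]
    exact mul_le_mul_of_nonneg_right (hB y hy) (by positivity)

lemma TwoHomogeneous.le_of_sphere {f : Euc n → ℝ} (hf : TwoHomogeneous f) {b : ℝ}
    (hB : ∀ x ∈ Metric.sphere (0 : Euc n) 1, b ≤ f x) (x : Euc n) : b * ‖x‖ ^ 2 ≤ f x := by
  rcases eq_or_ne x 0 with rfl | hx
  · simp [hf.map_zero]
  · obtain ⟨y, hy, hxy⟩ := exists_sphere_smul hx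
    have hx' : 0 < ‖x‖ := norm_pos_iff.2 hx
    have : f x = ‖x‖ ^ 2 • f y := by conv_lhs => rw [hxy, hf _ hx']
    rw [this, smul_eq_mul, mul_comm]
    exact mul_le_mul_of_nonneg_left (hB y hy) (by positivity)

lemma TwoHomogeneous.fderiv_smul (hf : TwoHomogeneous f) {c : ℝ}
    (hc : 0 < c) (x : Euc n) : fderiv ℝ f (c • x) = c • fderiv ℝ f x := by
  have h1 : fderiv ℝ (fun y => f (c • y)) x = c • fderiv ℝ f (c • x) := fderiv_comp_smul _
  have h2 : (fun y => f (c • y)) = fun y => c ^ 2 • f y := funext (hf c hc)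
  have h3 : fderiv ℝ (fun y => c ^ 2 • f y) x = c ^ 2 • fderiv ℝ f x := by
    rw [show (fun y => c ^ 2 • f y) = c ^ 2 • f from rfl, fderiv_const_smul_field]; rfl
  rw [h2, h3, sq, ← smul_smul] at h1
  exact (smul_right_injective _ hc.ne' h1).symm

/-- Euler's identity. -/
lemma TwoHomogeneous.euler (hf : TwoHomogeneous f) (hd : Differentiable ℝ f) (x : Euc n) :
    fderiv ℝ f x x = (2 : ℝ) • f x := by
  have h1 : HasDerivAt (fun c : ℝ => f (c • x)) (fderiv ℝ f x x) 1 := by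
    have hx : HasDerivAt (fun c : ℝ => c • x) x 1 := by
      simpa using (hasDerivAt_id (1 : ℝ)).smul_const x
    have := (hd ((1 : ℝ) • x)).hasFDerivAt.comp_hasDerivAt (1 : ℝ) hx
    simpa [Function.comp_def] using this
  have h2 : HasDerivAt (fun c : ℝ => f (c • x)) ((2 : ℝ) • f x) 1 := by
    have h3 : HasDerivAt (fun c : ℝ => c ^ 2 • f x) ((2 : ℝ) • f x) 1 := by
      simpa using (hasDerivAt_pow 2 (1 : ℝ)).smul_const (f x)
    refine h3.congr_of_eventuallyEq ?_
    filter_upwards [lt_mem_nhds (show (0 : ℝ) < 1 by norm_num)] with c hc using hf c hc x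
  exact h1.unique h2

lemma hasFDerivAt_zero_of_norm_le_sq {A : ℝ} (h : ∀ x, ‖f x‖ ≤ A * ‖x‖ ^ 2) :
    HasFDerivAt f (0 : Euc n →L[ℝ] F) 0 := by
  have h0 : f 0 = 0 := by simpa using h 0
  have : f =O[𝓝 0] fun x => ‖x - 0‖ ^ 2 :=
    Asymptotics.IsBigO.of_bound A (Eventually.of_forall fun x => by simpa using h x)
  have := this.hasFDerivAt (𝕜 := ℝ) one_lt_two
  exact this

lemma TwoHomogeneous.fderiv_zero {f : Euc n → F} (hf : TwoHomogeneous f)  :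
    fderiv ℝ f 0 = 0 := by
  have h := hf.fderiv_smul two_pos 0
  rw [smul_zero, two_smul] at h
  simpa using h

lemma TwoHomogeneous.norm_fderiv_le (hf : TwoHomogeneous f) {M : ℝ}
    (hM : ∀ x ∈ Metric.sphere (0 : Euc n) 1, ‖fderiv ℝ f x‖ ≤ M) (x : Euc n) :
    ‖fderiv ℝ f x‖ ≤ M * ‖x‖ := by
  rcases eq_or_ne x 0 with rfl | hx
  · simp [hf.fderiv_zero]
  · obtain ⟨y, hy, hxy⟩ := exists_sphere_smul hx
    have hx' : 0 < ‖x‖ := norm_pos_iff.2 hx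
    have : fderiv ℝ f x = ‖x‖ • fderiv ℝ f y := by conv_lhs => rw [hxy, hf.fderiv_smul hx']
    rw [this, norm_smul, Real.norm_of_nonneg (by positivity), mul_comm]
    exact mul_le_mul_of_nonneg_right (hM y hy) (by positivity)

/-- A 2-homogeneous map that is bounded and Lipschitz on the unit sphere has derivative of at most
linear growth. The radial part of the derivative is controlled by the bound, the tangential part by
the Lipschitz constant. -/
lemma TwoHomogeneous.norm_fderiv_le_of_lipschitz_sphere (hf : TwoHomogeneous f) {B M : ℝ}
    (hB : ∀ x ∈ Metric.sphere (0 : Euc n) 1, ‖f x‖ ≤ B) (hM0 : 0 ≤ M)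
    (hM : ∀ x ∈ Metric.sphere (0 : Euc n) 1, ∀ y ∈ Metric.sphere (0 : Euc n) 1,
      ‖f x - f y‖ ≤ M * ‖x - y‖) (x : Euc n) :
    ‖fderiv ℝ f x‖ ≤ 2 * (M + B) * ‖x‖ := by
  refine hf.norm_fderiv_le (fun x hx => ?_) x
  have hx1 : ‖x‖ = 1 := by simpa using hx
  have hB0 : 0 ≤ B := (norm_nonneg _).trans (hB x hx)
  -- The local Lipschitz constant near `x` exceeds the claimed bound by an arbitrarily small `η`.
  refine le_of_forall_pos_le_add fun η hη => ?_
  have hlim : Tendsto (fun y : Euc n => 2 * M + (‖y‖ + 1) * B) (𝓝 x)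
      (𝓝 (2 * M + (‖x‖ + 1) * B)) :=
    (Continuous.tendsto (by fun_prop) x)
  have hev : ∀ᶠ y in 𝓝 x, 2 * M + (‖y‖ + 1) * B < 2 * (M + B) + η := by
    refine hlim.eventually_lt_const ?_
    rw [hx1]; linarith
  have hne : ∀ᶠ y in 𝓝 x, y ≠ 0 := by
    refine isOpen_ne.mem_nhds ?_
    rintro rfl
    simp at hx1
  refine norm_fderiv_le_of_lip' ℝ (by positivity) ?_
  filter_upwards [hev, hne] with y hy hy0
  obtain ⟨z, hz, hyz⟩ := exists_sphere_smul hy0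
  have hz1 : ‖z‖ = 1 := by simpa using hz
  have hy' : 0 < ‖y‖ := norm_pos_iff.2 hy0
  have hfy : f y = ‖y‖ ^ 2 • f z := by conv_lhs => rw [hyz, hf _ hy']
  have h1 : f y - f x = (f z - f x) + (‖y‖ ^ 2 - 1) • f z := by
    rw [hfy, sub_smul, one_smul]; abel
  have h2 : |‖y‖ - 1| ≤ ‖y - x‖ := by
    have := abs_norm_sub_norm_le y x
    rwa [hx1] at this
  have h3 : ‖z - x‖ ≤ 2 * ‖y - x‖ := by
    have e : z - x = (z - y) + (y - x) := by abel
    have e2 : z - y = (1 - ‖y‖) • z := by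
      conv_lhs => rw [hyz]
      rw [sub_smul, one_smul]
    have h4 : ‖z - y‖ ≤ ‖y - x‖ := by
      rw [e2, norm_smul, hz1, mul_one, Real.norm_eq_abs, abs_sub_comm]; exact h2
    rw [e]
    exact (norm_add_le _ _).trans (by linarith)
  have h5 : ‖(‖y‖ ^ 2 - 1) • f z‖ ≤ (‖y‖ + 1) * ‖y - x‖ * B := by
    rw [norm_smul, Real.norm_eq_abs, show ‖y‖ ^ 2 - 1 = (‖y‖ + 1) * (‖y‖ - 1) by ring, abs_mul,
      abs_of_nonneg (by positivity : 0 ≤ ‖y‖ + 1)]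
    gcongr
    exact hB z hz
  calc ‖f y - f x‖ ≤ ‖f z - f x‖ + ‖(‖y‖ ^ 2 - 1) • f z‖ := by rw [h1]; exact norm_add_le _ _
    _ ≤ M * (2 * ‖y - x‖) + (‖y‖ + 1) * ‖y - x‖ * B :=
        add_le_add ((hM z hz x hx).trans (mul_le_mul_of_nonneg_left h3 hM0)) h5
    _ = (2 * M + (‖y‖ + 1) * B) * ‖y - x‖ := by ring
    _ ≤ _ := mul_le_mul_of_nonneg_right hy.le (norm_nonneg _)

end Homogeneous

/-! ### Convexity and smoothness of the loss -/

lemma norm_gradient_eq {n : ℕ} (f : Euc n → ℝ) (x : Euc n) : ‖gradient f x‖ = ‖fderiv ℝ f x‖ := by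
  simp [gradient]

section Loss

variable {k : ℕ} {R : Euc k → ℝ} {M_R C_R : ℝ}

lemma LossRegular.lipschitz_gradient (hR : LossRegular R M_R C_R) (a b : Euc k) :
    ‖gradient R b - gradient R a‖ ≤ C_R * ‖b - a‖ :=
  Convex.norm_image_sub_le_of_norm_fderiv_le (𝕜 := ℝ)
    (fun x _ => hR.differentiable_gradient x) (fun x _ => hR.hessian_le x) convex_univ
    (Set.mem_univ a) (Set.mem_univ b)

/-- The graph of `R` lies above its tangent hyperplanes. -/
lemma LossRegular.tangent_le (hR : LossRegular R M_R C_R) (a b : Euc k) :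
    R a + inner ℝ (gradient R a) (b - a) ≤ R b := by
  have h1 : HasDerivAt (fun t : ℝ => R (a + t • (b - a))) (inner ℝ (gradient R a) (b - a)) 0 := by
    have hx : HasDerivAt (fun t : ℝ => a + t • (b - a)) (b - a) 0 := by
      simpa using ((hasDerivAt_id (0 : ℝ)).smul_const (b - a)).const_add a
    have := (hR.differentiable (a + (0 : ℝ) • (b - a))).hasFDerivAt.comp_hasDerivAt (0 : ℝ) hx
    rw [inner_gradient_left]
    simpa [Function.comp_def] using this
  have hc : ConvexOn ℝ Set.univ (fun t : ℝ => R (a + t • (b - a))) := by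
    refine ⟨convex_univ, fun s _ t _ p q hp hq hpq => ?_⟩
    have := hR.convex.2 (Set.mem_univ (a + s • (b - a))) (Set.mem_univ (a + t • (b - a))) hp hq hpq
    refine le_trans (le_of_eq ?_) this
    rw [smul_add, smul_add, add_add_add_comm, ← add_smul, hpq, one_smul, smul_smul, smul_smul,
      ← add_smul, smul_eq_mul, smul_eq_mul]
  have := hc.le_slope_of_hasDerivAt (Set.mem_univ 0) (Set.mem_univ 1) one_pos h1
  simp only [slope_def_field, one_smul, zero_smul, add_zero, sub_zero, div_one,
    add_sub_cancel] at this
  linarith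

/-- The quadratic upper bound; by convexity it follows from the tangent inequality at `b` and the
Lipschitz bound on the gradient. -/
lemma LossRegular.le_tangent_add (hR : LossRegular R M_R C_R) (a b : Euc k) :
    R b ≤ R a + inner ℝ (gradient R a) (b - a) + C_R * ‖b - a‖ ^ 2 := by
  have h1 := hR.tangent_le b a
  have h2 : inner ℝ (gradient R b - gradient R a) (b - a) ≤ C_R * ‖b - a‖ ^ 2 := by
    refine (real_inner_le_norm _ _).trans ?_
    rw [sq, ← mul_assoc]
    exact mul_le_mul_of_nonneg_right (hR.lipschitz_gradient a b) (norm_nonneg _)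
  rw [← neg_sub b a, inner_neg_right] at h1
  rw [inner_sub_left] at h2
  linarith

end Loss

/-! ### Spherical caps -/

section Sphere

open scoped Pointwise

lemma toSphere_univ_ne_zero (d : ℕ) :
    (volume : Measure (Euc (d + 1))).toSphere Set.univ ≠ 0 := by
  rw [Measure.measure_univ_ne_zero]
  exact Measure.toSphere_ne_zero _

instance (d : ℕ) : IsProbabilityMeasure (uniformSphere d) := by
  constructor
  rw [uniformSphere, Measure.smul_apply, Measure.map_apply measurable_subtype_coe MeasurableSet.univ,
    Set.preimage_univ, smul_eq_mul]
  exact ENNReal.inv_mul_cancel (toSphere_univ_ne_zero d) (measure_ne_top _ _)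

lemma ae_mem_sphere_uniformSphere (d : ℕ) :
    ∀ᵐ x ∂(uniformSphere d), x ∈ Metric.sphere (0 : Euc (d + 1)) 1 := by
  refine Measure.ae_smul_measure ?_ _
  refine (ae_map_iff (p := fun x => x ∈ Metric.sphere (0 : Euc (d + 1)) 1)
    measurable_subtype_coe.aemeasurable Metric.isClosed_sphere.measurableSet).2 ?_
  exact Eventually.of_forall fun x => x.2

/-- The uniform measure of a spherical cap, bounded below through the cone over the cap: the cone
over the cap of radius `r` about `x` contains the ball of radius `r / 4` about `x / 2`. -/
lemma pow_le_uniformSphere_ball (d : ℕ) {x : Euc (d + 1)} (hx : x ∈ Metric.sphere (0 : Euc (d + 1)) 1)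
    {r : ℝ} (hr : 0 < r) (hr1 : r ≤ 1) :
    (r / 4) ^ (d + 1) ≤ (uniformSphere d).real (Metric.ball x r) := by
  have hx1 : ‖x‖ = 1 := by simpa using hx
  set s : Set (Metric.sphere (0 : Euc (d + 1)) 1) := Subtype.val ⁻¹' Metric.ball x r with hs
  have hsm : MeasurableSet s := measurable_subtype_coe Metric.isOpen_ball.measurableSet
  have hsub : Metric.ball ((1 / 2 : ℝ) • x) (r / 4) ⊆
      Set.Ioo (0 : ℝ) 1 • ((↑) '' s : Set (Euc (d + 1))) := by
    intro y hy
    rw [Metric.mem_ball, dist_eq_norm] at hy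
    have hhx : ‖(1 / 2 : ℝ) • x‖ = 1 / 2 := by rw [norm_smul, hx1]; norm_num
    have h1 : |‖y‖ - 1 / 2| < r / 4 := by
      have := abs_norm_sub_norm_le y ((1 / 2 : ℝ) • x)
      rw [hhx] at this
      exact this.trans_lt hy
    rw [abs_lt] at h1
    have hy0 : 0 < ‖y‖ := by linarith
    obtain ⟨z, hz, hyz⟩ := exists_sphere_smul (norm_pos_iff.1 hy0)
    have hz1 : ‖z‖ = 1 := by simpa using hz
    refine Set.mem_smul.2 ⟨‖y‖, ⟨hy0, by linarith⟩, z, ⟨⟨z, hz⟩, ?_, rfl⟩, hyz.symm⟩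
    rw [hs, Set.mem_preimage, Metric.mem_ball, dist_eq_norm]
    have e : z - x = (2 : ℝ) • ((1 / 2 - ‖y‖) • z + (y - (1 / 2 : ℝ) • x)) := by
      conv_rhs => rw [hyz]
      rw [norm_smul, hz1, norm_norm, mul_one, sub_smul, smul_add, smul_sub, smul_sub, smul_smul, smul_smul]
      norm_num
      rw [smul_smul]
      norm_num
    have h2 : ‖(1 / 2 - ‖y‖) • z‖ < r / 4 := by
      rw [norm_smul, hz1, mul_one, Real.norm_eq_abs, abs_lt]; constructor <;> linarith
    rw [e, norm_smul, Real.norm_of_nonneg two_pos.le]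
    have := norm_add_le ((1 / 2 - ‖y‖) • z) (y - (1 / 2 : ℝ) • x)
    linarith
  have hball : volume (Metric.ball ((1 / 2 : ℝ) • x) (r / 4)) =
      ENNReal.ofReal ((r / 4) ^ (d + 1)) * volume (Metric.ball (0 : Euc (d + 1)) 1) := by
    rw [Measure.addHaar_ball volume _ (by positivity)]
    simp
  have h : ENNReal.ofReal ((r / 4) ^ (d + 1)) ≤ uniformSphere d (Metric.ball x r) := by
    rw [uniformSphere, Measure.smul_apply, Measure.map_apply measurable_subtype_coe
      Metric.isOpen_ball.measurableSet, smul_eq_mul, ← hs, mul_comm, ← div_eq_mul_inv,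
      ENNReal.le_div_iff_mul_le (Or.inl (toSphere_univ_ne_zero d)) (Or.inl (measure_ne_top _ _)),
      Measure.toSphere_apply_univ, Measure.toSphere_apply' _ hsm, mul_left_comm, ← hball]
    gcongr
  rw [measureReal_def]
  exact (ENNReal.ofReal_le_iff_le_toReal (measure_ne_top _ _)).1 h

end Sphere

/-! ### Mollification with convergence of derivatives at every point -/

section Mollify

open scoped Convolution

variable {n : ℕ}

/-- The convolution of `ψ` with the rescaled kernel `y ↦ cⁿ η (c y)`. -/
noncomputable def mollify (η ψ : Euc n → ℝ) (c : ℝ) : Euc n → ℝ :=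
  (fun y => c ^ n * η (c • y)) ⋆[ContinuousLinearMap.lsmul ℝ ℝ, volume] ψ

variable {η ψ : Euc n → ℝ} {c : ℝ}

lemma integral_rescale (hc : 0 < c) (g : Euc n → ℝ) :
    ∫ t, c ^ n * g (c • t) = ∫ z, g z := by
  rw [integral_const_mul, Measure.integral_comp_smul_of_nonneg volume g c (hR := hc.le)]
  simp [hc.ne']

lemma mollify_apply (hc : 0 < c) (x : Euc n) :
    mollify η ψ c x = ∫ z, η z * ψ (x - c⁻¹ • z) := by
  rw [mollify, convolution_def,
    ← integral_rescale hc (fun z => η z * ψ (x - c⁻¹ • z))]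
  refine integral_congr_ae (Eventually.of_forall fun t => ?_)
  simp [smul_smul, hc.ne', mul_assoc]

lemma hasCompactSupport_rescale (hη : HasCompactSupport η) (hc : 0 < c) :
    HasCompactSupport (fun y => c ^ n * η (c • y)) :=
  HasCompactSupport.mul_left (f := fun _ => c ^ n) (hη.comp_smul hc.ne')

lemma contDiff_mollify (hη : HasCompactSupport η) (hη' : ContDiff ℝ ∞ η) (hψ : Continuous ψ)
    (hc : 0 < c) : ContDiff ℝ ∞ (mollify η ψ c) :=
  (hasCompactSupport_rescale hη hc).contDiff_convolution_left _ (by fun_prop)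
    hψ.locallyIntegrable

/-- The derivative of the mollification, with the derivative falling on the kernel. -/
lemma fderiv_mollify_apply (hη : HasCompactSupport η) (hη' : ContDiff ℝ ∞ η) (hψ : Continuous ψ)
    (hc : 0 < c) (x h : Euc n) :
    fderiv ℝ (mollify η ψ c) x h = ∫ z, fderiv ℝ η z h * (c * ψ (x - c⁻¹ • z)) := by
  have hη1 : Differentiable ℝ η := hη'.differentiable (by simp)
  have hcs := hasCompactSupport_rescale hη hc
  have hcd : ContDiff ℝ 1 (fun y : Euc n => c ^ n * η (c • y)) :=
    (show ContDiff ℝ ∞ (fun y : Euc n => c ^ n * η (c • y)) by fun_prop).of_le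
      (by exact_mod_cast le_top)
  have h1 := (hcs.hasFDerivAt_convolution_left (ContinuousLinearMap.lsmul ℝ ℝ) (μ := volume)
    hcd hψ.locallyIntegrable x).fderiv
  have hex : ConvolutionExistsAt (fderiv ℝ (fun y : Euc n => c ^ n * η (c • y))) ψ x
      ((ContinuousLinearMap.lsmul ℝ ℝ).precompL (Euc n)) volume :=
    (hcs.fderiv ℝ).convolutionExists_left _ (hcd.continuous_fderiv one_ne_zero)
      hψ.locallyIntegrable x
  rw [mollify, h1, convolution_def, ContinuousLinearMap.integral_apply hex,
    ← integral_rescale hc (fun z => fderiv ℝ η z h * (c * ψ (x - c⁻¹ • z)))]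
  refine integral_congr_ae (Eventually.of_forall fun t => ?_)
  have h2 : fderiv ℝ (fun y : Euc n => c ^ n * η (c • y)) t = c ^ n • c • fderiv ℝ η (c • t) := by
    rw [fderiv_const_mul (by fun_prop), fderiv_comp_smul]
  simp [h2, smul_smul, hc.ne', ContinuousLinearMap.precompL_apply]
  ring

/-- Integration by parts of a normalized kernel against the affine function `b - ℓ`. -/
lemma integral_fderiv_mul_eq (hη : HasCompactSupport η) (hη' : ContDiff ℝ ∞ η)
    (hη1 : ∫ z, η z = 1) (b : ℝ) (ℓ : Euc n →L[ℝ] ℝ) (h : Euc n) :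
    ∫ z, fderiv ℝ η z h * (b - ℓ z) = ℓ h := by
  have hd : Differentiable ℝ η := hη'.differentiable (by simp)
  have hc' : Continuous (fderiv ℝ η) := hη'.continuous_fderiv (by simp)
  have hcs' : HasCompactSupport (fun z => fderiv ℝ η z h) := hη.fderiv_apply ℝ h
  have hg : ∀ z, fderiv ℝ (fun z => ℓ z - b) z = ℓ := fun z => by
    rw [fderiv_sub_const]; exact ℓ.fderiv
  have := integral_mul_fderiv_eq_neg_fderiv_mul_of_integrable (μ := (volume : Measure (Euc n)))
    (f := η) (g := fun z => ℓ z - b) (v := h)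
    (Continuous.integrable_of_hasCompactSupport (by fun_prop) hcs'.mul_right)
    (Continuous.integrable_of_hasCompactSupport (by simp only [hg]; fun_prop) hη.mul_right)
    (Continuous.integrable_of_hasCompactSupport (by fun_prop) hη.mul_right)
    (fun x _ => hd x) (fun x _ => by fun_prop)
  simp only [hg] at this
  rw [integral_mul_const, hη1, one_mul, ← integral_neg] at this
  rw [this]
  congr 1 with z
  ring

/-- Every differentiable function of compact support with bounded derivative is approximated by
smooth functions of compact support whose derivatives converge at *every* point, although the
derivative of the limit need not be continuous. -/
lemma exists_smooth_approx (hd : Differentiable ℝ ψ) (hs : HasCompactSupport ψ) {A : ℝ}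
    (hA : ∀ x, ‖fderiv ℝ ψ x‖ ≤ A) :
    ∃ (ψ' : ℕ → Euc n → ℝ) (B : ℝ), (∀ j, ContDiff ℝ ∞ (ψ' j)) ∧
      (∀ j, HasCompactSupport (ψ' j)) ∧ (∀ j x, |ψ' j x| ≤ B) ∧
      (∀ j x, ‖fderiv ℝ (ψ' j) x‖ * ‖x‖ ≤ B) ∧
      (∀ x, Tendsto (fun j => ψ' j x) atTop (𝓝 (ψ x))) ∧
      ∀ x h, Tendsto (fun j => fderiv ℝ (ψ' j) x h) atTop (𝓝 (fderiv ℝ ψ x h)) := by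
  let b : ContDiffBump (0 : Euc n) := ⟨1, 2, one_pos, one_lt_two⟩
  set η : Euc n → ℝ := b.normed volume with hη_def
  have hη : HasCompactSupport η := b.hasCompactSupport_normed
  have hη' : ContDiff ℝ ∞ η := b.contDiff_normed
  have hη1 : ∫ z, η z = 1 := b.integral_normed
  have hη0 : ∀ z, 0 ≤ η z := b.nonneg_normed
  have hηz : ∀ z, η z ≠ 0 → ‖z‖ < 2 := fun z hz => by
    have : z ∈ Function.support η := hz
    rw [hη_def, b.support_normed_eq] at this
    simpa using this
  have hηc : Continuous η := hη'.continuous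
  have hηi : Integrable η := hηc.integrable_of_hasCompactSupport hη
  have hψ : Continuous ψ := hd.continuous
  have hA0 : 0 ≤ A := (norm_nonneg _).trans (hA 0)
  have hlip : ∀ x y, |ψ x - ψ y| ≤ A * ‖x - y‖ := fun x y =>
    Convex.norm_image_sub_le_of_norm_fderiv_le (𝕜 := ℝ) (fun x _ => hd x) (fun x _ => hA x)
      convex_univ (Set.mem_univ y) (Set.mem_univ x)
  obtain ⟨B₀, hB₀⟩ := hs.exists_bound_of_continuous hψ
  obtain ⟨r, hr⟩ := hs.isCompact.isBounded.subset_closedBall (0 : Euc n)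
  have hψ0 : ∀ x, r < ‖x‖ → ψ x = 0 := fun x hx => by
    by_contra h
    have := hr (subset_tsupport _ h)
    simp at this
    linarith
  have hpos : ∀ j : ℕ, (0 : ℝ) < (j : ℝ) + 1 := fun j => by positivity
  have hint : ∀ (j : ℕ) x, Integrable (fun z => η z * ψ (x - ((j : ℝ) + 1)⁻¹ • z)) := fun j x =>
    Continuous.integrable_of_hasCompactSupport (by fun_prop) hη.mul_right
  have hB₀0 : 0 ≤ B₀ := (norm_nonneg _).trans (hB₀ 0)
  have hdlip : ∀ j x y, |mollify η ψ ((j : ℕ) + 1 : ℝ) x - mollify η ψ ((j : ℝ) + 1) y|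
      ≤ A * ‖x - y‖ := by
    intro j x y
    rw [mollify_apply (hpos j), mollify_apply (hpos j), ← integral_sub (hint j x) (hint j y)]
    have : ‖∫ z, (η z * ψ (x - ((j : ℝ) + 1)⁻¹ • z) - η z * ψ (y - ((j : ℝ) + 1)⁻¹ • z))‖
        ≤ ∫ z, η z * (A * ‖x - y‖) := by
      refine norm_integral_le_of_norm_le (hηi.mul_const _) (Eventually.of_forall fun z => ?_)
      rw [← mul_sub, norm_mul, Real.norm_of_nonneg (hη0 z)]
      refine mul_le_mul_of_nonneg_left ?_ (hη0 z)
      simpa using hlip (x - ((j : ℝ) + 1)⁻¹ • z) (y - ((j : ℝ) + 1)⁻¹ • z)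
    rwa [integral_mul_const, hη1, one_mul] at this
  refine ⟨fun j => mollify η ψ (j + 1), max B₀ (A * (|r| + 2)), fun j =>
    contDiff_mollify hη hη' hψ (hpos j), fun j =>
    HasCompactSupport.convolution _ (hasCompactSupport_rescale hη (hpos j)) hs, fun j x => ?_,
    fun j x => ?_, fun x => ?_, fun x h => ?_⟩
  · refine le_trans ?_ (le_max_left _ _)
    beta_reduce
    rw [mollify_apply (hpos j), ← Real.norm_eq_abs]
    calc _ ≤ ∫ z, η z * B₀ := by
          refine norm_integral_le_of_norm_le (hηi.mul_const _) (Eventually.of_forall fun z => ?_)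
          rw [norm_mul, Real.norm_of_nonneg (hη0 z)]
          exact mul_le_mul_of_nonneg_left (hB₀ _) (hη0 z)
      _ = B₀ := by rw [integral_mul_const, hη1, one_mul]
  · refine le_trans ?_ (le_max_right _ _)
    rcases le_or_gt ‖x‖ (|r| + 2) with hx | hx
    · refine mul_le_mul ?_ hx (norm_nonneg _) hA0
      exact norm_fderiv_le_of_lip' ℝ hA0 (Eventually.of_forall fun y => hdlip j y x)
    · have hz : mollify η ψ (j + 1) =ᶠ[𝓝 x] fun _ => 0 := by
        filter_upwards [(isOpen_lt continuous_const continuous_norm).mem_nhds hx] with y hy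
        rw [mollify_apply (hpos j)]
        refine integral_eq_zero_of_ae (Eventually.of_forall fun z => ?_)
        by_cases hz : η z = 0
        · simp [hz]
        · have h1 := hηz z hz
          have h2 : ‖((j : ℝ) + 1)⁻¹ • z‖ ≤ ‖z‖ := by
            rw [norm_smul, norm_inv, Real.norm_of_nonneg (hpos j).le]
            refine mul_le_of_le_one_left (norm_nonneg _) (inv_le_one_of_one_le₀ ?_)
            have : (0 : ℝ) ≤ j := Nat.cast_nonneg j
            linarith
          have h3 := norm_sub_norm_le y (((j : ℝ) + 1)⁻¹ • z)
          have hy' : |r| + 2 < ‖y‖ := hy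
          have : r < ‖y - ((j : ℝ) + 1)⁻¹ • z‖ := by linarith [le_abs_self r]
          simp [hψ0 _ this]
      rw [hz.fderiv_eq]
      simp
      positivity
  · have hj : Tendsto (fun j : ℕ => ((j : ℝ) + 1)⁻¹) atTop (𝓝 0) := by
      simpa [one_div] using tendsto_one_div_add_atTop_nhds_zero_nat (𝕜 := ℝ)
    have : Tendsto (fun j : ℕ => ∫ z, η z * ψ (x - ((j : ℝ) + 1)⁻¹ • z)) atTop
        (𝓝 (∫ z, η z * ψ x)) := by
      refine tendsto_integral_of_dominated_convergence (fun z => η z * B₀)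
        (fun j => (hint j x).aestronglyMeasurable) (hηi.mul_const _) (fun j =>
          Eventually.of_forall fun z => ?_) (Eventually.of_forall fun z => ?_)
      · rw [norm_mul, Real.norm_of_nonneg (hη0 z)]
        exact mul_le_mul_of_nonneg_left (hB₀ _) (hη0 z)
      · refine Tendsto.const_mul _ ((hψ.tendsto x).comp ?_)
        simpa using (tendsto_const_nhds (x := x)).sub (hj.smul_const z)
    rw [integral_mul_const, hη1, one_mul] at this
    refine this.congr fun j => (mollify_apply (hpos j) x).symm
  · have hcη : Continuous (fderiv ℝ η) := hη'.continuous_fderiv (by simp)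
    have hcs' : HasCompactSupport (fun z => fderiv ℝ η z h) := hη.fderiv_apply ℝ h
    -- Since `∫ ∂_h η = 0`, the constant `ψ x` may be subtracted: the integrand becomes a
    -- difference quotient of `ψ` at `x`.
    have hzero : ∀ a : ℝ, ∫ z, fderiv ℝ η z h * a = 0 := fun a => by
      simpa using integral_fderiv_mul_eq hη hη' hη1 a 0 h
    have heq : ∀ j : ℕ, fderiv ℝ (mollify η ψ (j + 1)) x h =
        ∫ z, fderiv ℝ η z h * (((j : ℝ) + 1) * (ψ (x - ((j : ℝ) + 1)⁻¹ • z) - ψ x)) := by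
      intro j
      rw [fderiv_mollify_apply hη hη' hψ (hpos j), ← sub_zero (∫ z, _),
        ← hzero (((j : ℝ) + 1) * ψ x), ← integral_sub]
      · congr 1 with z
        ring
      · exact Continuous.integrable_of_hasCompactSupport (by fun_prop) hcs'.mul_right
      · exact Continuous.integrable_of_hasCompactSupport (by fun_prop) hcs'.mul_right
    have hlim : Tendsto (fun j : ℕ => ∫ z, fderiv ℝ η z h *
        (((j : ℝ) + 1) * (ψ (x - ((j : ℝ) + 1)⁻¹ • z) - ψ x))) atTop
        (𝓝 (∫ z, fderiv ℝ η z h * (0 - fderiv ℝ ψ x z))) := by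
      refine tendsto_integral_of_dominated_convergence (fun z => ‖fderiv ℝ η z h‖ * (A * ‖z‖))
        (fun j => Continuous.aestronglyMeasurable (by fun_prop))
        (Continuous.integrable_of_hasCompactSupport (by fun_prop) hcs'.norm.mul_right) (fun j =>
          Eventually.of_forall fun z => ?_) (Eventually.of_forall fun z => ?_)
      · rw [norm_mul]
        refine mul_le_mul_of_nonneg_left ?_ (norm_nonneg _)
        have := hlip (x - ((j : ℝ) + 1)⁻¹ • z) x
        rw [norm_mul, Real.norm_of_nonneg (hpos j).le, Real.norm_eq_abs]
        refine (mul_le_mul_of_nonneg_left this (hpos j).le).trans (le_of_eq ?_)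
        have e : x - ((j : ℝ) + 1)⁻¹ • z - x = -(((j : ℝ) + 1)⁻¹ • z) := by abel
        rw [e, norm_neg, norm_smul, norm_inv, Real.norm_of_nonneg (hpos j).le]
        have := (hpos j).ne'
        field_simp
      · refine Tendsto.const_mul _ ?_
        have hcinf : Tendsto (fun j : ℕ => ‖(j : ℝ) + 1‖) atTop atTop :=
          tendsto_norm_atTop_atTop.comp
            (tendsto_atTop_add_const_right _ _ tendsto_natCast_atTop_atTop)
        have := (hd x).hasFDerivAt.lim (-z) hcinf
        rw [map_neg, ← zero_sub (fderiv ℝ ψ x z)] at this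
        refine this.congr fun j => ?_
        simp [sub_eq_add_neg]
    rw [integral_fderiv_mul_eq hη hη' hη1] at hlim
    exact hlim.congr fun j => (heq j).symm

end Mollify

/-! ### The class of admissible test functions -/

section WeakEquation

variable {d : ℕ} {σ T G : ℝ} {ρ : ℝ → Measure (Euc (d + 1))}
  {u : ℝ → Euc (d + 1) → Euc (d + 1)}

/-- The action of `-σ μ + σ U^d - ∇·(w μ)` on a test function, for an arbitrary vector field `w`. -/
noncomputable def weakRHS (σ : ℝ) (μ : Measure (Euc (d + 1))) (w : Euc (d + 1) → Euc (d + 1))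
    (φ : Euc (d + 1) → ℝ) : ℝ :=
  -σ * (∫ θ, φ θ ∂μ) + σ * (∫ θ, φ θ ∂(uniformSphere d)) + ∫ θ, fderiv ℝ φ θ (w θ) ∂μ

/-- The equation `dρ_t/dt = -σ ρ_t + σ U^d - ∇·(u_t ρ_t)` on `[0, T]`, integrated in time, holds
against the test function `φ`. -/
def SolvesAgainst (σ T : ℝ) (ρ : ℝ → Measure (Euc (d + 1)))
    (u : ℝ → Euc (d + 1) → Euc (d + 1)) (φ : Euc (d + 1) → ℝ) : Prop :=
  IntegrableOn (fun s => weakRHS σ (ρ s) (u s) φ) (Set.Icc 0 T) ∧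
    ∀ t ∈ Set.Icc 0 T, ∫ θ, φ θ ∂(ρ t) = ∫ θ, φ θ ∂(ρ 0) +
      ∫ s in (0 : ℝ)..t, weakRHS σ (ρ s) (u s) φ

/-- A weak solution on `[0, T]` of the equation with a prescribed velocity field of linear
growth, uniformly in time. No regularity of the velocity is assumed. -/
structure IsLinearGrowthSolution (σ T G : ℝ) (ρ : ℝ → Measure (Euc (d + 1)))
    (u : ℝ → Euc (d + 1) → Euc (d + 1)) : Prop where
  rate_nonneg : 0 ≤ σ
  growth_nonneg : 0 ≤ G
  mem_P₂ : ∀ t ∈ Set.Icc 0 T, ρ t ∈ P₂ (d + 1)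
  measurable : ∀ t ∈ Set.Icc 0 T, Measurable (u t)
  growth : ∀ t ∈ Set.Icc 0 T, ∀ θ, ‖u t θ‖ ≤ G * ‖θ‖
  solves : ∀ φ : Euc (d + 1) → ℝ, ContDiff ℝ ∞ φ → HasCompactSupport φ → SolvesAgainst σ T ρ u φ

lemma measurable_fderiv_apply_field {f : Euc (d + 1) → ℝ} {w : Euc (d + 1) → Euc (d + 1)}
    (hw : Measurable w) : Measurable fun θ => fderiv ℝ f θ (w θ) := by
  simp_rw [← inner_gradient_left]
  have : Measurable (gradient f) :=
    (LinearIsometryEquiv.continuous _).measurable.comp (measurable_fderiv ℝ f)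
  exact this.inner hw

lemma abs_weakRHS_le (hσ : 0 ≤ σ) (hG : 0 ≤ G) {μ : Measure (Euc (d + 1))}
    {w : Euc (d + 1) → Euc (d + 1)} (hw : ∀ θ, ‖w θ‖ ≤ G * ‖θ‖) {φ g : Euc (d + 1) → ℝ}
    (hg : Integrable g μ) (hgU : Integrable g (uniformSphere d)) (h1 : ∀ x, |φ x| ≤ g x)
    (h2 : ∀ x, ‖fderiv ℝ φ x‖ * ‖x‖ ≤ g x) :
    |weakRHS σ μ w φ| ≤ (σ + G) * (∫ θ, g θ ∂μ) + σ * ∫ θ, g θ ∂(uniformSphere d) := by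
  have e1 : |∫ θ, φ θ ∂μ| ≤ ∫ θ, g θ ∂μ := by
    rw [← Real.norm_eq_abs]; exact norm_integral_le_of_norm_le hg (Eventually.of_forall h1)
  have e2 : |∫ θ, φ θ ∂(uniformSphere d)| ≤ ∫ θ, g θ ∂(uniformSphere d) :=
    by rw [← Real.norm_eq_abs]; exact norm_integral_le_of_norm_le hgU (Eventually.of_forall h1)
  have e3 : |∫ θ, fderiv ℝ φ θ (w θ) ∂μ| ≤ ∫ θ, G * g θ ∂μ := by
    rw [← Real.norm_eq_abs]
    refine norm_integral_le_of_norm_le (hg.const_mul G) (Eventually.of_forall fun x => ?_)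
    refine (ContinuousLinearMap.le_opNorm _ _).trans ?_
    calc _ ≤ ‖fderiv ℝ φ x‖ * (G * ‖x‖) := by gcongr; exact hw x
      _ = G * (‖fderiv ℝ φ x‖ * ‖x‖) := by ring
      _ ≤ _ := by gcongr; exact h2 x
  rw [integral_const_mul] at e3
  unfold weakRHS
  refine (abs_add_le _ _).trans ((add_le_add (abs_add_le _ _) le_rfl).trans ?_)
  rw [abs_mul, abs_mul, abs_neg, abs_of_nonneg hσ]
  nlinarith [mul_le_mul_of_nonneg_left e1 hσ, mul_le_mul_of_nonneg_left e2 hσ]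

lemma SolvesAgainst.intervalIntegrable {φ : Euc (d + 1) → ℝ} (h : SolvesAgainst σ T ρ u φ) {s t : ℝ}
    (hs : s ∈ Set.Icc 0 T) (ht : t ∈ Set.Icc 0 T) :
    IntervalIntegrable (fun r => weakRHS σ (ρ r) (u r) φ) volume s t :=
  (h.1.mono_set ((Set.uIcc_subset_Icc hs ht))).intervalIntegrable

lemma SolvesAgainst.sub_eq {φ : Euc (d + 1) → ℝ} (h : SolvesAgainst σ T ρ u φ) {s t : ℝ}
    (hs : s ∈ Set.Icc 0 T) (ht : t ∈ Set.Icc 0 T) :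
    ∫ θ, φ θ ∂(ρ t) - ∫ θ, φ θ ∂(ρ s) = ∫ r in s..t, weakRHS σ (ρ r) (u r) φ := by
  have h0 : (0 : ℝ) ∈ Set.Icc 0 T := ⟨le_rfl, hs.1.trans hs.2⟩
  rw [h.2 t ht, h.2 s hs, ← intervalIntegral.integral_add_adjacent_intervals
    (h.intervalIntegrable h0 hs) (h.intervalIntegrable hs ht)]
  ring

/-- Passage to the limit in the test function, under pointwise convergence of the test function and
of its derivative, with a common bound `g` of bounded mean along the flow. -/
lemma IsLinearGrowthSolution.solvesAgainst_of_tendsto (hρ : IsLinearGrowthSolution σ T G ρ u)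
    {ψ' : ℕ → Euc (d + 1) → ℝ} {ψ g : Euc (d + 1) → ℝ} {K : ℝ}
    (hsol : ∀ j, SolvesAgainst σ T ρ u (ψ' j)) (hdiff : ∀ j, Differentiable ℝ (ψ' j))
    (hg : ∀ t ∈ Set.Icc 0 T, Integrable g (ρ t)) (hK : ∀ t ∈ Set.Icc 0 T, ∫ θ, g θ ∂(ρ t) ≤ K)
    (hgU : Integrable g (uniformSphere d)) (h1 : ∀ j x, |ψ' j x| ≤ g x)
    (h2 : ∀ j x, ‖fderiv ℝ (ψ' j) x‖ * ‖x‖ ≤ g x)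
    (l1 : ∀ x, Tendsto (fun j => ψ' j x) atTop (𝓝 (ψ x)))
    (l2 : ∀ x h, Tendsto (fun j => fderiv ℝ (ψ' j) x h) atTop (𝓝 (fderiv ℝ ψ x h))) :
    SolvesAgainst σ T ρ u ψ := by
  have hσ := hρ.rate_nonneg
  have hG := hρ.growth_nonneg
  have lim1 : ∀ μ : Measure (Euc (d + 1)), Integrable g μ →
      Tendsto (fun j => ∫ θ, ψ' j θ ∂μ) atTop (𝓝 (∫ θ, ψ θ ∂μ)) := fun μ hμ =>
    tendsto_integral_of_dominated_convergence g
      (fun j => (hdiff j).continuous.measurable.aestronglyMeasurable) hμ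
      (fun j => Eventually.of_forall (h1 j)) (Eventually.of_forall l1)
  have lim : ∀ s ∈ Set.Icc 0 T,
      Tendsto (fun j => weakRHS σ (ρ s) (u s) (ψ' j)) atTop (𝓝 (weakRHS σ (ρ s) (u s) ψ)) := by
    intro s hs
    refine (((lim1 _ (hg s hs)).const_mul _).add ((lim1 _ hgU).const_mul _)).add ?_
    refine tendsto_integral_of_dominated_convergence (fun θ => G * g θ)
      (fun j => (measurable_fderiv_apply_field (hρ.measurable s hs)).aestronglyMeasurable)
      ((hg s hs).const_mul G) (fun j => Eventually.of_forall fun x => ?_)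
      (Eventually.of_forall fun x => l2 x _)
    refine (ContinuousLinearMap.le_opNorm _ _).trans ?_
    calc _ ≤ ‖fderiv ℝ (ψ' j) x‖ * (G * ‖x‖) := by gcongr; exact hρ.growth s hs x
      _ = G * (‖fderiv ℝ (ψ' j) x‖ * ‖x‖) := by ring
      _ ≤ _ := by gcongr; exact h2 j x
  set B : ℝ := (σ + G) * K + σ * ∫ θ, g θ ∂(uniformSphere d) with hB
  have bd : ∀ j, ∀ s ∈ Set.Icc 0 T, ‖weakRHS σ (ρ s) (u s) (ψ' j)‖ ≤ B := by
    intro j s hs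
    refine (abs_weakRHS_le hσ hG (hρ.growth s hs) (hg s hs) hgU (h1 j) (h2 j)).trans ?_
    rw [hB]
    gcongr
    exact hK s hs
  have bd' : ∀ s ∈ Set.Icc 0 T, ‖weakRHS σ (ρ s) (u s) ψ‖ ≤ B := fun s hs =>
    le_of_tendsto (lim s hs).norm (Eventually.of_forall fun j => bd j s hs)
  have hae : ∀ᵐ s ∂(volume.restrict (Set.Icc 0 T)), s ∈ Set.Icc 0 T :=
    ae_restrict_mem measurableSet_Icc
  have hmeas : AEStronglyMeasurable (fun s => weakRHS σ (ρ s) (u s) ψ)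
      (volume.restrict (Set.Icc 0 T)) :=
    aestronglyMeasurable_of_tendsto_ae atTop (fun j => (hsol j).1.aestronglyMeasurable)
      (hae.mono fun s hs => lim s hs)
  refine ⟨Integrable.of_bound hmeas B (hae.mono bd'),
    fun t ht => ?_⟩
  have h0 : (0 : ℝ) ∈ Set.Icc 0 T := ⟨le_rfl, ht.1.trans ht.2⟩
  have hL := lim1 _ (hg t ht)
  have hsub : Set.uIoc 0 t ⊆ Set.Icc 0 T := fun s hs => by
    rw [Set.uIoc_of_le ht.1] at hs
    exact ⟨hs.1.le, hs.2.trans ht.2⟩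
  have hI : Tendsto (fun j => ∫ s in (0 : ℝ)..t, weakRHS σ (ρ s) (u s) (ψ' j)) atTop
      (𝓝 (∫ s in (0 : ℝ)..t, weakRHS σ (ρ s) (u s) ψ)) := by
    refine intervalIntegral.tendsto_integral_filter_of_dominated_convergence (fun _ => B)
      (Eventually.of_forall fun j => (hsol j).1.aestronglyMeasurable.mono_measure
        (Measure.restrict_mono hsub le_rfl))
      (Eventually.of_forall fun j => Eventually.of_forall fun s hs => bd j s (hsub hs))
      intervalIntegrable_const (Eventually.of_forall fun s hs => lim s (hsub hs))
  exact tendsto_nhds_unique hL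
    (((lim1 _ (hg 0 h0)).add hI).congr fun j => ((hsol j).2 t ht).symm)

/-- Continuity of the derivative of the test function is not needed, since its mollifications
converge together with their derivatives at every point. -/
lemma IsLinearGrowthSolution.solvesAgainst_of_hasCompactSupport
    (hρ : IsLinearGrowthSolution σ T G ρ u) {ψ : Euc (d + 1) → ℝ} (hd : Differentiable ℝ ψ)
    (hs : HasCompactSupport ψ) {A : ℝ} (hA : ∀ x, ‖fderiv ℝ ψ x‖ ≤ A) :
    SolvesAgainst σ T ρ u ψ := by
  obtain ⟨ψ', B, c1, c2, c3, c4, c5, c6⟩ := exists_smooth_approx hd hs hA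
  refine hρ.solvesAgainst_of_tendsto (g := fun _ => B) (K := B)
    (fun j => hρ.solves _ (c1 j) (c2 j)) (fun j => (c1 j).differentiable (by simp))
    (fun t ht => ?_) (fun t ht => ?_) (integrable_const _) c3 c4 c5 c6
  · have := (hρ.mem_P₂ t ht).1
    exact integrable_const _
  · have := (hρ.mem_P₂ t ht).1
    simp

/-- A smooth cutoff: equal to `1` on the unit ball, with values in `[0, 1]`, of compact support. -/
lemma exists_cutoff (n : ℕ) : ∃ (χ : Euc n → ℝ) (C : ℝ), Differentiable ℝ χ ∧
    HasCompactSupport χ ∧ (∀ x, 0 ≤ χ x) ∧ (∀ x, χ x ≤ 1) ∧ (∀ x, ‖x‖ ≤ 1 → χ x = 1) ∧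
    (∀ x, ‖fderiv ℝ χ x‖ ≤ C) ∧ ∀ x, ‖fderiv ℝ χ x‖ * ‖x‖ ≤ C := by
  let b : ContDiffBump (0 : Euc n) := ⟨1, 2, one_pos, one_lt_two⟩
  have hb : ContDiff ℝ 1 b := b.contDiff
  have hc : Continuous (fderiv ℝ b) := hb.continuous_fderiv one_ne_zero
  obtain ⟨C₁, h1⟩ := (b.hasCompactSupport.fderiv ℝ).exists_bound_of_continuous hc
  obtain ⟨C₂, h2⟩ := ((b.hasCompactSupport.fderiv ℝ).norm.mul_right
    (f' := fun x => ‖x‖)).exists_bound_of_continuous (hc.norm.mul continuous_norm)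
  refine ⟨b, max C₁ C₂, hb.differentiable one_ne_zero, b.hasCompactSupport, fun _ => b.nonneg,
    fun _ => b.le_one, fun x hx => b.one_of_mem_closedBall (by simpa using hx),
    fun x => (h1 x).trans (le_max_left _ _), fun x => le_trans ?_ (le_max_right _ _)⟩
  exact (le_abs_self _).trans (h2 x)

/-- Removal of the support condition by cutoff at infinity: it suffices that the test function and
`‖∇ψ‖ ‖x‖` have a common bound `g` of bounded mean along the flow. -/
lemma IsLinearGrowthSolution.solvesAgainst_of_bound (hρ : IsLinearGrowthSolution σ T G ρ u)
    {ψ g : Euc (d + 1) → ℝ} {K : ℝ} (hd : Differentiable ℝ ψ)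
    (hloc : ∀ r : ℝ, ∃ A, ∀ x, ‖x‖ ≤ r → ‖fderiv ℝ ψ x‖ ≤ A)
    (hg : ∀ t ∈ Set.Icc 0 T, Integrable g (ρ t)) (hK : ∀ t ∈ Set.Icc 0 T, ∫ θ, g θ ∂(ρ t) ≤ K)
    (hgU : Integrable g (uniformSphere d)) (h1 : ∀ x, |ψ x| ≤ g x)
    (h2 : ∀ x, ‖fderiv ℝ ψ x‖ * ‖x‖ ≤ g x) :
    SolvesAgainst σ T ρ u ψ := by
  obtain ⟨χ, C, χd, χs, χ0, χ1, χe, χC, χC'⟩ := exists_cutoff (d + 1)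
  have hC0 : 0 ≤ C := (norm_nonneg _).trans (χC 0)
  have hpos : ∀ j : ℕ, (0 : ℝ) < ((j : ℝ) + 1)⁻¹ := fun j => by positivity
  set κ : ℕ → Euc (d + 1) → ℝ := fun j x => χ (((j : ℝ) + 1)⁻¹ • x) with hκ
  have κd : ∀ j, Differentiable ℝ (κ j) := fun j => by
    rw [hκ]; exact χd.comp (by fun_prop)
  have κf : ∀ j x, fderiv ℝ (κ j) x = ((j : ℝ) + 1)⁻¹ • fderiv ℝ χ (((j : ℝ) + 1)⁻¹ • x) :=
    fun j x => fderiv_comp_smul _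
  have κC : ∀ j x, ‖fderiv ℝ (κ j) x‖ * ‖x‖ ≤ C := fun j x => by
    have := χC' (((j : ℝ) + 1)⁻¹ • x)
    rw [κf, norm_smul, Real.norm_of_nonneg (hpos j).le]
    rw [norm_smul, Real.norm_of_nonneg (hpos j).le] at this
    linarith
  have κC' : ∀ j x, ‖fderiv ℝ (κ j) x‖ ≤ C := fun j x => by
    rw [κf, norm_smul, Real.norm_of_nonneg (hpos j).le]
    refine (mul_le_of_le_one_left (norm_nonneg _) (inv_le_one_of_one_le₀ ?_)).trans (χC _)
    have : (0 : ℝ) ≤ j := Nat.cast_nonneg j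
    linarith
  have κs : ∀ j, HasCompactSupport (κ j) := fun j => χs.comp_smul (hpos j).ne'
  have κe : ∀ (j : ℕ) x, ‖x‖ < (j : ℝ) + 1 → κ j =ᶠ[𝓝 x] fun _ => 1 := fun j x hx => by
    filter_upwards [(isOpen_lt continuous_norm continuous_const).mem_nhds hx] with y hy
    refine χe _ ?_
    have hy' : ‖y‖ < (j : ℝ) + 1 := hy
    rw [norm_smul, Real.norm_of_nonneg (hpos j).le, inv_mul_le_iff₀ (by positivity)]
    linarith
  have hfd : ∀ j x, fderiv ℝ (fun y => κ j y * ψ y) x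
      = κ j x • fderiv ℝ ψ x + ψ x • fderiv ℝ (κ j) x := fun j x =>
    fderiv_fun_mul (κd j x) (hd x)
  have hev : ∀ x, ∀ᶠ j : ℕ in atTop, κ j =ᶠ[𝓝 x] fun _ => 1 := fun x => by
    filter_upwards [eventually_ge_atTop ⌈‖x‖⌉₊] with j hj
    exact κe j x (by have := Nat.ceil_le.1 hj; linarith)
  have hg0 : ∀ x, 0 ≤ g x := fun x => (abs_nonneg _).trans (h1 x)
  have hκabs : ∀ j x, |κ j x| ≤ 1 := fun j x => abs_le.2 ⟨by linarith [χ0 (((j : ℝ) + 1)⁻¹ • x)], χ1 _⟩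
  refine hρ.solvesAgainst_of_tendsto (ψ' := fun j x => κ j x * ψ x)
    (g := fun x => (1 + C) * g x) (K := (1 + C) * K) (fun j => ?_)
    (fun j => (κd j).mul hd) (fun t ht => (hg t ht).const_mul _) (fun t ht => ?_)
    (hgU.const_mul _) (fun j x => ?_) (fun j x => ?_) (fun x => ?_) (fun x h => ?_)
  · obtain ⟨r, hr⟩ := (κs j).isCompact.isBounded.subset_closedBall (0 : Euc (d + 1))
    obtain ⟨A, hA⟩ := hloc r
    obtain ⟨B, hB⟩ := (isCompact_closedBall (0 : Euc (d + 1)) r).exists_bound_of_continuousOn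
      hd.continuous.continuousOn
    refine hρ.solvesAgainst_of_hasCompactSupport ((κd j).mul hd) (κs j).mul_right
      (A := max (A + B * C) 0) fun x => ?_
    by_cases hx : x ∈ tsupport (κ j)
    · have hx' := hr hx
      refine le_trans ?_ (le_max_left _ _)
      rw [hfd]
      refine (norm_add_le _ _).trans (add_le_add ?_ ?_)
      · rw [norm_smul]
        exact (mul_le_of_le_one_left (norm_nonneg _) (hκabs j x)).trans
          (hA x (by simpa using hx'))
      · rw [norm_smul]
        exact mul_le_mul (hB x hx') (κC' j x) (norm_nonneg _) ((norm_nonneg _).trans (hB x hx'))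
    · have : fderiv ℝ (fun y => κ j y * ψ y) x = 0 := by
        have h0 : (fun y => κ j y * ψ y) =ᶠ[𝓝 x] fun _ => 0 := by
          filter_upwards [(notMem_tsupport_iff_eventuallyEq.1 hx)] with y hy
          rw [hy]; simp
        rw [h0.fderiv_eq]; simp
      rw [this]; simp
  · rw [integral_const_mul]
    exact mul_le_mul_of_nonneg_left (hK t ht) (by positivity)
  · rw [abs_mul]
    calc |κ j x| * |ψ x| ≤ 1 * g x := mul_le_mul (hκabs j x) (h1 x) (abs_nonneg _) zero_le_one
      _ ≤ (1 + C) * g x := mul_le_mul_of_nonneg_right (by linarith) (hg0 x)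
  · rw [hfd]
    calc _ ≤ (‖κ j x • fderiv ℝ ψ x‖ + ‖ψ x • fderiv ℝ (κ j) x‖) * ‖x‖ := by
          gcongr; exact norm_add_le _ _
      _ = |κ j x| * (‖fderiv ℝ ψ x‖ * ‖x‖) + |ψ x| * (‖fderiv ℝ (κ j) x‖ * ‖x‖) := by
          rw [norm_smul, norm_smul, Real.norm_eq_abs, Real.norm_eq_abs]; ring
      _ ≤ 1 * g x + g x * C := by
          gcongr
          · exact hκabs j x
          · exact h2 x
          · exact hg0 x
          · exact h1 x
          · exact κC j x
      _ = _ := by ring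
  · refine tendsto_const_nhds.congr' ?_
    filter_upwards [hev x] with j hj
    rw [hj.eq_of_nhds, one_mul]
  · refine tendsto_const_nhds.congr' ?_
    filter_upwards [hev x] with j hj
    rw [hfd, hj.eq_of_nhds, hj.fderiv_eq]
    simp

lemma integrable_sq_uniformSphere (d : ℕ) (A : ℝ) :
    Integrable (fun x : Euc (d + 1) => A * ‖x‖ ^ 2) (uniformSphere d) := by
  refine (integrable_const A).congr ?_
  filter_upwards [ae_mem_sphere_uniformSphere d] with x hx
  have : ‖x‖ = 1 := by simpa using hx
  simp [this]

/-- The second moment is bounded along the flow. The test functions `‖x‖² / (1 + a ‖x‖²)` are bounded,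
and the rate in the resulting Grönwall estimate does not depend on `a`. -/
lemma IsLinearGrowthSolution.exists_moment_bound (hρ : IsLinearGrowthSolution σ T G ρ u) :
    ∃ K, 0 ≤ K ∧ ∀ t ∈ Set.Icc 0 T, ∫ θ, ‖θ‖ ^ 2 ∂(ρ t) ≤ K := by
  have hσ := hρ.rate_nonneg
  have hG := hρ.growth_nonneg
  set γ : ℝ := 2 * G + 1 with hγ
  set K₀ : ℝ := ∫ θ, ‖θ‖ ^ 2 ∂(ρ 0) with hK₀
  have hK₀0 : 0 ≤ K₀ := integral_nonneg fun _ => by positivity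
  refine ⟨Real.exp (γ * T) * (K₀ + σ / γ), by positivity, fun t ht => ?_⟩
  have h0 : (0 : ℝ) ∈ Set.Icc 0 T := ⟨le_rfl, ht.1.trans ht.2⟩
  have hγ0 : 0 < γ := by positivity
  let φ : ℝ → Euc (d + 1) → ℝ := fun a x => ‖x‖ ^ 2 / (1 + a * ‖x‖ ^ 2)
  have hden : ∀ a, 0 < a → ∀ x : Euc (d + 1), 0 < 1 + a * ‖x‖ ^ 2 := fun a ha x => by positivity
  have φ0 : ∀ a, 0 < a → ∀ x, 0 ≤ φ a x := fun a ha x => div_nonneg (by positivity) (hden a ha x).le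
  have φle : ∀ a, 0 < a → ∀ x, φ a x ≤ ‖x‖ ^ 2 := fun a ha x =>
    div_le_self (by positivity) (by nlinarith [sq_nonneg ‖x‖])
  have φh : ∀ a, 0 < a → ∀ x, HasFDerivAt (φ a)
      ((1 / (1 + a * ‖x‖ ^ 2) ^ 2) • ((2 : ℕ) • (innerSL ℝ x))) x := by
    intro a ha x
    have hq : HasFDerivAt (fun y : Euc (d + 1) => ‖y‖ ^ 2) ((2 : ℕ) • (innerSL ℝ x)) x :=
      (hasStrictFDerivAt_norm_sq x).hasFDerivAt
    have hr : HasDerivAt (fun v : ℝ => v / (1 + a * v)) (1 / (1 + a * ‖x‖ ^ 2) ^ 2) (‖x‖ ^ 2) := by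
      have h1 := (hasDerivAt_id (‖x‖ ^ 2)).div
        (((hasDerivAt_id (‖x‖ ^ 2)).const_mul a).const_add 1)
          (show 1 + a * id (‖x‖ ^ 2) ≠ 0 from (hden a ha x).ne')
      refine h1.congr_deriv ?_
      simp only [id]
      ring
    exact HasDerivAt.comp_hasFDerivAt (h₂ := fun v : ℝ => v / (1 + a * v)) x hr hq
  have φd : ∀ a, 0 < a → Differentiable ℝ (φ a) := fun a ha x => (φh a ha x).differentiableAt
  have φf : ∀ a, 0 < a → ∀ x, ‖fderiv ℝ (φ a) x‖ ≤ 2 * ‖x‖ / (1 + a * ‖x‖ ^ 2) := by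
    intro a ha x
    rw [(φh a ha x).fderiv, norm_smul, Real.norm_of_nonneg (by have := hden a ha x; positivity)]
    have h3 : ‖(2 : ℕ) • (innerSL ℝ x)‖ ≤ 2 * ‖x‖ := by
      refine (norm_nsmul_le).trans ?_
      simp
    have hD := hden a ha x
    calc _ ≤ 1 / (1 + a * ‖x‖ ^ 2) ^ 2 * (2 * ‖x‖) := by gcongr
      _ ≤ 1 / (1 + a * ‖x‖ ^ 2) * (2 * ‖x‖) := by
          gcongr
          exact le_self_pow₀ (by nlinarith [sq_nonneg ‖x‖]) two_ne_zero
      _ = _ := by ring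
  have φf' : ∀ a, 0 < a → ∀ x, ‖fderiv ℝ (φ a) x‖ * ‖x‖ ≤ 2 * φ a x := fun a ha x =>
    (mul_le_mul_of_nonneg_right (φf a ha x) (norm_nonneg x)).trans (le_of_eq (by
      simp only [φ]; ring))
  have φb : ∀ a, 0 < a → ∀ x, φ a x ≤ 1 / a := fun a ha x => by
    rw [div_le_div_iff₀ (hden a ha x) ha]; nlinarith
  have φi : ∀ a, 0 < a → ∀ t ∈ Set.Icc 0 T, Integrable (φ a) (ρ t) := fun a ha t ht =>
    (hρ.mem_P₂ t ht).2.mono' (φd a ha).continuous.measurable.aestronglyMeasurable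
      (Eventually.of_forall fun x => by
        rw [Real.norm_of_nonneg (φ0 a ha x)]; exact φle a ha x)
  have φsol : ∀ a, 0 < a → SolvesAgainst σ T ρ u (φ a) := by
    intro a ha
    refine hρ.solvesAgainst_of_bound (g := fun _ => 2 * (1 / a)) (K := 2 * (1 / a)) (φd a ha)
      (fun r => ⟨2 * r, fun x hx => (φf a ha x).trans ?_⟩) (fun t ht => ?_) (fun t ht => ?_)
      (integrable_const _) (fun x => ?_) (fun x => ?_)
    · exact (div_le_self (by positivity) (by nlinarith [sq_nonneg ‖x‖])).trans (by linarith)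
    · have := (hρ.mem_P₂ t ht).1
      exact integrable_const _
    · have := (hρ.mem_P₂ t ht).1
      simp
    · rw [abs_of_nonneg (φ0 a ha x)]
      have := φb a ha x
      have : 0 < 1 / a := by positivity
      linarith
    · exact (φf' a ha x).trans (by linarith [φb a ha x])
  have φU : ∀ a, 0 < a → ∫ θ, φ a θ ∂(uniformSphere d) ≤ 1 := fun a ha => by
    have : ∫ θ, φ a θ ∂(uniformSphere d) ≤ ∫ θ, (1 : ℝ) ∂(uniformSphere d) := by
      refine integral_mono_of_nonneg (Eventually.of_forall (φ0 a ha)) (integrable_const _) ?_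
      filter_upwards [ae_mem_sphere_uniformSphere d] with x hx
      have h1 : ‖x‖ = 1 := by simpa using hx
      simpa [h1] using φle a ha x
    simpa using this
  -- The rate of growth is bounded independently of `a`.
  have φrhs : ∀ a, 0 < a → ∀ s ∈ Set.Icc 0 T,
      weakRHS σ (ρ s) (u s) (φ a) ≤ σ + 2 * G * ∫ θ, φ a θ ∂(ρ s) := by
    intro a ha s hs
    have e1 : ∫ θ, fderiv ℝ (φ a) θ (u s θ) ∂(ρ s) ≤ ∫ θ, 2 * G * φ a θ ∂(ρ s) := by
      refine (Real.le_norm_self _).trans (norm_integral_le_of_norm_le ((φi a ha s hs).const_mul _)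
        (Eventually.of_forall fun x => (ContinuousLinearMap.le_opNorm _ _).trans ?_))
      calc _ ≤ ‖fderiv ℝ (φ a) x‖ * (G * ‖x‖) := by gcongr; exact hρ.growth s hs x
        _ = G * (‖fderiv ℝ (φ a) x‖ * ‖x‖) := by ring
        _ ≤ G * (2 * φ a x) := mul_le_mul_of_nonneg_left (φf' a ha x) hG
        _ = _ := by ring
    rw [integral_const_mul] at e1
    have e2 : 0 ≤ σ * ∫ θ, φ a θ ∂(ρ s) := mul_nonneg hσ (integral_nonneg (φ0 a ha))
    have e3 := mul_le_mul_of_nonneg_left (φU a ha) hσ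
    unfold weakRHS
    linarith
  have φbd : ∀ a, 0 < a → ∃ B, ∀ s ∈ Set.Icc 0 T, |weakRHS σ (ρ s) (u s) (φ a)| ≤ B := by
    intro a ha
    refine ⟨(σ + G) * (2 * (1 / a)) + σ * (2 * (1 / a)), fun s hs => ?_⟩
    have := (hρ.mem_P₂ s hs).1
    have h := abs_weakRHS_le (μ := ρ s) hσ hG (hρ.growth s hs) (φ := φ a) (g := fun _ => 2 * (1 / a))
      (integrable_const _) (integrable_const _) (fun x => by
        rw [abs_of_nonneg (φ0 a ha x)]
        have := φb a ha x
        have : 0 < 1 / a := by positivity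
        linarith) (fun x => (φf' a ha x).trans (by linarith [φb a ha x]))
    simpa using h
  have bound : ∀ a, 0 < a → ∫ θ, φ a θ ∂(ρ t) ≤ Real.exp (γ * T) * (K₀ + σ / γ) := by
    intro a ha
    obtain ⟨B, hB⟩ := φbd a ha
    have hB0 : 0 ≤ B := (abs_nonneg _).trans (hB 0 h0)
    set f : ℝ → ℝ := fun s => ∫ θ, φ a θ ∂(ρ s) with hf
    have hf0 : ∀ s, 0 ≤ f s := fun s => integral_nonneg (φ0 a ha)
    have hlip : ∀ s ∈ Set.Icc 0 T, ∀ s' ∈ Set.Icc 0 T, s ≤ s' → f s' - f s ≤ B * (s' - s) := by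
      intro s hs s' hs' hss
      rw [hf]
      beta_reduce
      rw [(φsol a ha).sub_eq hs hs']
      have := intervalIntegral.norm_integral_le_of_norm_le_const
        (f := fun r => weakRHS σ (ρ r) (u r) (φ a)) (C := B) (a := s) (b := s') (fun r hr => by
          rw [Set.uIoc_of_le hss] at hr
          exact hB r ⟨hs.1.trans hr.1.le, hr.2.trans hs'.2⟩)
      rw [abs_of_nonneg (by linarith : 0 ≤ s' - s)] at this
      exact (le_abs_self _).trans this
    have hg := exp_mul_le_of_discrete_growth (g := fun s => -(f s + σ / γ)) (s := 0) (e := t)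
      (δ := γ) (K := γ * B) ht.1 hγ0.le (by positivity) (fun s hs s' hs' hss => by
        have hs1 : s ∈ Set.Icc 0 T := ⟨hs.1, hs.2.trans ht.2⟩
        have hs2 : s' ∈ Set.Icc 0 T := ⟨hs'.1, hs'.2.trans ht.2⟩
        have e1 : f s' - f s ≤ ∫ r in s..s', (σ + γ * (f s + B * (s' - s))) := by
          rw [hf]
          beta_reduce
          rw [(φsol a ha).sub_eq hs1 hs2]
          refine intervalIntegral.integral_mono_on hss ((φsol a ha).intervalIntegrable hs1 hs2)
            intervalIntegrable_const (fun r hr => ?_)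
          have hr1 : r ∈ Set.Icc 0 T := ⟨hs1.1.trans hr.1, hr.2.trans hs2.2⟩
          refine (φrhs a ha r hr1).trans ?_
          have h1 := hlip s hs1 r hr1 hr.1
          have h2 : B * (r - s) ≤ B * (s' - s) := by gcongr; exact hr.2
          have h3 : f r ≤ f s + B * (s' - s) := by linarith
          have h4 : 2 * G * f r ≤ γ * f r := mul_le_mul_of_nonneg_right (by linarith) (hf0 r)
          have h5 := mul_le_mul_of_nonneg_left h3 hγ0.le
          change σ + 2 * G * f r ≤ _
          linarith
        rw [intervalIntegral.integral_const, smul_eq_mul] at e1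
        have e2 : γ * (σ / γ) = σ := by field_simp
        have e3 : γ * (s' - s) * (σ / γ) = (s' - s) * σ := by
          rw [mul_right_comm, e2]; ring
        nlinarith)
    have h1 : f t + σ / γ ≤ Real.exp (γ * (t - 0)) * (f 0 + σ / γ) := by linarith
    have h2 : Real.exp (γ * (t - 0)) ≤ Real.exp (γ * T) := by
      rw [sub_zero]
      exact Real.exp_le_exp.2 (mul_le_mul_of_nonneg_left ht.2 hγ0.le)
    have h3 : f 0 ≤ K₀ := integral_mono (φi a ha 0 h0) (hρ.mem_P₂ 0 h0).2 (φle a ha)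
    have h4 : 0 ≤ σ / γ := by positivity
    have h5 : Real.exp (γ * (t - 0)) * (f 0 + σ / γ) ≤ Real.exp (γ * T) * (K₀ + σ / γ) :=
      mul_le_mul h2 (by linarith) (by linarith [hf0 0]) (Real.exp_pos _).le
    linarith
  have hlim : Tendsto (fun j : ℕ => ∫ θ, φ (1 / ((j : ℝ) + 1)) θ ∂(ρ t)) atTop
      (𝓝 (∫ θ, ‖θ‖ ^ 2 ∂(ρ t))) := by
    have hp : ∀ j : ℕ, (0 : ℝ) < 1 / ((j : ℝ) + 1) := fun j => by positivity
    refine tendsto_integral_of_dominated_convergence (fun θ => ‖θ‖ ^ 2)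
      (fun j => (φi _ (hp j) t ht).aestronglyMeasurable) (hρ.mem_P₂ t ht).2
      (fun j => Eventually.of_forall fun x => ?_) (Eventually.of_forall fun x => ?_)
    · rw [Real.norm_of_nonneg (φ0 _ (hp j) x)]; exact φle _ (hp j) x
    · have h1 := tendsto_one_div_add_atTop_nhds_zero_nat (𝕜 := ℝ)
      have h2 : Tendsto (fun j : ℕ => ‖x‖ ^ 2 / (1 + 1 / ((j : ℝ) + 1) * ‖x‖ ^ 2)) atTop
          (𝓝 (‖x‖ ^ 2 / (1 + 0 * ‖x‖ ^ 2))) :=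
        tendsto_const_nhds.div (tendsto_const_nhds.add (h1.mul_const _)) (by simp)
      simpa using h2
  exact le_of_tendsto hlim (Eventually.of_forall fun j => bound _ (by positivity))

/-- The equation holds against every differentiable function of at most quadratic growth whose
derivative has at most linear growth. -/
lemma IsLinearGrowthSolution.solvesAgainst (hρ : IsLinearGrowthSolution σ T G ρ u)
    {ψ : Euc (d + 1) → ℝ} {A : ℝ} (hd : Differentiable ℝ ψ) (h1 : ∀ x, |ψ x| ≤ A * ‖x‖ ^ 2)
    (h2 : ∀ x, ‖fderiv ℝ ψ x‖ ≤ A * ‖x‖) : SolvesAgainst σ T ρ u ψ := by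
  obtain ⟨K, hK0, hK⟩ := hρ.exists_moment_bound
  have hA0 : 0 ≤ A := by
    obtain ⟨x, hx⟩ := exists_ne (0 : Euc (d + 1))
    by_contra! hA
    nlinarith [norm_pos_iff.2 hx, (norm_nonneg _).trans (h2 x)]
  refine hρ.solvesAgainst_of_bound (g := fun x => A * ‖x‖ ^ 2) (K := A * K) hd
    (fun r => ⟨A * r, fun x hx => (h2 x).trans (by gcongr)⟩)
    (fun t ht => (hρ.mem_P₂ t ht).2.const_mul A) (fun t ht => ?_)
    (integrable_sq_uniformSphere d A) h1 (fun x => ?_)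
  · rw [integral_const_mul]
    exact mul_le_mul_of_nonneg_left (hK t ht) hA0
  · calc _ ≤ A * ‖x‖ * ‖x‖ := by gcongr; exact h2 x
      _ = _ := by ring

end WeakEquation

/-! ### The first variation and its gradient field -/

section Problem

variable {d k : ℕ} {R : Euc k → ℝ} {Φ : Euc (d + 1) → Euc k} {V : Euc (d + 1) → ℝ} {S : ℝ}

/-- The regularity assumptions with all constants replaced by powers of a single `S ≥ 1`. -/
structure ProblemBounds (R : Euc k → ℝ) (Φ : Euc (d + 1) → Euc k) (V : Euc (d + 1) → ℝ)
    (S : ℝ) : Prop where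
  one_le : 1 ≤ S
  loss : LossRegular R S S
  Φ_hom : TwoHomogeneous Φ
  V_hom : TwoHomogeneous V
  Φ_diff : Differentiable ℝ Φ
  V_diff : Differentiable ℝ V
  Φ_le : ∀ x, ‖Φ x‖ ≤ S * ‖x‖ ^ 2
  le_V : ∀ x, S⁻¹ * ‖x‖ ^ 2 ≤ V x
  V_le : ∀ x, |V x| ≤ S * ‖x‖ ^ 2
  fderiv_Φ_le : ∀ x, ‖fderiv ℝ Φ x‖ ≤ 4 * S ^ 2 * ‖x‖
  fderiv_V_le : ∀ x, ‖fderiv ℝ V x‖ ≤ S * ‖x‖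

/-- The function `⟨a, Φ⟩ + V`; the first variation `L'[ρ]` is the case `a = ∇R(∫ Φ dρ)`. -/
noncomputable def linearization (Φ : Euc (d + 1) → Euc k) (V : Euc (d + 1) → ℝ) (a : Euc k)
    (θ : Euc (d + 1)) : ℝ :=
  inner ℝ a (Φ θ) + V θ

lemma ProblemBounds.pos (h : ProblemBounds R Φ V S) : 0 < S := one_pos.trans_le h.one_le

lemma ProblemBounds.V_nonneg (h : ProblemBounds R Φ V S) (x : Euc (d + 1)) : 0 ≤ V x :=
  (mul_nonneg (inv_nonneg.2 h.pos.le) (by positivity)).trans (h.le_V x)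

lemma ProblemBounds.hasFDerivAt_inner (h : ProblemBounds R Φ V S) (a : Euc k) (θ : Euc (d + 1)) :
    HasFDerivAt (fun θ => inner ℝ a (Φ θ)) ((innerSL ℝ a).comp (fderiv ℝ Φ θ)) θ :=
  (innerSL ℝ a).hasFDerivAt.comp θ (h.Φ_diff θ).hasFDerivAt

lemma ProblemBounds.hasFDerivAt_linearization (h : ProblemBounds R Φ V S) (a : Euc k)
    (θ : Euc (d + 1)) :
    HasFDerivAt (linearization Φ V a) ((innerSL ℝ a).comp (fderiv ℝ Φ θ) + fderiv ℝ V θ) θ :=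
  (h.hasFDerivAt_inner a θ).add (h.V_diff θ).hasFDerivAt

lemma ProblemBounds.fderiv_linearization_apply (h : ProblemBounds R Φ V S) (a : Euc k)
    (θ w : Euc (d + 1)) :
    fderiv ℝ (linearization Φ V a) θ w = inner ℝ a (fderiv ℝ Φ θ w) + fderiv ℝ V θ w := by
  rw [(h.hasFDerivAt_linearization a θ).fderiv]; rfl

lemma ProblemBounds.differentiable_linearization (h : ProblemBounds R Φ V S) (a : Euc k) :
    Differentiable ℝ (linearization Φ V a) := fun θ =>
  (h.hasFDerivAt_linearization a θ).differentiableAt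

lemma ProblemBounds.twoHomogeneous_linearization (h : ProblemBounds R Φ V S) (a : Euc k) :
    TwoHomogeneous (linearization Φ V a) := fun c hc x => by
  simp only [linearization, h.Φ_hom c hc, h.V_hom c hc, inner_smul_right, smul_eq_mul]
  ring

lemma ProblemBounds.abs_linearization_le (h : ProblemBounds R Φ V S) {a : Euc k} (ha : ‖a‖ ≤ S)
    (x : Euc (d + 1)) : |linearization Φ V a x| ≤ 2 * S ^ 2 * ‖x‖ ^ 2 := by
  have hS := h.one_le
  have h1 : |inner ℝ a (Φ x)| ≤ S * (S * ‖x‖ ^ 2) :=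
    (abs_real_inner_le_norm _ _).trans (mul_le_mul ha (h.Φ_le x) (norm_nonneg _) h.pos.le)
  refine (abs_add_le _ _).trans ((add_le_add h1 (h.V_le x)).trans ?_)
  nlinarith [mul_nonneg (mul_nonneg h.pos.le (sub_nonneg.2 hS)) (sq_nonneg ‖x‖)]

lemma ProblemBounds.norm_fderiv_linearization_le (h : ProblemBounds R Φ V S) {a : Euc k}
    (ha : ‖a‖ ≤ S) (x : Euc (d + 1)) : ‖fderiv ℝ (linearization Φ V a) x‖ ≤ 5 * S ^ 3 * ‖x‖ := by
  have hS := h.one_le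
  rw [(h.hasFDerivAt_linearization a x).fderiv]
  refine (norm_add_le _ _).trans ?_
  have h1 : ‖(innerSL ℝ a).comp (fderiv ℝ Φ x)‖ ≤ S * (4 * S ^ 2 * ‖x‖) := by
    refine (ContinuousLinearMap.opNorm_comp_le _ _).trans ?_
    rw [innerSL_apply_norm]
    exact mul_le_mul ha (h.fderiv_Φ_le x) (norm_nonneg _) h.pos.le
  have h2 : S ≤ S ^ 3 := le_self_pow₀ hS (by norm_num)
  have h3 := h.fderiv_V_le x
  nlinarith [mul_le_mul_of_nonneg_right h2 (norm_nonneg x)]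

lemma velocity_eq (R : Euc k → ℝ) (Φ : Euc (d + 1) → Euc k) (V : Euc (d + 1) → ℝ)
    (μ : Measure (Euc (d + 1))) (θ : Euc (d + 1)) :
    velocity R Φ V μ θ = -gradient (linearization Φ V (gradient R (∫ x, Φ x ∂μ))) θ := rfl

lemma measurable_velocity (R : Euc k → ℝ) (Φ : Euc (d + 1) → Euc k) (V : Euc (d + 1) → ℝ)
    (μ : Measure (Euc (d + 1))) : Measurable (velocity R Φ V μ) :=
  ((LinearIsometryEquiv.continuous _).measurable.comp (measurable_fderiv ℝ _)).neg

lemma ProblemBounds.norm_velocity_le (h : ProblemBounds R Φ V S) (μ : Measure (Euc (d + 1)))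
    (θ : Euc (d + 1)) : ‖velocity R Φ V μ θ‖ ≤ 5 * S ^ 3 * ‖θ‖ := by
  rw [velocity_eq, norm_neg, norm_gradient_eq]
  exact h.norm_fderiv_linearization_le (h.loss.gradient_le _) θ

lemma fderiv_linearization_velocity (R : Euc k → ℝ) (Φ : Euc (d + 1) → Euc k)
    (V : Euc (d + 1) → ℝ) (μ : Measure (Euc (d + 1))) (θ : Euc (d + 1)) :
    fderiv ℝ (linearization Φ V (gradient R (∫ x, Φ x ∂μ))) θ (velocity R Φ V μ θ) =
      -‖velocity R Φ V μ θ‖ ^ 2 := by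
  rw [← inner_gradient_left, velocity_eq, inner_neg_right, norm_neg, real_inner_self_eq_norm_sq]

lemma flowRHS_eq (R : Euc k → ℝ) (Φ : Euc (d + 1) → Euc k) (V : Euc (d + 1) → ℝ) (σ : ℝ)
    (μ : Measure (Euc (d + 1))) (φ : Euc (d + 1) → ℝ) :
    flowRHS R Φ V σ μ φ = weakRHS σ μ (velocity R Φ V μ) φ := by
  simp only [flowRHS, weakRHS, inner_gradient_left]

lemma integrable_of_sq_bound {F : Type*} [NormedAddCommGroup F] {n : ℕ} {μ : Measure (Euc n)}
    (hμ : Integrable (fun x => ‖x‖ ^ 2) μ) {f : Euc n → F} (hf : AEStronglyMeasurable f μ) {A : ℝ}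
    (hA : ∀ x, ‖f x‖ ≤ A * ‖x‖ ^ 2) : Integrable f μ :=
  (hμ.const_mul A).mono' hf (Eventually.of_forall hA)

lemma integrable_sq_uniformSphere' (d : ℕ) :
    Integrable (fun x : Euc (d + 1) => ‖x‖ ^ 2) (uniformSphere d) := by
  simpa using integrable_sq_uniformSphere d 1

lemma integral_sq_uniformSphere (d : ℕ) : ∫ x : Euc (d + 1), ‖x‖ ^ 2 ∂(uniformSphere d) = 1 := by
  have : ∫ x : Euc (d + 1), ‖x‖ ^ 2 ∂(uniformSphere d) = ∫ _, (1 : ℝ) ∂(uniformSphere d) := by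
    refine integral_congr_ae ?_
    filter_upwards [ae_mem_sphere_uniformSphere d] with x hx
    have : ‖x‖ = 1 := by simpa using hx
    simp [this]
  simpa using this

variable {μ : Measure (Euc (d + 1))}

lemma ProblemBounds.integrable_Φ (h : ProblemBounds R Φ V S)
    (hμ : Integrable (fun x => ‖x‖ ^ 2) μ) : Integrable Φ μ :=
  integrable_of_sq_bound hμ h.Φ_diff.continuous.aestronglyMeasurable h.Φ_le

lemma ProblemBounds.integrable_V (h : ProblemBounds R Φ V S)
    (hμ : Integrable (fun x => ‖x‖ ^ 2) μ) : Integrable V μ :=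
  integrable_of_sq_bound hμ h.V_diff.continuous.aestronglyMeasurable h.V_le

lemma ProblemBounds.integral_linearization (h : ProblemBounds R Φ V S)
    (hμ : Integrable (fun x => ‖x‖ ^ 2) μ) (a : Euc k) :
    ∫ x, linearization Φ V a x ∂μ = inner ℝ a (∫ x, Φ x ∂μ) + ∫ x, V x ∂μ := by
  have h1 := h.integrable_Φ hμ
  simp only [linearization]
  rw [integral_add (h1.const_inner a) (h.integrable_V hμ), integral_inner h1]

lemma ProblemBounds.integral_sq_le (h : ProblemBounds R Φ V S)
    (hμ : Integrable (fun x => ‖x‖ ^ 2) μ) :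
    ∫ x, ‖x‖ ^ 2 ∂μ ≤ S * objective R Φ V μ := by
  have h1 : ∫ x, S⁻¹ * ‖x‖ ^ 2 ∂μ ≤ ∫ x, V x ∂μ :=
    integral_mono (hμ.const_mul _) (h.integrable_V hμ) h.le_V
  rw [integral_const_mul, inv_mul_le_iff₀ h.pos] at h1
  have h2 := h.loss.nonneg (∫ x, Φ x ∂μ)
  refine h1.trans (mul_le_mul_of_nonneg_left ?_ h.pos.le)
  unfold objective
  linarith

lemma ProblemBounds.objective_nonneg (h : ProblemBounds R Φ V S) (μ : Measure (Euc (d + 1))) :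
    0 ≤ objective R Φ V μ :=
  add_nonneg (h.loss.nonneg _) (integral_nonneg h.V_nonneg)

lemma ProblemBounds.norm_integral_Φ_le (h : ProblemBounds R Φ V S)
    (hμ : Integrable (fun x => ‖x‖ ^ 2) μ) : ‖∫ x, Φ x ∂μ‖ ≤ S * ∫ x, ‖x‖ ^ 2 ∂μ := by
  rw [← integral_const_mul]
  exact norm_integral_le_of_norm_le (hμ.const_mul _) (Eventually.of_forall h.Φ_le)

/-- `R(0)` is controlled by the value of the objective at any single measure. -/
lemma ProblemBounds.loss_zero_le (h : ProblemBounds R Φ V S)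
    (hμ : Integrable (fun x => ‖x‖ ^ 2) μ) (hL : objective R Φ V μ ≤ S) : R 0 ≤ 2 * S ^ 4 := by
  have hS := h.one_le
  have h1 := h.loss.tangent_le 0 (∫ x, Φ x ∂μ)
  have h2 : |inner ℝ (gradient R 0) (∫ x, Φ x ∂μ - 0)| ≤ S * (S * (S * S)) := by
    refine (abs_real_inner_le_norm _ _).trans ?_
    rw [sub_zero]
    refine mul_le_mul (h.loss.gradient_le _) ?_ (norm_nonneg _) h.pos.le
    refine (h.norm_integral_Φ_le hμ).trans (mul_le_mul_of_nonneg_left ?_ h.pos.le)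
    exact (h.integral_sq_le hμ).trans (mul_le_mul_of_nonneg_left hL h.pos.le)
  have h3 : R (∫ x, Φ x ∂μ) ≤ S := by
    have : 0 ≤ ∫ x, V x ∂μ := integral_nonneg h.V_nonneg
    unfold objective at hL
    linarith
  have h4 : S ≤ S ^ 4 := le_self_pow₀ hS (by norm_num)
  have h5 := neg_abs_le (inner ℝ (gradient R 0) (∫ x, Φ x ∂μ - 0))
  have h6 : S * (S * (S * S)) = S ^ 4 := by ring
  linarith

lemma ProblemBounds.integral_linearization_ge (h : ProblemBounds R Φ V S)
    (hμ : Integrable (fun x => ‖x‖ ^ 2) μ) :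
    -R 0 ≤ ∫ x, linearization Φ V (gradient R (∫ x, Φ x ∂μ)) x ∂μ := by
  rw [h.integral_linearization hμ]
  have h1 := h.loss.tangent_le (∫ x, Φ x ∂μ) 0
  rw [zero_sub, inner_neg_right] at h1
  have h2 := h.loss.nonneg (∫ x, Φ x ∂μ)
  have h3 : 0 ≤ ∫ x, V x ∂μ := integral_nonneg h.V_nonneg
  linarith

end Problem

/-! ### Rates of change along the flow -/

section Rates

variable {d k : ℕ} {R : Euc k → ℝ} {Φ : Euc (d + 1) → Euc k} {V : Euc (d + 1) → ℝ} {S σ T : ℝ}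
  {ρ : ℝ → Measure (Euc (d + 1))}

lemma IsFlowSolution.isLinearGrowthSolution (hf : IsFlowSolution R Φ V σ T ρ)
    (h : ProblemBounds R Φ V S) (hσ : 0 ≤ σ) :
    IsLinearGrowthSolution σ T (5 * S ^ 3) ρ (fun t => velocity R Φ V (ρ t)) where
  rate_nonneg := hσ
  growth_nonneg := by have := h.pos; positivity
  mem_P₂ := hf.mem_P₂
  measurable _ _ := measurable_velocity _ _ _ _
  growth _ _ θ := h.norm_velocity_le _ θ
  solves φ h1 h2 := by
    refine ⟨?_, fun t ht => ?_⟩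
    · simpa only [flowRHS_eq] using hf.integrable φ h1 h2
    · simpa only [flowRHS_eq] using hf.equation φ h1 h2 t ht

/-- The rate of change of `∫ Φ dρ_t` along the flow, as a vector. -/
noncomputable def featureRate (R : Euc k → ℝ) (Φ : Euc (d + 1) → Euc k) (V : Euc (d + 1) → ℝ)
    (σ : ℝ) (μ : Measure (Euc (d + 1))) : Euc k :=
  -σ • (∫ θ, Φ θ ∂μ) + σ • (∫ θ, Φ θ ∂(uniformSphere d)) +
    ∫ θ, fderiv ℝ Φ θ (velocity R Φ V μ θ) ∂μ

/-- The dissipation `∫ ‖v[μ]‖² dμ`. -/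
noncomputable def dissipation (R : Euc k → ℝ) (Φ : Euc (d + 1) → Euc k) (V : Euc (d + 1) → ℝ)
    (μ : Measure (Euc (d + 1))) : ℝ :=
  ∫ θ, ‖velocity R Φ V μ θ‖ ^ 2 ∂μ

variable {μ : Measure (Euc (d + 1))}

lemma ProblemBounds.integrable_fderiv_Φ_velocity (h : ProblemBounds R Φ V S)
    (hμ : Integrable (fun x => ‖x‖ ^ 2) μ) :
    Integrable (fun θ => fderiv ℝ Φ θ (velocity R Φ V μ θ)) μ := by
  have hm : Measurable fun θ => fderiv ℝ Φ θ (velocity R Φ V μ θ) :=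
    isBoundedBilinearMap_apply.continuous.measurable.comp
      ((measurable_fderiv ℝ Φ).prodMk (measurable_velocity R Φ V μ))
  refine integrable_of_sq_bound hμ hm.aestronglyMeasurable (A := 4 * S ^ 2 * (5 * S ^ 3))
    fun θ => (ContinuousLinearMap.le_opNorm _ _).trans ?_
  have := h.pos
  calc _ ≤ (4 * S ^ 2 * ‖θ‖) * (5 * S ^ 3 * ‖θ‖) :=
        mul_le_mul (h.fderiv_Φ_le θ) (h.norm_velocity_le μ θ) (norm_nonneg _) (by positivity)
    _ = _ := by ring

lemma ProblemBounds.integrable_velocity_sq (h : ProblemBounds R Φ V S)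
    (hμ : Integrable (fun x => ‖x‖ ^ 2) μ) :
    Integrable (fun θ => ‖velocity R Φ V μ θ‖ ^ 2) μ := by
  refine integrable_of_sq_bound hμ
    ((measurable_velocity R Φ V μ).norm.pow_const 2).aestronglyMeasurable
    (A := (5 * S ^ 3) ^ 2) fun θ => ?_
  rw [norm_pow, norm_norm, ← mul_pow]
  exact pow_le_pow_left₀ (norm_nonneg _) (h.norm_velocity_le μ θ) 2

lemma dissipation_nonneg (R : Euc k → ℝ) (Φ : Euc (d + 1) → Euc k) (V : Euc (d + 1) → ℝ)
    (μ : Measure (Euc (d + 1))) : 0 ≤ dissipation R Φ V μ :=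
  integral_nonneg fun _ => by positivity

lemma ProblemBounds.inner_featureRate (h : ProblemBounds R Φ V S)
    (hμ : Integrable (fun x => ‖x‖ ^ 2) μ) (c : Euc k) :
    inner ℝ c (featureRate R Φ V σ μ) =
      weakRHS σ μ (velocity R Φ V μ) (fun θ => inner ℝ c (Φ θ)) := by
  unfold featureRate weakRHS
  have e : ∀ θ w, fderiv ℝ (fun θ => inner ℝ c (Φ θ)) θ w = inner ℝ c (fderiv ℝ Φ θ w) :=
    fun θ w => by rw [(h.hasFDerivAt_inner c θ).fderiv]; rfl
  simp only [e]
  rw [integral_inner (h.integrable_Φ hμ), integral_inner (h.integrable_Φ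
    (integrable_sq_uniformSphere' d)), integral_inner (h.integrable_fderiv_Φ_velocity hμ),
    inner_add_right, inner_add_right, inner_smul_right, inner_smul_right]

/-- Young's inequality, with a free weight `w`, bounds the rate of the features by the
dissipation. -/
lemma ProblemBounds.norm_featureRate_le (h : ProblemBounds R Φ V S) (hσ : 0 ≤ σ)
    (hμ : Integrable (fun x => ‖x‖ ^ 2) μ) {w : ℝ} (hw : 0 < w) :
    ‖featureRate R Φ V σ μ‖ ≤ σ * S * ((∫ θ, ‖θ‖ ^ 2 ∂μ) + 1) +
      2 * S ^ 2 * (w * dissipation R Φ V μ + (∫ θ, ‖θ‖ ^ 2 ∂μ) / w) := by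
  have hS := h.pos
  have h1 := h.norm_integral_Φ_le hμ
  have h2 := h.norm_integral_Φ_le (integrable_sq_uniformSphere' d)
  rw [integral_sq_uniformSphere] at h2
  have h3 : ‖∫ θ, fderiv ℝ Φ θ (velocity R Φ V μ θ) ∂μ‖ ≤
      ∫ θ, (2 * S ^ 2 * w * ‖velocity R Φ V μ θ‖ ^ 2 + 2 * S ^ 2 / w * ‖θ‖ ^ 2) ∂μ := by
    refine norm_integral_le_of_norm_le (((h.integrable_velocity_sq hμ).const_mul _).add
      (hμ.const_mul _)) (Eventually.of_forall fun θ => ?_)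
    refine (ContinuousLinearMap.le_opNorm _ _).trans ?_
    refine (mul_le_mul_of_nonneg_right (h.fderiv_Φ_le θ) (norm_nonneg _)).trans ?_
    have h4 : 2 * (‖θ‖ * ‖velocity R Φ V μ θ‖) ≤
        w * ‖velocity R Φ V μ θ‖ ^ 2 + 1 / w * ‖θ‖ ^ 2 := by
      have : 0 ≤ (1 / w) * (w * ‖velocity R Φ V μ θ‖ - ‖θ‖) ^ 2 := by positivity
      have e : (1 / w) * (w * ‖velocity R Φ V μ θ‖ - ‖θ‖) ^ 2 =
        w * ‖velocity R Φ V μ θ‖ ^ 2 + 1 / w * ‖θ‖ ^ 2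
          - 2 * (‖θ‖ * ‖velocity R Φ V μ θ‖) := by field_simp; ring
      linarith
    have h5 := mul_le_mul_of_nonneg_left h4 (by positivity : 0 ≤ 2 * S ^ 2)
    calc _ = 2 * S ^ 2 * (2 * (‖θ‖ * ‖velocity R Φ V μ θ‖)) := by ring
      _ ≤ _ := h5
      _ = _ := by ring
  rw [integral_add ((h.integrable_velocity_sq hμ).const_mul _) (hμ.const_mul _),
    integral_const_mul, integral_const_mul] at h3
  have h4 : ‖featureRate R Φ V σ μ‖ ≤ σ * ‖∫ θ, Φ θ ∂μ‖ + σ * ‖∫ θ, Φ θ ∂(uniformSphere d)‖ +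
      ‖∫ θ, fderiv ℝ Φ θ (velocity R Φ V μ θ) ∂μ‖ := by
    unfold featureRate
    refine (norm_add_le _ _).trans (add_le_add ((norm_add_le _ _).trans (le_of_eq ?_)) le_rfl)
    rw [norm_smul, norm_smul, norm_neg, Real.norm_of_nonneg hσ]
  have h5 := mul_le_mul_of_nonneg_left h1 hσ
  have h6 := mul_le_mul_of_nonneg_left h2 hσ
  unfold dissipation
  have e : σ * S * ((∫ θ, ‖θ‖ ^ 2 ∂μ) + 1) +
      2 * S ^ 2 * (w * (∫ θ, ‖velocity R Φ V μ θ‖ ^ 2 ∂μ) + (∫ θ, ‖θ‖ ^ 2 ∂μ) / w) =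
      σ * (S * ∫ θ, ‖θ‖ ^ 2 ∂μ) + σ * (S * 1) + (2 * S ^ 2 * w *
      (∫ θ, ‖velocity R Φ V μ θ‖ ^ 2 ∂μ) + 2 * S ^ 2 / w * (∫ θ, ‖θ‖ ^ 2 ∂μ)) := by ring
  rw [e]
  linarith

lemma ProblemBounds.dissipation_le (h : ProblemBounds R Φ V S)
    (hμ : Integrable (fun x => ‖x‖ ^ 2) μ) :
    dissipation R Φ V μ ≤ (5 * S ^ 3) ^ 2 * ∫ θ, ‖θ‖ ^ 2 ∂μ := by
  rw [← integral_const_mul]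
  refine integral_mono (h.integrable_velocity_sq hμ) (hμ.const_mul _) fun θ => ?_
  beta_reduce
  rw [← mul_pow]
  exact pow_le_pow_left₀ (norm_nonneg _) (h.norm_velocity_le μ θ) 2

/-- The formal derivative of the objective along the flow: with `F` the first variation, it is
`∫ F d(-σ μ + σ U^d)` minus the dissipation. -/
lemma ProblemBounds.rate_linearization (h : ProblemBounds R Φ V S)
    (hμ : Integrable (fun x => ‖x‖ ^ 2) μ) :
    inner ℝ (gradient R (∫ x, Φ x ∂μ)) (featureRate R Φ V σ μ) +
        weakRHS σ μ (velocity R Φ V μ) V =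
      -σ * (∫ θ, linearization Φ V (gradient R (∫ x, Φ x ∂μ)) θ ∂μ) +
        σ * (∫ θ, linearization Φ V (gradient R (∫ x, Φ x ∂μ)) θ ∂(uniformSphere d)) -
        dissipation R Φ V μ := by
  set a := gradient R (∫ x, Φ x ∂μ) with ha
  have hU := integrable_sq_uniformSphere' d
  have h1 : Integrable (fun θ => fderiv ℝ V θ (velocity R Φ V μ θ)) μ := by
    refine integrable_of_sq_bound hμ (measurable_fderiv_apply_field
      (measurable_velocity R Φ V μ)).aestronglyMeasurable (A := S * (5 * S ^ 3)) fun θ => ?_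
    refine (ContinuousLinearMap.le_opNorm _ _).trans ?_
    have := h.pos
    calc _ ≤ (S * ‖θ‖) * (5 * S ^ 3 * ‖θ‖) :=
          mul_le_mul (h.fderiv_V_le θ) (h.norm_velocity_le μ θ) (norm_nonneg _) (by positivity)
      _ = _ := by ring
  have h2 : dissipation R Φ V μ = -((inner ℝ a (∫ θ, fderiv ℝ Φ θ (velocity R Φ V μ θ) ∂μ)) +
      ∫ θ, fderiv ℝ V θ (velocity R Φ V μ θ) ∂μ) := by
    rw [← integral_inner (h.integrable_fderiv_Φ_velocity hμ), ← integral_add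
      ((h.integrable_fderiv_Φ_velocity hμ).const_inner a) h1, ← integral_neg, dissipation]
    refine integral_congr_ae (Eventually.of_forall fun θ => ?_)
    beta_reduce
    rw [← h.fderiv_linearization_apply, fderiv_linearization_velocity, neg_neg]
  rw [h2, h.integral_linearization hμ, h.integral_linearization hU]
  unfold featureRate weakRHS
  rw [inner_add_right, inner_add_right, inner_smul_right, inner_smul_right]
  ring

/-- The mean of the first variation over `μ` is at least `-R(0)` by convexity, and its mean over the
sphere is at most `2 S²`; so the perturbation raises the objective at most at rate `4 σ S⁴`. -/
lemma ProblemBounds.rate_linearization_le (h : ProblemBounds R Φ V S) (hσ : 0 ≤ σ)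
    (hμ : Integrable (fun x => ‖x‖ ^ 2) μ) (hR : R 0 ≤ 2 * S ^ 4) :
    inner ℝ (gradient R (∫ x, Φ x ∂μ)) (featureRate R Φ V σ μ) +
        weakRHS σ μ (velocity R Φ V μ) V ≤ 4 * σ * S ^ 4 - dissipation R Φ V μ := by
  rw [h.rate_linearization hμ]
  have h1 := h.integral_linearization_ge hμ
  have h2 : ∫ θ, linearization Φ V (gradient R (∫ x, Φ x ∂μ)) θ ∂(uniformSphere d) ≤
      2 * S ^ 2 := by
    refine (Real.le_norm_self _).trans ((norm_integral_le_of_norm_le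
      ((integrable_sq_uniformSphere' d).const_mul (2 * S ^ 2)) (Eventually.of_forall
      (h.abs_linearization_le (h.loss.gradient_le _)))).trans (le_of_eq ?_))
    rw [integral_const_mul, integral_sq_uniformSphere, mul_one]
  have h3 : S ^ 2 ≤ S ^ 4 := pow_le_pow_right₀ h.one_le (by norm_num)
  nlinarith [mul_le_mul_of_nonneg_left h1 hσ, mul_le_mul_of_nonneg_left h2 hσ,
    mul_le_mul_of_nonneg_left h3 hσ, mul_le_mul_of_nonneg_left hR hσ]

end Rates

/-! ### The energy inequality -/

section Energy

variable {d k : ℕ} {R : Euc k → ℝ} {Φ : Euc (d + 1) → Euc k} {V : Euc (d + 1) → ℝ} {S σ T : ℝ}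
  {ρ : ℝ → Measure (Euc (d + 1))}

lemma IsFlowSolution.solvesAgainst_inner (hf : IsFlowSolution R Φ V σ T ρ)
    (h : ProblemBounds R Φ V S) (hσ : 0 ≤ σ) (c : Euc k) :
    SolvesAgainst σ T ρ (fun t => velocity R Φ V (ρ t)) (fun θ => inner ℝ c (Φ θ)) := by
  have hS := h.one_le
  refine (hf.isLinearGrowthSolution h hσ).solvesAgainst (A := ‖c‖ * (4 * S ^ 2))
    (fun θ => (h.hasFDerivAt_inner c θ).differentiableAt) (fun θ => ?_) (fun θ => ?_)
  · refine (abs_real_inner_le_norm _ _).trans ?_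
    rw [mul_assoc]
    refine mul_le_mul_of_nonneg_left ((h.Φ_le θ).trans ?_) (norm_nonneg _)
    exact mul_le_mul_of_nonneg_right (by nlinarith) (by positivity)
  · rw [(h.hasFDerivAt_inner c θ).fderiv]
    refine (ContinuousLinearMap.opNorm_comp_le _ _).trans ?_
    rw [innerSL_apply_norm, mul_assoc]
    exact mul_le_mul_of_nonneg_left (h.fderiv_Φ_le θ) (norm_nonneg _)

lemma IsFlowSolution.solvesAgainst_V (hf : IsFlowSolution R Φ V σ T ρ)
    (h : ProblemBounds R Φ V S) (hσ : 0 ≤ σ) :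
    SolvesAgainst σ T ρ (fun t => velocity R Φ V (ρ t)) V :=
  (hf.isLinearGrowthSolution h hσ).solvesAgainst h.V_diff h.V_le h.fderiv_V_le

lemma IsFlowSolution.integrableOn_featureRate (hf : IsFlowSolution R Φ V σ T ρ)
    (h : ProblemBounds R Φ V S) (hσ : 0 ≤ σ) :
    IntegrableOn (fun r => featureRate R Φ V σ (ρ r)) (Set.Icc 0 T) := by
  have hsum : IntegrableOn (fun r => ∑ i, inner ℝ (EuclideanSpace.basisFun (Fin k) ℝ i)
      (featureRate R Φ V σ (ρ r)) • EuclideanSpace.basisFun (Fin k) ℝ i) (Set.Icc 0 T) := by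
    refine integrable_finsetSum _ fun i _ => Integrable.smul_const ?_ _
    refine (hf.solvesAgainst_inner h hσ (EuclideanSpace.basisFun (Fin k) ℝ i)).1.congr_fun
      (fun r hr => ?_) measurableSet_Icc
    exact (h.inner_featureRate (hf.mem_P₂ r hr).2 _).symm
  simpa only [OrthonormalBasis.sum_repr'] using hsum

lemma IsFlowSolution.intervalIntegrable_featureRate (hf : IsFlowSolution R Φ V σ T ρ)
    (h : ProblemBounds R Φ V S) (hσ : 0 ≤ σ) {s t : ℝ} (hs : s ∈ Set.Icc 0 T)
    (ht : t ∈ Set.Icc 0 T) :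
    IntervalIntegrable (fun r => featureRate R Φ V σ (ρ r)) volume s t :=
  ((hf.integrableOn_featureRate h hσ).mono_set (Set.uIcc_subset_Icc hs ht)).intervalIntegrable

lemma IsFlowSolution.integral_featureRate (hf : IsFlowSolution R Φ V σ T ρ)
    (h : ProblemBounds R Φ V S) (hσ : 0 ≤ σ) {s t : ℝ} (hs : s ∈ Set.Icc 0 T)
    (ht : t ∈ Set.Icc 0 T) :
    ∫ θ, Φ θ ∂(ρ t) - ∫ θ, Φ θ ∂(ρ s) = ∫ r in s..t, featureRate R Φ V σ (ρ r) := by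
  refine ext_inner_left ℝ fun c => ?_
  have h1 := (hf.solvesAgainst_inner h hσ c).sub_eq hs ht
  rw [integral_inner (h.integrable_Φ (hf.mem_P₂ t ht).2),
    integral_inner (h.integrable_Φ (hf.mem_P₂ s hs).2), ← inner_sub_right] at h1
  have h2 := (innerSL ℝ c).intervalIntegral_comp_comm
    (hf.intervalIntegrable_featureRate h hσ hs ht)
  rw [innerSL_apply_apply] at h2
  rw [h1, ← h2]
  refine intervalIntegral.integral_congr fun r hr => ?_
  rw [innerSL_apply_apply]
  exact (h.inner_featureRate (hf.mem_P₂ r (Set.uIcc_subset_Icc hs ht hr)).2 c).symm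

lemma IsFlowSolution.exists_featureRate_bound (hf : IsFlowSolution R Φ V σ T ρ)
    (h : ProblemBounds R Φ V S) (hσ : 0 ≤ σ) :
    ∃ K, 0 ≤ K ∧ ∀ t ∈ Set.Icc 0 T, ‖featureRate R Φ V σ (ρ t)‖ ≤ K := by
  obtain ⟨N, hN0, hN⟩ := (hf.isLinearGrowthSolution h hσ).exists_moment_bound
  have hS := h.pos
  refine ⟨σ * S * (N + 1) + 2 * S ^ 2 * (1 * ((5 * S ^ 3) ^ 2 * N) + N / 1), by positivity,
    fun t ht => ?_⟩
  have hμ := (hf.mem_P₂ t ht).2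
  refine (h.norm_featureRate_le hσ hμ one_pos).trans ?_
  have h1 := hN t ht
  have h2 := h.dissipation_le hμ
  have h3 : (5 * S ^ 3) ^ 2 * (∫ θ, ‖θ‖ ^ 2 ∂(ρ t)) ≤ (5 * S ^ 3) ^ 2 * N := by gcongr
  gcongr
  exact h2.trans h3

lemma IsFlowSolution.norm_mean_sub_le (hf : IsFlowSolution R Φ V σ T ρ)
    (h : ProblemBounds R Φ V S) (hσ : 0 ≤ σ) {K : ℝ}
    (hK : ∀ t ∈ Set.Icc 0 T, ‖featureRate R Φ V σ (ρ t)‖ ≤ K) {s t : ℝ} (hs : s ∈ Set.Icc 0 T)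
    (ht : t ∈ Set.Icc 0 T) (hst : s ≤ t) :
    ‖∫ θ, Φ θ ∂(ρ t) - ∫ θ, Φ θ ∂(ρ s)‖ ≤ K * (t - s) := by
  rw [hf.integral_featureRate h hσ hs ht]
  have := intervalIntegral.norm_integral_le_of_norm_le_const
    (f := fun r => featureRate R Φ V σ (ρ r)) (C := K) (a := s) (b := t) (fun r hr => by
      rw [Set.uIoc_of_le hst] at hr
      exact hK r ⟨hs.1.trans hr.1.le, hr.2.trans ht.2⟩)
  rwa [abs_of_nonneg (by linarith : 0 ≤ t - s)] at this

lemma IsFlowSolution.continuousOn_mean (hf : IsFlowSolution R Φ V σ T ρ)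
    (h : ProblemBounds R Φ V S) (hσ : 0 ≤ σ) :
    ContinuousOn (fun t => ∫ θ, Φ θ ∂(ρ t)) (Set.Icc 0 T) := by
  obtain ⟨K, hK0, hK⟩ := hf.exists_featureRate_bound h hσ
  have : LipschitzOnWith K.toNNReal (fun t => ∫ θ, Φ θ ∂(ρ t)) (Set.Icc 0 T) := by
    refine LipschitzOnWith.of_dist_le_mul fun s hs t ht => ?_
    rw [Real.coe_toNNReal _ hK0]
    rcases le_total s t with hst | hst
    · rw [dist_comm, dist_comm s, dist_eq_norm, Real.dist_eq, abs_of_nonneg (by linarith)]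
      exact hf.norm_mean_sub_le h hσ hK hs ht hst
    · rw [dist_eq_norm, Real.dist_eq, abs_of_nonneg (by linarith)]
      exact hf.norm_mean_sub_le h hσ hK ht hs hst
  exact this.continuousOn

lemma IsFlowSolution.continuousOn_gradient (hf : IsFlowSolution R Φ V σ T ρ)
    (h : ProblemBounds R Φ V S) (hσ : 0 ≤ σ) :
    ContinuousOn (fun t => gradient R (∫ θ, Φ θ ∂(ρ t))) (Set.Icc 0 T) :=
  h.loss.differentiable_gradient.continuous.comp_continuousOn (hf.continuousOn_mean h hσ)

lemma IsFlowSolution.continuousOn_integral_V (hf : IsFlowSolution R Φ V σ T ρ)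
    (h : ProblemBounds R Φ V S) (hσ : 0 ≤ σ) :
    ContinuousOn (fun t => ∫ θ, V θ ∂(ρ t)) (Set.Icc 0 T) := by
  have hV := hf.solvesAgainst_V h hσ
  rcases lt_or_ge T 0 with hT | hT
  · simp [Set.Icc_eq_empty_of_lt hT]
  have h1 : ContinuousOn (fun t => ∫ θ, V θ ∂(ρ 0) +
      ∫ s in (0 : ℝ)..t, weakRHS σ (ρ s) (velocity R Φ V (ρ s)) V) (Set.Icc 0 T) := by
    have h2 := hV.1
    rw [← Set.uIcc_of_le hT] at h2 ⊢
    exact continuousOn_const.add (intervalIntegral.continuousOn_primitive_interval h2)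
  exact h1.congr fun t ht => hV.2 t ht

lemma IsFlowSolution.integrableOn_inner_featureRate (hf : IsFlowSolution R Φ V σ T ρ)
    (h : ProblemBounds R Φ V S) (hσ : 0 ≤ σ) :
    IntegrableOn (fun r => inner ℝ (gradient R (∫ θ, Φ θ ∂(ρ r))) (featureRate R Φ V σ (ρ r)))
      (Set.Icc 0 T) := by
  refine ((hf.integrableOn_featureRate h hσ).norm.const_mul S).mono'
    (((hf.continuousOn_gradient h hσ).aestronglyMeasurable measurableSet_Icc).inner
      (hf.integrableOn_featureRate h hσ).aestronglyMeasurable)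
    (Eventually.of_forall fun r => (abs_real_inner_le_norm _ _).trans ?_)
  exact mul_le_mul_of_nonneg_right (h.loss.gradient_le _) (norm_nonneg _)

/-- Measurability in time of the dissipation comes from its expression through the rates of the
features and of the regularizer, which are integrable in time as limits of the rates of smooth test
functions. -/
lemma IsFlowSolution.integrableOn_dissipation (hf : IsFlowSolution R Φ V σ T ρ)
    (h : ProblemBounds R Φ V S) (hσ : 0 ≤ σ) :
    IntegrableOn (fun r => dissipation R Φ V (ρ r)) (Set.Icc 0 T) := by
  have hg := hf.continuousOn_gradient h hσ
  have h1 : ContinuousOn (fun r =>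
      -σ * (inner ℝ (gradient R (∫ x, Φ x ∂(ρ r))) (∫ x, Φ x ∂(ρ r)) + ∫ θ, V θ ∂(ρ r)) +
      σ * (inner ℝ (gradient R (∫ x, Φ x ∂(ρ r))) (∫ x, Φ x ∂(uniformSphere d)) +
        ∫ θ, V θ ∂(uniformSphere d))) (Set.Icc 0 T) :=
    (((hg.inner (𝕜 := ℝ) (hf.continuousOn_mean h hσ)).add (hf.continuousOn_integral_V h hσ)).const_mul
      _).add (((hg.inner (𝕜 := ℝ) continuousOn_const).add continuousOn_const).const_mul _)
  refine ((h1.integrableOn_compact isCompact_Icc).sub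
    ((hf.integrableOn_inner_featureRate h hσ).add (hf.solvesAgainst_V h hσ).1)).congr_fun
    (fun r hr => ?_) measurableSet_Icc
  have hμ := (hf.mem_P₂ r hr).2
  have e := h.rate_linearization (σ := σ) hμ
  rw [h.integral_linearization hμ, h.integral_linearization (integrable_sq_uniformSphere' d)] at e
  simp only [Pi.sub_apply, Pi.add_apply]
  linarith

/-- The chain rule for the objective along the flow, as an inequality. The objective is only known
to be Lipschitz in time; the defect of the linear approximation over a short step is quadratic in
its length by convexity of `R`. -/
lemma IsFlowSolution.objective_sub_le (hf : IsFlowSolution R Φ V σ T ρ)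
    (h : ProblemBounds R Φ V S) (hσ : 0 ≤ σ) {s t : ℝ} (hs : s ∈ Set.Icc 0 T)
    (ht : t ∈ Set.Icc 0 T) (hst : s ≤ t) :
    objective R Φ V (ρ t) - objective R Φ V (ρ s) ≤
      ∫ r in s..t, (inner ℝ (gradient R (∫ θ, Φ θ ∂(ρ r))) (featureRate R Φ V σ (ρ r)) +
        weakRHS σ (ρ r) (velocity R Φ V (ρ r)) V) := by
  obtain ⟨K, hK0, hK⟩ := hf.exists_featureRate_bound h hσ
  have hS := h.pos
  set q : ℝ → ℝ := fun r => inner ℝ (gradient R (∫ θ, Φ θ ∂(ρ r))) (featureRate R Φ V σ (ρ r)) +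
        weakRHS σ (ρ r) (velocity R Φ V (ρ r)) V with hq
  have hqi : IntegrableOn q (Set.Icc 0 T) :=
    (hf.integrableOn_inner_featureRate h hσ).add (hf.solvesAgainst_V h hσ).1
  have hqii : ∀ s ∈ Set.Icc 0 T, ∀ t ∈ Set.Icc 0 T, IntervalIntegrable q volume s t :=
    fun s hs t ht => (hqi.mono_set (Set.uIcc_subset_Icc hs ht)).intervalIntegrable
  have step : ∀ x ∈ Set.Icc 0 T, ∀ y ∈ Set.Icc 0 T, x ≤ y →
      objective R Φ V (ρ y) - objective R Φ V (ρ x) ≤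
        (∫ r in x..y, q r) + 2 * S * K ^ 2 * (y - x) ^ 2 := by
    intro x hx y hy hxy
    set a := gradient R (∫ θ, Φ θ ∂(ρ x)) with ha
    have hyx : 0 ≤ y - x := by linarith
    have h1 := h.loss.le_tangent_add (∫ θ, Φ θ ∂(ρ x)) (∫ θ, Φ θ ∂(ρ y))
    have h2 := hf.norm_mean_sub_le h hσ hK hx hy hxy
    have h3 : S * ‖∫ θ, Φ θ ∂(ρ y) - ∫ θ, Φ θ ∂(ρ x)‖ ^ 2 ≤ S * (K * (y - x)) ^ 2 := by gcongr
    have h4 : inner ℝ a (∫ θ, Φ θ ∂(ρ y) - ∫ θ, Φ θ ∂(ρ x)) =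
        ∫ r in x..y, inner ℝ a (featureRate R Φ V σ (ρ r)) := by
      rw [hf.integral_featureRate h hσ hx hy]
      exact ((innerSL ℝ a).intervalIntegral_comp_comm
        (hf.intervalIntegrable_featureRate h hσ hx hy)).symm
    have h5 := (hf.solvesAgainst_V h hσ).sub_eq hx hy
    have hii : IntervalIntegrable (fun r => inner ℝ a (featureRate R Φ V σ (ρ r))) volume x y := by
      have := (hf.intervalIntegrable_featureRate h hσ hx hy)
      exact ⟨this.1.const_inner a, this.2.const_inner a⟩
    have hVi := (hf.solvesAgainst_V h hσ).intervalIntegrable hx hy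
    have h6 : (∫ r in x..y, inner ℝ a (featureRate R Φ V σ (ρ r))) +
        (∫ r in x..y, weakRHS σ (ρ r) (velocity R Φ V (ρ r)) V) ≤
        ∫ r in x..y, (q r + S * (K * (y - x)) * K) := by
      rw [← intervalIntegral.integral_add hii hVi]
      refine intervalIntegral.integral_mono_on hxy (hii.add hVi)
        ((hqii x hx y hy).add intervalIntegrable_const) fun r hr => ?_
      have hr1 : r ∈ Set.Icc 0 T := ⟨hx.1.trans hr.1, hr.2.trans hy.2⟩
      have h7 : inner ℝ (a - gradient R (∫ θ, Φ θ ∂(ρ r))) (featureRate R Φ V σ (ρ r)) ≤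
          S * (K * (y - x)) * K := by
        refine (real_inner_le_norm _ _).trans ?_
        refine mul_le_mul ?_ (hK r hr1) (norm_nonneg _) (by positivity)
        rw [norm_sub_rev]
        refine (h.loss.lipschitz_gradient _ _).trans ?_
        refine mul_le_mul_of_nonneg_left ?_ hS.le
        refine (hf.norm_mean_sub_le h hσ hK hx hr1 hr.1).trans ?_
        exact mul_le_mul_of_nonneg_left (by linarith [hr.2]) hK0
      rw [inner_sub_left] at h7
      rw [hq]
      beta_reduce
      linarith
    rw [intervalIntegral.integral_add (hqii x hx y hy) intervalIntegrable_const,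
      intervalIntegral.integral_const, smul_eq_mul] at h6
    unfold objective
    nlinarith
  have := le_of_quadratic_defect (g := fun r => (∫ z in s..r, q z) - objective R Φ V (ρ r))
    (s := s) (e := t) (K := 2 * S * K ^ 2) hst (by positivity) (fun x hx y hy hxy => by
      have hx1 : x ∈ Set.Icc 0 T := ⟨hs.1.trans hx.1, hx.2.trans ht.2⟩
      have hy1 : y ∈ Set.Icc 0 T := ⟨hs.1.trans hy.1, hy.2.trans ht.2⟩
      have h1 := step x hx1 y hy1 hxy
      have h2 := intervalIntegral.integral_add_adjacent_intervals (hqii s hs x hx1)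
        (hqii x hx1 y hy1)
      linarith)
  simp only [intervalIntegral.integral_same] at this
  linarith

/-- The energy inequality. -/
lemma IsFlowSolution.objective_sub_le_sub_dissipation (hf : IsFlowSolution R Φ V σ T ρ)
    (h : ProblemBounds R Φ V S) (hσ : 0 ≤ σ) (hR : R 0 ≤ 2 * S ^ 4) {s t : ℝ}
    (hs : s ∈ Set.Icc 0 T) (ht : t ∈ Set.Icc 0 T) (hst : s ≤ t) :
    objective R Φ V (ρ t) - objective R Φ V (ρ s) ≤
      4 * σ * S ^ 4 * (t - s) - ∫ r in s..t, dissipation R Φ V (ρ r) := by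
  have hD : IntervalIntegrable (fun r => dissipation R Φ V (ρ r)) volume s t :=
    ((hf.integrableOn_dissipation h hσ).mono_set (Set.uIcc_subset_Icc hs ht)).intervalIntegrable
  have h1 : ∫ r in s..t, (inner ℝ (gradient R (∫ θ, Φ θ ∂(ρ r))) (featureRate R Φ V σ (ρ r)) +
        weakRHS σ (ρ r) (velocity R Φ V (ρ r)) V) ≤
      ∫ r in s..t, (4 * σ * S ^ 4 - dissipation R Φ V (ρ r)) := by
    refine intervalIntegral.integral_mono_on hst
      ((((hf.integrableOn_inner_featureRate h hσ).add (hf.solvesAgainst_V h hσ).1).mono_set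
        (Set.uIcc_subset_Icc hs ht)).intervalIntegrable)
      (intervalIntegrable_const.sub hD) fun r hr => ?_
    exact h.rate_linearization_le hσ (hf.mem_P₂ r ⟨hs.1.trans hr.1, hr.2.trans ht.2⟩).2 hR
  rw [intervalIntegral.integral_sub intervalIntegrable_const hD, intervalIntegral.integral_const,
    smul_eq_mul] at h1
  linarith [hf.objective_sub_le h hσ hs ht hst]

end Energy

/-! ### Amplification of the noise in a cone of descent -/

lemma hasDerivAt_max_zero_sq (x : ℝ) :
    HasDerivAt (fun y : ℝ => max y 0 ^ 2) (2 * max x 0) x := by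
  have h1 : (fun y : ℝ => max y 0 ^ 2 - (max x 0 ^ 2 + 2 * max x 0 * (y - x))) =O[𝓝 x]
      fun y => ‖y - x‖ ^ 2 := by
    refine Asymptotics.IsBigO.of_bound 1 (Eventually.of_forall fun y => ?_)
    rw [one_mul, norm_pow, norm_norm, Real.norm_eq_abs, Real.norm_eq_abs, sq_abs, abs_le]
    rcases le_total x 0 with hx | hx <;> rcases le_total y 0 with hy | hy <;>
      simp only [hx, hy, max_eq_left, max_eq_right] <;> constructor <;> nlinarith
  have h2 := (h1.hasFDerivAt (𝕜 := ℝ) one_lt_two).hasDerivAt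
  have h3 : HasDerivAt (fun y : ℝ => max x 0 ^ 2 + 2 * max x 0 * (y - x)) (2 * max x 0) x := by
    simpa using (((hasDerivAt_id x).sub_const x).const_mul (2 * max x 0)).const_add (max x 0 ^ 2)
  have h4 := h2.add h3
  simp only [zero_apply, zero_add] at h4
  refine h4.congr_of_eventuallyEq (Eventually.of_forall fun y => ?_)
  simp

section CapFunction

variable {d k : ℕ} {R : Euc k → ℝ} {Φ : Euc (d + 1) → Euc k} {V : Euc (d + 1) → ℝ} {S : ℝ}

/-- The 2-homogeneous test function `(s ‖θ‖² - F(θ))₊² / ‖θ‖²` with `F = ⟨a, Φ⟩ + V`. It is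
supported on the cone over the part of the sphere where `F < s`. -/
noncomputable def capFunction (Φ : Euc (d + 1) → Euc k) (V : Euc (d + 1) → ℝ) (s : ℝ) (a : Euc k)
    (θ : Euc (d + 1)) : ℝ :=
  max (s * ‖θ‖ ^ 2 - linearization Φ V a θ) 0 ^ 2 / ‖θ‖ ^ 2

lemma capFunction_nonneg (s : ℝ) (a : Euc k) (θ : Euc (d + 1)) : 0 ≤ capFunction Φ V s a θ :=
  div_nonneg (sq_nonneg _) (sq_nonneg _)

variable {s : ℝ} {a : Euc k}

lemma ProblemBounds.max_le (h : ProblemBounds R Φ V S) (hs : |s| ≤ 1) (ha : ‖a‖ ≤ S)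
    (θ : Euc (d + 1)) :
    max (s * ‖θ‖ ^ 2 - linearization Φ V a θ) 0 ≤ 3 * S ^ 2 * ‖θ‖ ^ 2 := by
  have hS := h.one_le
  have h1 := abs_le.1 (h.abs_linearization_le ha θ)
  have h2 := abs_le.1 hs
  have h3 : 1 ≤ S ^ 2 := one_le_pow₀ hS
  refine _root_.max_le ?_ (by positivity)
  nlinarith [sq_nonneg ‖θ‖, mul_le_mul_of_nonneg_right h2.2 (sq_nonneg ‖θ‖),
    mul_le_mul_of_nonneg_right h3 (sq_nonneg ‖θ‖)]

lemma ProblemBounds.capFunction_le (h : ProblemBounds R Φ V S) (hs : |s| ≤ 1) (ha : ‖a‖ ≤ S)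
    (θ : Euc (d + 1)) : capFunction Φ V s a θ ≤ 9 * S ^ 4 * ‖θ‖ ^ 2 := by
  rcases eq_or_ne θ 0 with rfl | hθ
  · simp [capFunction]
  have hθ' : 0 < ‖θ‖ := norm_pos_iff.2 hθ
  rw [capFunction, div_le_iff₀ (by positivity)]
  calc _ ≤ (3 * S ^ 2 * ‖θ‖ ^ 2) ^ 2 := pow_le_pow_left₀ (le_max_right _ _) (h.max_le hs ha θ) 2
    _ = _ := by ring

lemma ProblemBounds.hasFDerivAt_capFunction (h : ProblemBounds R Φ V S) (s : ℝ) (a : Euc k)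
    {θ : Euc (d + 1)} (hθ : θ ≠ 0) :
    HasFDerivAt (capFunction Φ V s a)
      ((2 * max (s * ‖θ‖ ^ 2 - linearization Φ V a θ) 0 / ‖θ‖ ^ 2) •
        ((2 * s) • innerSL ℝ θ - fderiv ℝ (linearization Φ V a) θ) -
      (2 * max (s * ‖θ‖ ^ 2 - linearization Φ V a θ) 0 ^ 2 / ‖θ‖ ^ 4) • innerSL ℝ θ) θ := by
  have hθ' : ‖θ‖ ≠ 0 := norm_ne_zero_iff.2 hθ
  have hq : HasFDerivAt (fun y : Euc (d + 1) => ‖y‖ ^ 2) ((2 : ℕ) • (innerSL ℝ θ)) θ :=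
    (hasStrictFDerivAt_norm_sq θ).hasFDerivAt
  have hW := (hq.const_mul s).sub (h.differentiable_linearization a θ).hasFDerivAt
  have hp := HasDerivAt.comp_hasFDerivAt (h₂ := fun y : ℝ => max y 0 ^ 2) θ
    (hasDerivAt_max_zero_sq (s * ‖θ‖ ^ 2 - linearization Φ V a θ)) hW
  have hi := HasDerivAt.comp_hasFDerivAt (h₂ := fun y : ℝ => y⁻¹) θ
    (hasDerivAt_inv (pow_ne_zero 2 hθ')) hq
  have hm := hp.mul hi
  refine (hm.congr_fderiv ?_).congr_of_eventuallyEq (Eventually.of_forall fun y => ?_)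
  · ext w
    simp
    field_simp
    ring
  · simp [capFunction, div_eq_mul_inv]

lemma ProblemBounds.capFunction_regular (h : ProblemBounds R Φ V S) (hs : |s| ≤ 1)
    (ha : ‖a‖ ≤ S) (θ : Euc (d + 1)) : DifferentiableAt ℝ (capFunction Φ V s a) θ ∧
      ‖fderiv ℝ (capFunction Φ V s a) θ‖ ≤ 60 * S ^ 5 * ‖θ‖ := by
  have hS := h.one_le
  have hS0 := h.pos
  rcases eq_or_ne θ 0 with rfl | hθ
  · have := hasFDerivAt_zero_of_norm_le_sq (f := capFunction Φ V s a) (A := 9 * S ^ 4) fun θ => by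
      rw [Real.norm_of_nonneg (capFunction_nonneg _ _ _)]; exact h.capFunction_le hs ha θ
    exact ⟨this.differentiableAt, by rw [this.fderiv]; simp⟩
  · have hd := h.hasFDerivAt_capFunction s a hθ
    refine ⟨hd.differentiableAt, ?_⟩
    have hθ' : 0 < ‖θ‖ := norm_pos_iff.2 hθ
    rw [hd.fderiv]
    set m := max (s * ‖θ‖ ^ 2 - linearization Φ V a θ) 0
    have hm0 : 0 ≤ m := le_max_right _ _
    have hm := h.max_le hs ha θ
    have h1 : ‖(2 * s) • innerSL ℝ θ - fderiv ℝ (linearization Φ V a) θ‖ ≤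
        2 * ‖θ‖ + 5 * S ^ 3 * ‖θ‖ := by
      refine (norm_sub_le _ _).trans (add_le_add ?_ (h.norm_fderiv_linearization_le ha θ))
      rw [norm_smul, innerSL_apply_norm, Real.norm_eq_abs, abs_mul, abs_two]
      nlinarith
    have h2 : 2 * m / ‖θ‖ ^ 2 ≤ 6 * S ^ 2 := by
      rw [div_le_iff₀ (by positivity)]; linarith
    have h3 : 2 * m ^ 2 / ‖θ‖ ^ 4 ≤ 18 * S ^ 4 := by
      rw [div_le_iff₀ (by positivity)]
      calc 2 * m ^ 2 ≤ 2 * (3 * S ^ 2 * ‖θ‖ ^ 2) ^ 2 := by gcongr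
        _ = _ := by ring
    refine (norm_sub_le _ _).trans ?_
    rw [norm_smul, norm_smul, innerSL_apply_norm, Real.norm_of_nonneg (by positivity),
      Real.norm_of_nonneg (by positivity)]
    have h4 : S ^ 2 ≤ S ^ 5 := pow_le_pow_right₀ hS (by norm_num)
    have h5 : S ^ 4 ≤ S ^ 5 := pow_le_pow_right₀ hS (by norm_num)
    calc _ ≤ 6 * S ^ 2 * (2 * ‖θ‖ + 5 * S ^ 3 * ‖θ‖) + 18 * S ^ 4 * ‖θ‖ := by gcongr
      _ = (12 * S ^ 2 + 30 * S ^ 5 + 18 * S ^ 4) * ‖θ‖ := by ring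
      _ ≤ _ := mul_le_mul_of_nonneg_right (by linarith) hθ'.le

/-- The gradient flow of `F` transports mass into the cone `F < s ‖θ‖²` and
outwards along it. The level sets are not crossed because `‖∇F‖ ≥ 2 |F| / ‖θ‖` by Euler's
identity. -/
lemma ProblemBounds.le_fderiv_capFunction (h : ProblemBounds R Φ V S) {δ : ℝ}
    (hs : s ≤ -(δ / 4)) (hs1 : |s| ≤ 1) (ha : ‖a‖ ≤ S) (θ : Euc (d + 1)) :
    δ * capFunction Φ V s a θ ≤
      fderiv ℝ (capFunction Φ V s a) θ (-gradient (linearization Φ V a) θ) := by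
  rcases eq_or_ne θ 0 with rfl | hθ
  · have := (h.capFunction_regular hs1 ha 0).2
    have h0 : fderiv ℝ (capFunction Φ V s a) 0 = 0 := by simpa using this
    simp [h0, capFunction]
  have hθ' : 0 < ‖θ‖ := norm_pos_iff.2 hθ
  rw [(h.hasFDerivAt_capFunction s a hθ).fderiv, capFunction]
  set F := linearization Φ V a with hF
  have hE : inner ℝ (gradient F θ) θ = 2 * F θ := by
    rw [inner_gradient_left, (h.twoHomogeneous_linearization a).euler
      (h.differentiable_linearization a) θ, smul_eq_mul]
  have hE' : inner ℝ θ (gradient F θ) = 2 * F θ := by rw [real_inner_comm, hE]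
  have hCS : (2 * F θ) ^ 2 ≤ ‖gradient F θ‖ ^ 2 * ‖θ‖ ^ 2 := by
    rw [← hE, ← mul_pow, ← sq_abs]
    exact pow_le_pow_left₀ (abs_nonneg _) (abs_real_inner_le_norm _ _) 2
  have hg : fderiv ℝ F θ (gradient F θ) = ‖gradient F θ‖ ^ 2 := by
    rw [← inner_gradient_left, real_inner_self_eq_norm_sq]
  simp only [sub_apply, smul_apply, map_neg,
    innerSL_apply_apply, hE', hg, smul_eq_mul]
  generalize ‖gradient F θ‖ ^ 2 = g at *
  generalize F θ = f at *
  have hn : 0 < ‖θ‖ ^ 2 := by positivity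
  rw [show ‖θ‖ ^ 4 = (‖θ‖ ^ 2) ^ 2 by ring]
  generalize ‖θ‖ ^ 2 = n at *
  rcases le_or_gt (s * n - f) 0 with hW | hW
  · simp [max_eq_right hW]
  rw [max_eq_left hW.le]
  set W := s * n - f with hWdef
  have h1 : 4 * f ^ 2 / n ≤ g := by rw [div_le_iff₀ hn]; linarith
  have h2 : f / n ≤ -(δ / 4) := by
    rw [div_le_iff₀ hn]; nlinarith
  have h3 : 0 ≤ 2 * W / n := by positivity
  have h4 : δ * (W ^ 2 / n) ≤ -4 * (f / n) * (W ^ 2 / n) :=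
    mul_le_mul_of_nonneg_right (by linarith) (by positivity)
  have h5 := mul_le_mul_of_nonneg_left h1 h3
  have e : -(2 * W / n * (2 * s * (2 * f) - g) - 2 * W ^ 2 / n ^ 2 * (2 * f)) =
      2 * W / n * g - 2 * W / n * (4 * f ^ 2 / n) + -4 * (f / n) * (W ^ 2 / n) := by
    rw [hWdef]; field_simp; ring
  rw [e]
  linarith

lemma ProblemBounds.abs_linearization_sub_le (h : ProblemBounds R Φ V S) (a b : Euc k)
    (θ : Euc (d + 1)) :
    |linearization Φ V b θ - linearization Φ V a θ| ≤ S * ‖b - a‖ * ‖θ‖ ^ 2 := by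
  have : linearization Φ V b θ - linearization Φ V a θ = inner ℝ (b - a) (Φ θ) := by
    simp only [linearization, inner_sub_left]; ring
  rw [this]
  refine (abs_real_inner_le_norm _ _).trans ?_
  calc _ ≤ ‖b - a‖ * (S * ‖θ‖ ^ 2) := mul_le_mul_of_nonneg_left (h.Φ_le θ) (norm_nonneg _)
    _ = _ := by ring

lemma ProblemBounds.capFunction_mono (h : ProblemBounds R Φ V S) {s' : ℝ} {b : Euc k}
    (hs : S * ‖b - a‖ ≤ s' - s) (θ : Euc (d + 1)) :
    capFunction Φ V s a θ ≤ capFunction Φ V s' b θ := by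
  have h1 := abs_le.1 (h.abs_linearization_sub_le a b θ)
  have h2 := mul_le_mul_of_nonneg_right hs (sq_nonneg ‖θ‖)
  unfold capFunction
  have h3 : s * ‖θ‖ ^ 2 - linearization Φ V a θ ≤ s' * ‖θ‖ ^ 2 - linearization Φ V b θ := by
    linarith
  have h4 := max_le_max_right 0 h3
  gcongr

lemma ProblemBounds.norm_gradient_linearization_sub_le (h : ProblemBounds R Φ V S) (a b : Euc k)
    (θ : Euc (d + 1)) :
    ‖gradient (linearization Φ V b) θ - gradient (linearization Φ V a) θ‖ ≤
      4 * S ^ 2 * ‖b - a‖ * ‖θ‖ := by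
  have h1 : gradient (linearization Φ V b) θ - gradient (linearization Φ V a) θ =
      (InnerProductSpace.toDual ℝ _).symm ((innerSL ℝ (b - a)).comp (fderiv ℝ Φ θ)) := by
    simp only [gradient, ← map_sub]
    rw [(h.hasFDerivAt_linearization b θ).fderiv, (h.hasFDerivAt_linearization a θ).fderiv]
    congr 1
    ext w
    simp
  rw [h1, LinearIsometryEquiv.norm_map]
  refine (ContinuousLinearMap.opNorm_comp_le _ _).trans ?_
  rw [innerSL_apply_norm]
  calc _ ≤ ‖b - a‖ * (4 * S ^ 2 * ‖θ‖) :=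
        mul_le_mul_of_nonneg_left (h.fderiv_Φ_le θ) (norm_nonneg _)
    _ = _ := by ring

/-- The noise charges the cap: if `F ≤ -δ` at some point of the sphere, then `F ≤ -3δ/4` on a cap
of radius `δ / (20 S³)`. -/
lemma ProblemBounds.le_integral_capFunction (h : ProblemBounds R Φ V S) {δ : ℝ} (hδ : 0 < δ)
    (hδ1 : δ ≤ 1) (ha : ‖a‖ ≤ S) {x : Euc (d + 1)}
    (hx : x ∈ Metric.sphere (0 : Euc (d + 1)) 1) (hF : linearization Φ V a x ≤ -δ) :
    δ ^ 2 / 16 * (δ / (80 * S ^ 3)) ^ (d + 1) ≤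
      ∫ θ, capFunction Φ V (-(δ / 2)) a θ ∂(uniformSphere d) := by
  have hS := h.one_le
  have hS0 := h.pos
  set r := δ / (20 * S ^ 3) with hr
  have hr0 : 0 < r := by positivity
  have hS3 : 1 ≤ S ^ 3 := one_le_pow₀ hS
  have hr1 : r ≤ 1 := by rw [hr, div_le_one (by positivity)]; linarith
  have hx1 : ‖x‖ = 1 := by simpa using hx
  have hs1 : |-(δ / 2)| ≤ 1 := by rw [abs_neg, abs_of_pos (by linarith)]; linarith
  have hball := pow_le_uniformSphere_ball d hx hr0 hr1
  have hr4 : r / 4 = δ / (80 * S ^ 3) := by rw [hr]; field_simp; norm_num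
  rw [hr4] at hball
  have hcap : ∀ θ ∈ Metric.sphere (0 : Euc (d + 1)) 1, θ ∈ Metric.ball x r →
      δ ^ 2 / 16 ≤ capFunction Φ V (-(δ / 2)) a θ := by
    intro θ hθ hθr
    have hθ1 : ‖θ‖ = 1 := by simpa using hθ
    have hlip : |linearization Φ V a θ - linearization Φ V a x| ≤ 5 * S ^ 3 * ‖θ - x‖ := by
      refine Convex.norm_image_sub_le_of_norm_fderiv_le (𝕜 := ℝ)
        (s := Metric.closedBall (0 : Euc (d + 1)) 1)
        (fun y _ => h.differentiable_linearization a y) (fun y hy => ?_)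
        (convex_closedBall _ _) (Metric.sphere_subset_closedBall hx)
        (Metric.sphere_subset_closedBall hθ)
      have hy1 : ‖y‖ ≤ 1 := by simpa using hy
      refine (h.norm_fderiv_linearization_le ha y).trans ?_
      nlinarith
    have h1 : 5 * S ^ 3 * ‖θ - x‖ ≤ δ / 4 := by
      have : ‖θ - x‖ < r := by rwa [Metric.mem_ball, dist_eq_norm] at hθr
      calc _ ≤ 5 * S ^ 3 * r := by gcongr
        _ = δ / 4 := by rw [hr]; field_simp; norm_num
    have h2 := (abs_le.1 hlip).2
    rw [capFunction, hθ1]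
    have h3 : δ / 4 ≤ max (-(δ / 2) * 1 ^ 2 - linearization Φ V a θ) 0 :=
      le_trans (by linarith) (le_max_left _ _)
    calc δ ^ 2 / 16 = (δ / 4) ^ 2 := by ring
      _ ≤ _ := pow_le_pow_left₀ (by positivity) h3 2
      _ = _ := by ring
  have hint : Integrable (capFunction Φ V (-(δ / 2)) a) (uniformSphere d) := by
    refine integrable_of_sq_bound (integrable_sq_uniformSphere' d)
      (Differentiable.continuous fun θ =>
        (h.capFunction_regular hs1 ha θ).1).aestronglyMeasurable (A := 9 * S ^ 4) fun θ => ?_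
    rw [Real.norm_of_nonneg (capFunction_nonneg _ _ _)]
    exact h.capFunction_le hs1 ha θ
  calc _ ≤ δ ^ 2 / 16 * (uniformSphere d).real (Metric.ball x r) := by gcongr
    _ = ∫ θ in Metric.ball x r, δ ^ 2 / 16 ∂(uniformSphere d) := by
        rw [setIntegral_const, smul_eq_mul, mul_comm]
    _ ≤ ∫ θ in Metric.ball x r, capFunction Φ V (-(δ / 2)) a θ ∂(uniformSphere d) := by
        refine integral_mono_ae (integrable_const _) hint.integrableOn ?_
        filter_upwards [ae_restrict_mem Metric.isOpen_ball.measurableSet,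
          ae_restrict_of_ae (ae_mem_sphere_uniformSphere d)] with θ h1 h2 using hcap θ h2 h1
    _ ≤ _ := setIntegral_le_integral hint (Eventually.of_forall fun θ => capFunction_nonneg _ _ _)

end CapFunction

section CapGrowth

variable {d k : ℕ} {R : Euc k → ℝ} {Φ : Euc (d + 1) → Euc k} {V : Euc (d + 1) → ℝ} {S σ T : ℝ}
  {ρ : ℝ → Measure (Euc (d + 1))}

/-- Exponential growth of the mass in a cone of descent. If the first variation is below `-δ`
somewhere on the sphere at time `t₀`, and the features move little during `[t₀, t₁]`, then the mass
fed in by the noise grows exponentially. The level of the cone is raised at the speed at which the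
first variation changes, so that the test function is nondecreasing in time. -/
lemma IsFlowSolution.exponential_growth (hf : IsFlowSolution R Φ V σ T ρ)
    (h : ProblemBounds R Φ V S) (hσ : 0 ≤ σ) {N δ t₀ t₁ : ℝ}
    (hN : ∀ t ∈ Set.Icc 0 T, ∫ θ, ‖θ‖ ^ 2 ∂(ρ t) ≤ N) (hδ : 0 < δ) (hδ1 : δ ≤ 1)
    (hσδ : σ ≤ δ / 2) (ht₀ : t₀ ∈ Set.Icc 0 T) (ht₁ : t₁ ∈ Set.Icc 0 T) (ht : t₀ ≤ t₁)
    {x : Euc (d + 1)} (hx : x ∈ Metric.sphere (0 : Euc (d + 1)) 1)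
    (hF : linearization Φ V (gradient R (∫ θ, Φ θ ∂(ρ t₀))) x ≤ -δ)
    (hX : S ^ 2 * (∫ r in t₀..t₁, ‖featureRate R Φ V σ (ρ r)‖) ≤ δ / 4) :
    σ * (δ ^ 2 / 16 * (δ / (80 * S ^ 3)) ^ (d + 1)) * (Real.exp (δ / 2 * (t₁ - t₀)) - 1) ≤
      δ / 2 * (9 * S ^ 4 * N) := by
  obtain ⟨K, hK0, hK⟩ := hf.exists_featureRate_bound h hσ
  have hlg := hf.isLinearGrowthSolution h hσ
  have hS := h.one_le
  have hS0 := h.pos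
  have hN0 : 0 ≤ N := le_trans (integral_nonneg fun _ => by positivity) (hN t₀ ht₀)
  set u₀ : ℝ := δ ^ 2 / 16 * (δ / (80 * S ^ 3)) ^ (d + 1) with hu₀
  have hu₀0 : 0 ≤ u₀ := by positivity
  set X : ℝ → Euc k := fun r => featureRate R Φ V σ (ρ r) with hXdef
  set a : ℝ → Euc k := fun t => gradient R (∫ θ, Φ θ ∂(ρ t)) with hadef
  have ha : ∀ t, ‖a t‖ ≤ S := fun t => h.loss.gradient_le _
  set s : ℝ → ℝ := fun t => -(δ / 2) + S ^ 2 * ∫ r in t₀..t, ‖X r‖ with hsdef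
  have hmem : ∀ t ∈ Set.Icc t₀ t₁, t ∈ Set.Icc 0 T := fun t h =>
    ⟨ht₀.1.trans h.1, h.2.trans ht₁.2⟩
  have hii : ∀ t ∈ Set.Icc 0 T, ∀ t' ∈ Set.Icc 0 T, IntervalIntegrable (fun r => ‖X r‖) volume t t' :=
    fun t h1 t' h2 => (hf.intervalIntegrable_featureRate h hσ h1 h2).norm
  have hsstep : ∀ t ∈ Set.Icc t₀ t₁, ∀ t' ∈ Set.Icc t₀ t₁, t ≤ t' → S * ‖a t' - a t‖ ≤ s t' - s t := by
    intro t h1 t' h2 h12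
    have e : s t' - s t = S ^ 2 * ∫ r in t..t', ‖X r‖ := by
      rw [hsdef]
      beta_reduce
      rw [← intervalIntegral.integral_add_adjacent_intervals (hii t₀ ht₀ t (hmem t h1))
        (hii t (hmem t h1) t' (hmem t' h2))]
      ring
    have h3 : ‖a t' - a t‖ ≤ S * ∫ r in t..t', ‖X r‖ := by
      refine (h.loss.lipschitz_gradient _ _).trans (mul_le_mul_of_nonneg_left ?_ hS0.le)
      rw [hf.integral_featureRate h hσ (hmem t h1) (hmem t' h2)]
      exact intervalIntegral.norm_integral_le_integral_norm h12
    rw [e]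
    calc S * ‖a t' - a t‖ ≤ S * (S * ∫ r in t..t', ‖X r‖) := mul_le_mul_of_nonneg_left h3 hS0.le
      _ = _ := by ring
  have hst₀ : s t₀ = -(δ / 2) := by simp [hsdef]
  have hst₁ : s t₁ ≤ -(δ / 4) := by
    have : s t₁ = -(δ / 2) + S ^ 2 * ∫ r in t₀..t₁, ‖X r‖ := rfl
    linarith
  have hsmono : ∀ t ∈ Set.Icc t₀ t₁, ∀ t' ∈ Set.Icc t₀ t₁, t ≤ t' → s t ≤ s t' := fun t h1 t' h2 h12 => by
    have := hsstep t h1 t' h2 h12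
    have : 0 ≤ S * ‖a t' - a t‖ := by positivity
    linarith
  have hl : t₀ ∈ Set.Icc t₀ t₁ := ⟨le_rfl, ht⟩
  have hrr : t₁ ∈ Set.Icc t₀ t₁ := ⟨ht, le_rfl⟩
  have hs_le : ∀ t ∈ Set.Icc t₀ t₁, s t ≤ -(δ / 4) := fun t h1 =>
    (hsmono t h1 t₁ hrr h1.2).trans hst₁
  have hs_abs : ∀ t ∈ Set.Icc t₀ t₁, |s t| ≤ 1 := fun t h1 => by
    have h2 := hsmono t₀ hl t h1 h1.1
    have h3 := hs_le t h1
    rw [abs_le]; constructor <;> linarith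
  set φ : ℝ → Euc (d + 1) → ℝ := fun t => capFunction Φ V (s t) (a t) with hφ
  set A : ℝ := 60 * S ^ 5 with hA
  have hA0 : 0 ≤ A := by positivity
  have φ0 : ∀ t θ, 0 ≤ φ t θ := fun t θ => capFunction_nonneg _ _ _
  have φle : ∀ t ∈ Set.Icc t₀ t₁, ∀ θ, φ t θ ≤ 9 * S ^ 4 * ‖θ‖ ^ 2 := fun t h1 =>
    h.capFunction_le (hs_abs t h1) (ha t)
  have φd : ∀ t ∈ Set.Icc t₀ t₁, Differentiable ℝ (φ t) := fun t h1 θ =>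
    (h.capFunction_regular (hs_abs t h1) (ha t) θ).1
  have φf : ∀ t ∈ Set.Icc t₀ t₁, ∀ θ, ‖fderiv ℝ (φ t) θ‖ ≤ A * ‖θ‖ := fun t h1 θ =>
    (h.capFunction_regular (hs_abs t h1) (ha t) θ).2
  have φA : ∀ t ∈ Set.Icc t₀ t₁, ∀ θ, |φ t θ| ≤ A * ‖θ‖ ^ 2 := fun t h1 θ => by
    rw [abs_of_nonneg (φ0 t θ)]
    refine (φle t h1 θ).trans (mul_le_mul_of_nonneg_right ?_ (by positivity))
    have : S ^ 4 ≤ S ^ 5 := pow_le_pow_right₀ hS (by norm_num)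
    rw [hA]; nlinarith [pow_pos hS0 5]
  have φi : ∀ t ∈ Set.Icc t₀ t₁, ∀ μ : Measure (Euc (d + 1)),
      Integrable (fun θ => ‖θ‖ ^ 2) μ → Integrable (φ t) μ := fun t h1 μ hμ =>
    integrable_of_sq_bound hμ (φd t h1).continuous.aestronglyMeasurable (φA t h1)
  have φsol : ∀ t ∈ Set.Icc t₀ t₁, SolvesAgainst σ T ρ (fun t => velocity R Φ V (ρ t)) (φ t) :=
    fun t h1 => hlg.solvesAgainst (φd t h1) (φA t h1) (φf t h1)
  have φmono : ∀ t ∈ Set.Icc t₀ t₁, ∀ t' ∈ Set.Icc t₀ t₁, t ≤ t' → ∀ θ, φ t θ ≤ φ t' θ :=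
    fun t h1 t' h2 h12 => h.capFunction_mono (hsstep t h1 t' h2 h12)
  have hU := integrable_sq_uniformSphere' d
  have φU : ∀ t ∈ Set.Icc t₀ t₁, u₀ ≤ ∫ θ, φ t θ ∂(uniformSphere d) := fun t h1 => by
    have h2 : u₀ ≤ ∫ θ, φ t₀ θ ∂(uniformSphere d) := by
      have := h.le_integral_capFunction hδ hδ1 (ha t₀) hx hF
      rwa [← hst₀] at this
    exact h2.trans (integral_mono (φi t₀ hl _ hU) (φi t h1 _ hU) (φmono t₀ hl t h1 h1.1))
  -- `C₁` bounds the error made by testing with `φ t`, frozen at time `t`, against the velocity at a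
  -- later time `r`; `C₂` bounds the rate of change of the integral of the frozen test function.
  set C₁ : ℝ := A * (4 * S ^ 2 * (S * K)) * N with hC₁
  set C₂ : ℝ := (σ + 5 * S ^ 3) * (A * N) + σ * A with hC₂
  have hC₁0 : 0 ≤ C₁ := by positivity
  have hC₂0 : 0 ≤ C₂ := by positivity
  have drift : ∀ t ∈ Set.Icc t₀ t₁, ∀ r ∈ Set.Icc t₀ t₁, t ≤ r →
      σ * u₀ + δ / 2 * (∫ θ, φ t θ ∂(ρ r)) - C₁ * (r - t) ≤
        weakRHS σ (ρ r) (velocity R Φ V (ρ r)) (φ t) := by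
    intro t h1 r h2 htr
    have hμ := (hf.mem_P₂ r (hmem r h2)).2
    have hpt : ∀ θ, δ * φ t θ - A * (4 * S ^ 2 * (S * K)) * (r - t) * ‖θ‖ ^ 2 ≤
        fderiv ℝ (φ t) θ (velocity R Φ V (ρ r) θ) := by
      intro θ
      have g1 := h.le_fderiv_capFunction (hs_le t h1) (hs_abs t h1) (ha t) θ
      have g2 : ‖a r - a t‖ ≤ S * (K * (r - t)) :=
        (h.loss.lipschitz_gradient _ _).trans (mul_le_mul_of_nonneg_left
          (hf.norm_mean_sub_le h hσ hK (hmem t h1) (hmem r h2) htr) hS0.le)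
      have g3 : |fderiv ℝ (φ t) θ (gradient (linearization Φ V (a r)) θ -
          gradient (linearization Φ V (a t)) θ)| ≤
          A * (4 * S ^ 2 * (S * K)) * (r - t) * ‖θ‖ ^ 2 := by
        rw [← Real.norm_eq_abs]
        refine (ContinuousLinearMap.le_opNorm _ _).trans ?_
        calc _ ≤ (A * ‖θ‖) * (4 * S ^ 2 * (S * (K * (r - t))) * ‖θ‖) := by
              refine mul_le_mul (φf t h1 θ) ?_ (norm_nonneg _) (by positivity)
              refine (h.norm_gradient_linearization_sub_le _ _ θ).trans ?_
              gcongr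
          _ = _ := by ring
      have g4 : velocity R Φ V (ρ r) θ = -gradient (linearization Φ V (a t)) θ -
          (gradient (linearization Φ V (a r)) θ - gradient (linearization Φ V (a t)) θ) := by
        rw [velocity_eq]; abel
      rw [g4, map_sub]
      have g5 := (abs_le.1 g3).2
      change δ * φ t θ ≤ fderiv ℝ (φ t) θ (-gradient (linearization Φ V (a t)) θ) at g1
      linarith
    have hint : Integrable (fun θ => fderiv ℝ (φ t) θ (velocity R Φ V (ρ r) θ)) (ρ r) := by
      refine integrable_of_sq_bound hμ (measurable_fderiv_apply_field
        (measurable_velocity R Φ V _)).aestronglyMeasurable (A := A * (5 * S ^ 3)) fun θ => ?_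
      refine (ContinuousLinearMap.le_opNorm _ _).trans ?_
      calc _ ≤ (A * ‖θ‖) * (5 * S ^ 3 * ‖θ‖) :=
            mul_le_mul (φf t h1 θ) (h.norm_velocity_le _ θ) (norm_nonneg _) (by positivity)
        _ = _ := by ring
    have h3 := integral_mono (((φi t h1 _ hμ).const_mul δ).sub (hμ.const_mul _)) hint hpt
    simp only [Pi.sub_apply] at h3
    rw [integral_sub ((φi t h1 _ hμ).const_mul δ) (hμ.const_mul _), integral_const_mul,
      integral_const_mul] at h3
    have h4 : A * (4 * S ^ 2 * (S * K)) * (r - t) * (∫ θ, ‖θ‖ ^ 2 ∂(ρ r)) ≤ C₁ * (r - t) := by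
      rw [hC₁]
      have : 0 ≤ A * (4 * S ^ 2 * (S * K)) * (r - t) :=
        mul_nonneg (by positivity) (by linarith)
      calc _ ≤ A * (4 * S ^ 2 * (S * K)) * (r - t) * N :=
            mul_le_mul_of_nonneg_left (hN r (hmem r h2)) this
        _ = _ := by ring
    have h5 := mul_le_mul_of_nonneg_left (φU t h1) hσ
    have h6 : 0 ≤ ∫ θ, φ t θ ∂(ρ r) := integral_nonneg (φ0 t)
    unfold weakRHS
    nlinarith [mul_le_mul_of_nonneg_right hσδ h6]
  have lip : ∀ t ∈ Set.Icc t₀ t₁, ∀ r ∈ Set.Icc t₀ t₁, t ≤ r →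
      (∫ θ, φ t θ ∂(ρ t)) - C₂ * (r - t) ≤ ∫ θ, φ t θ ∂(ρ r) := by
    intro t h1 r h2 htr
    have h3 := (φsol t h1).sub_eq (hmem t h1) (hmem r h2)
    have h4 := intervalIntegral.norm_integral_le_of_norm_le_const
      (f := fun r => weakRHS σ (ρ r) (velocity R Φ V (ρ r)) (φ t)) (C := C₂) (a := t) (b := r)
      (fun z hz => by
        rw [Set.uIoc_of_le htr] at hz
        have hz1 : z ∈ Set.Icc 0 T := hmem z ⟨h1.1.trans hz.1.le, hz.2.trans h2.2⟩
        have hμ := (hf.mem_P₂ z hz1).2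
        refine (abs_weakRHS_le hσ (by positivity) (h.norm_velocity_le _) (hμ.const_mul A)
          (hU.const_mul A) (φA t h1) (fun θ => ?_)).trans ?_
        · calc _ ≤ A * ‖θ‖ * ‖θ‖ := mul_le_mul_of_nonneg_right (φf t h1 θ) (norm_nonneg _)
            _ = _ := by ring
        · rw [integral_const_mul, integral_const_mul, integral_sq_uniformSphere, mul_one, hC₂]
          have := hN z hz1
          gcongr)
    rw [abs_of_nonneg (by linarith : 0 ≤ r - t), ← h3] at h4
    have := (abs_le.1 h4).1
    linarith
  set f : ℝ → ℝ := fun t => ∫ θ, φ t θ ∂(ρ t) with hfdef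
  have key := exp_mul_le_of_discrete_growth (g := fun t => δ / 2 * f t + σ * u₀) (s := t₀)
    (e := t₁) (δ := δ / 2) (K := δ / 2 * (C₁ + δ / 2 * C₂)) ht (by positivity) (by positivity)
    (fun t h1 t' h2 h12 => by
      have hμ := (hf.mem_P₂ t' (hmem t' h2)).2
      have k1 : (∫ θ, φ t θ ∂(ρ t')) ≤ f t' :=
        integral_mono (φi t h1 _ hμ) (φi t' h2 _ hμ) (φmono t h1 t' h2 h12)
      have k2 := (φsol t h1).sub_eq (hmem t h1) (hmem t' h2)
      have k3 : ∫ r in t..t', (σ * u₀ + δ / 2 * (f t - C₂ * (t' - t)) - C₁ * (t' - t)) ≤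
          ∫ r in t..t', weakRHS σ (ρ r) (velocity R Φ V (ρ r)) (φ t) := by
        refine intervalIntegral.integral_mono_on h12 intervalIntegrable_const
          ((φsol t h1).intervalIntegrable (hmem t h1) (hmem t' h2)) fun r hr => ?_
        have hr1 : r ∈ Set.Icc t₀ t₁ := ⟨h1.1.trans hr.1, hr.2.trans h2.2⟩
        refine le_trans ?_ (drift t h1 r hr1 hr.1)
        have l1 := lip t h1 r hr1 hr.1
        have l2 : C₂ * (r - t) ≤ C₂ * (t' - t) := by gcongr; exact hr.2
        have l3 : C₁ * (r - t) ≤ C₁ * (t' - t) := by gcongr; exact hr.2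
        have l4 : δ / 2 * (f t - C₂ * (t' - t)) ≤ δ / 2 * (∫ θ, φ t θ ∂(ρ r)) :=
          mul_le_mul_of_nonneg_left (by linarith) (by positivity)
        linarith
      rw [intervalIntegral.integral_const, smul_eq_mul, ← k2] at k3
      have k4 : f t + (t' - t) * (σ * u₀ + δ / 2 * (f t - C₂ * (t' - t)) - C₁ * (t' - t)) ≤ f t' := by
        have : (∫ θ, φ t θ ∂(ρ t)) = f t := rfl
        linarith
      have k5 := mul_le_mul_of_nonneg_left k4 (by positivity : 0 ≤ δ / 2)
      linarith)
  beta_reduce at key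
  have hf0 : 0 ≤ f t₀ := integral_nonneg (φ0 t₀)
  have hf1 : f t₁ ≤ 9 * S ^ 4 * N := by
    have hμ := (hf.mem_P₂ t₁ ht₁).2
    calc f t₁ ≤ ∫ θ, 9 * S ^ 4 * ‖θ‖ ^ 2 ∂(ρ t₁) :=
          integral_mono (φi t₁ hrr _ hμ) (hμ.const_mul _) (φle t₁ hrr)
      _ ≤ _ := by rw [integral_const_mul]; gcongr; exact hN t₁ ht₁
  have h1 : Real.exp (δ / 2 * (t₁ - t₀)) * (σ * u₀) ≤
      Real.exp (δ / 2 * (t₁ - t₀)) * (δ / 2 * f t₀ + σ * u₀) :=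
    mul_le_mul_of_nonneg_left (le_add_of_nonneg_left (by positivity)) (Real.exp_pos _).le
  have h2 : δ / 2 * f t₁ ≤ δ / 2 * (9 * S ^ 4 * N) := by gcongr
  linarith

end CapGrowth

/-! ### Energy dissipated in a time window -/

section Windows

variable {d k : ℕ} {R : Euc k → ℝ} {Φ : Euc (d + 1) → Euc k} {V : Euc (d + 1) → ℝ} {S σ T ε τ : ℝ}
  {ρ : ℝ → Measure (Euc (d + 1))}

/-- A large optimality gap forces either a large dissipation or a direction of descent of the first
variation. By convexity the first variation separates `μ` from a better competitor `ν`: either its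
mean over `μ` is large, and Euler's identity bounds the dissipation from below, or its mean over
`ν` is very negative. -/
lemma ProblemBounds.dissipation_or_descent (h : ProblemBounds R Φ V S) (hε : 0 < ε)
    {μ : Measure (Euc (d + 1))} (hμ : μ ∈ P₂ (d + 1)) (hL : objective R Φ V μ ≤ 2 * S)
    (hgap : 2 * ε < objective R Φ V μ - optimalValue R Φ V) :
    2 * ε ^ 2 / S ^ 2 ≤ dissipation R Φ V μ ∨
      ∃ x ∈ Metric.sphere (0 : Euc (d + 1)) 1,
        linearization Φ V (gradient R (∫ θ, Φ θ ∂μ)) x ≤ -(ε / (2 * S ^ 2)) := by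
  have hS := h.pos
  obtain ⟨_, ⟨ν, hν, rfl⟩, hlt⟩ := exists_lt_of_csInf_lt
    (⟨_, μ, hμ, rfl⟩ : (objective R Φ V '' P₂ (d + 1)).Nonempty)
    (show optimalValue R Φ V < objective R Φ V μ - 2 * ε by linarith)
  set a := gradient R (∫ θ, Φ θ ∂μ) with ha
  have hmom : ∀ {m : Measure (Euc (d + 1))}, m ∈ P₂ (d + 1) → objective R Φ V m ≤ 2 * S →
      ∫ θ, ‖θ‖ ^ 2 ∂m ≤ 2 * S ^ 2 := fun hm hLm =>
    (h.integral_sq_le hm.2).trans (by nlinarith)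
  have hsep : 2 * ε < ∫ θ, linearization Φ V a θ ∂μ - ∫ θ, linearization Φ V a θ ∂ν := by
    rw [h.integral_linearization hμ.2, h.integral_linearization hν.2]
    have := h.loss.tangent_le (∫ θ, Φ θ ∂μ) (∫ θ, Φ θ ∂ν)
    rw [← ha, inner_sub_right] at this
    unfold objective at hlt
    linarith
  by_cases hcase : ε < ∫ θ, linearization Φ V a θ ∂μ
  · left
    have h1 : ∫ θ, 2 * linearization Φ V a θ ∂μ ≤
        ∫ θ, (S ^ 2 / (2 * ε) * ‖velocity R Φ V μ θ‖ ^ 2 + ε / (2 * S ^ 2) * ‖θ‖ ^ 2) ∂μ := by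
      refine integral_mono ((integrable_of_sq_bound hμ.2 (h.differentiable_linearization
        a).continuous.aestronglyMeasurable (h.abs_linearization_le
        (h.loss.gradient_le _))).const_mul 2) (((h.integrable_velocity_sq hμ.2).const_mul _).add
        (hμ.2.const_mul _)) fun θ => ?_
      have hE : 2 * linearization Φ V a θ = -inner ℝ (velocity R Φ V μ θ) θ := by
        rw [velocity_eq, inner_neg_left, neg_neg, inner_gradient_left,
          (h.twoHomogeneous_linearization a).euler (h.differentiable_linearization a) θ,
          smul_eq_mul]
      have h2 := (neg_le_abs _).trans (abs_real_inner_le_norm (velocity R Φ V μ θ) θ)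
      have h3 : 0 ≤ ε / (2 * S ^ 2) * (S ^ 2 / ε * ‖velocity R Φ V μ θ‖ - ‖θ‖) ^ 2 := by positivity
      have e : ε / (2 * S ^ 2) * (S ^ 2 / ε * ‖velocity R Φ V μ θ‖ - ‖θ‖) ^ 2 =
          S ^ 2 / (2 * ε) * ‖velocity R Φ V μ θ‖ ^ 2 + ε / (2 * S ^ 2) * ‖θ‖ ^ 2 -
          ‖velocity R Φ V μ θ‖ * ‖θ‖ := by field_simp; ring
      beta_reduce
      linarith
    rw [integral_add ((h.integrable_velocity_sq hμ.2).const_mul _) (hμ.2.const_mul _),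
      integral_const_mul, integral_const_mul, integral_const_mul] at h1
    have h2 : ε / (2 * S ^ 2) * (∫ θ, ‖θ‖ ^ 2 ∂μ) ≤ ε := by
      calc _ ≤ ε / (2 * S ^ 2) * (2 * S ^ 2) :=
            mul_le_mul_of_nonneg_left (hmom hμ hL) (by positivity)
        _ = ε := by field_simp
    have h3 : ε ≤ S ^ 2 / (2 * ε) * dissipation R Φ V μ := by unfold dissipation; linarith
    rw [div_mul_eq_mul_div, le_div_iff₀ (by positivity)] at h3
    rw [div_le_iff₀ (by positivity)]
    nlinarith
  · right
    by_contra! hcon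
    have hνneg : ∫ θ, linearization Φ V a θ ∂ν < -ε := by linarith
    have h1 : ∫ θ, -(ε / (2 * S ^ 2)) * ‖θ‖ ^ 2 ∂ν ≤ ∫ θ, linearization Φ V a θ ∂ν :=
      integral_mono (hν.2.const_mul _) (integrable_of_sq_bound hν.2
        (h.differentiable_linearization a).continuous.aestronglyMeasurable
        (h.abs_linearization_le (h.loss.gradient_le _)))
        ((h.twoHomogeneous_linearization a).le_of_sphere fun x hx => (hcon x hx).le)
    rw [integral_const_mul] at h1
    have h2 : ε / (2 * S ^ 2) * (∫ θ, ‖θ‖ ^ 2 ∂ν) ≤ ε := by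
      calc _ ≤ ε / (2 * S ^ 2) * (2 * S ^ 2) :=
            mul_le_mul_of_nonneg_left (hmom hν (by linarith)) (by positivity)
        _ = ε := by field_simp
    linarith

lemma IsFlowSolution.objective_le (hf : IsFlowSolution R Φ V σ T ρ) (h : ProblemBounds R Φ V S)
    (hσ : 0 ≤ σ) (hL : objective R Φ V (ρ 0) ≤ S) (hσT : 4 * σ * S ^ 4 * T ≤ 1) {t : ℝ}
    (ht : t ∈ Set.Icc 0 T) :
    objective R Φ V (ρ t) + ∫ r in (0 : ℝ)..t, dissipation R Φ V (ρ r) ≤ 2 * S := by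
  have h0 : (0 : ℝ) ∈ Set.Icc 0 T := ⟨le_rfl, ht.1.trans ht.2⟩
  have h1 := hf.objective_sub_le_sub_dissipation h hσ (h.loss_zero_le (hf.mem_P₂ 0 h0).2 hL) h0 ht
    ht.1
  have h2 : 4 * σ * S ^ 4 * (t - 0) ≤ 4 * σ * S ^ 4 * T := by
    have := h.pos
    have := ht.2
    gcongr
    linarith
  linarith [h.one_le]

/-- As long as the optimality gap exceeds `2ε`, every time window of length `2τ` dissipates a fixed
amount of energy, provided that `τ` is long enough for the noise to be amplified beyond the
available second moment. -/
lemma IsFlowSolution.le_integral_dissipation (hf : IsFlowSolution R Φ V σ T ρ)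
    (h : ProblemBounds R Φ V S) (hσ : 0 ≤ σ) (hL : objective R Φ V (ρ 0) ≤ S)
    (hσT : 4 * σ * S ^ 4 * T ≤ 1) (hε : 0 < ε) (hεS : ε ≤ S)
    (hgap : ∀ t ∈ Set.Icc 0 T, 2 * ε < objective R Φ V (ρ t) - optimalValue R Φ V)
    (hσε : σ ≤ ε / (4 * S ^ 2)) (hστ : 3 * σ * S ^ 3 * τ ≤ ε / (32 * S ^ 4))
    (hτ1 : 1 ≤ τ)
    (hgrow : 9 / 2 * ε * S ^ 4 < σ * (ε ^ 2 / (64 * S ^ 4) * (ε / (160 * S ^ 5)) ^ (d + 1)) *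
      (Real.exp (ε / (4 * S ^ 2) * τ) - 1)) {t : ℝ} (ht : 0 ≤ t) (htT : t + 2 * τ ≤ T) :
    ε ^ 2 / (4096 * S ^ 14 * τ) ≤ ∫ r in t..(t + 2 * τ), dissipation R Φ V (ρ r) := by
  have hτ : 0 < τ := one_pos.trans_le hτ1
  have hS := h.one_le
  have hS0 := h.pos
  have hobj : ∀ r ∈ Set.Icc 0 T, objective R Φ V (ρ r) ≤ 2 * S := fun r hr => by
    have h1 := hf.objective_le h hσ hL hσT hr
    have h2 : 0 ≤ ∫ r in (0 : ℝ)..r, dissipation R Φ V (ρ r) :=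
      intervalIntegral.integral_nonneg hr.1 fun _ _ => dissipation_nonneg _ _ _ _
    linarith
  have hN : ∀ r ∈ Set.Icc 0 T, ∫ θ, ‖θ‖ ^ 2 ∂(ρ r) ≤ 2 * S ^ 2 := fun r hr =>
    (h.integral_sq_le (hf.mem_P₂ r hr).2).trans (by nlinarith [hobj r hr])
  have hDi : ∀ x ∈ Set.Icc 0 T, ∀ y ∈ Set.Icc 0 T,
      IntervalIntegrable (fun r => dissipation R Φ V (ρ r)) volume x y := fun x hx y hy =>
    ((hf.integrableOn_dissipation h hσ).mono_set (Set.uIcc_subset_Icc hx hy)).intervalIntegrable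
  have hsub : ∀ x y, t ≤ x → x ≤ y → y ≤ t + 2 * τ →
      ∫ r in x..y, dissipation R Φ V (ρ r) ≤
        ∫ r in t..(t + 2 * τ), dissipation R Φ V (ρ r) := fun x y h1 h2 h3 =>
    intervalIntegral.integral_mono_interval h1 h2 h3
      (Eventually.of_forall fun _ => dissipation_nonneg _ _ _ _)
      (hDi _ ⟨ht, by linarith⟩ _ ⟨by linarith, htT⟩)
  -- Either the dissipation is large throughout the first half of the window, or a direction of
  -- descent exists at some time `t₀` in it, and the amplification takes place in `[t₀, t₀ + τ]`.
  by_cases hcase : ∀ r ∈ Set.Icc t (t + τ), 2 * ε ^ 2 / S ^ 2 ≤ dissipation R Φ V (ρ r)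
  · refine le_trans ?_ (hsub t (t + τ) le_rfl (by linarith) (by linarith))
    have h1 : ∫ r in t..(t + τ), 2 * ε ^ 2 / S ^ 2 ≤
        ∫ r in t..(t + τ), dissipation R Φ V (ρ r) :=
      intervalIntegral.integral_mono_on (by linarith) intervalIntegrable_const
        (hDi _ ⟨ht, by linarith⟩ _ ⟨by linarith, by linarith⟩) hcase
    rw [intervalIntegral.integral_const, smul_eq_mul, add_sub_cancel_left] at h1
    refine le_trans ?_ h1
    calc ε ^ 2 / (4096 * S ^ 14 * τ) ≤ ε ^ 2 / S ^ 2 := by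
          refine div_le_div_of_nonneg_left (by positivity) (by positivity) ?_
          have : S ^ 2 ≤ S ^ 14 := pow_le_pow_right₀ hS (by norm_num)
          have h14 : 0 < S ^ 14 := by positivity
          nlinarith [mul_le_mul_of_nonneg_left hτ1 h14.le]
      _ ≤ τ * (2 * ε ^ 2 / S ^ 2) := by
          have : 0 < ε ^ 2 / S ^ 2 := by positivity
          calc _ = 1 * (ε ^ 2 / S ^ 2) := (one_mul _).symm
            _ ≤ (2 * τ) * (ε ^ 2 / S ^ 2) := by gcongr; linarith
            _ = _ := by ring
  · push Not at hcase
    obtain ⟨t₀, ht₀, hD⟩ := hcase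
    have ht₀T : t₀ ∈ Set.Icc 0 T := ⟨ht.trans ht₀.1, by linarith [ht₀.2]⟩
    have ht₁T : t₀ + τ ∈ Set.Icc 0 T := ⟨by linarith [ht₀T.1], by linarith [ht₀.2]⟩
    obtain ⟨x, hx, hFx⟩ := (h.dissipation_or_descent hε (hf.mem_P₂ _ ht₀T) (hobj _ ht₀T)
      (hgap _ ht₀T)).resolve_left hD.not_ge
    set δ : ℝ := ε / (2 * S ^ 2) with hδ
    have hδ0 : 0 < δ := by positivity
    have hδ1 : δ ≤ 1 := by
      rw [hδ, div_le_one (by positivity)]; nlinarith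
    -- Otherwise the amplified noise would exceed the bound on the second moment.
    have hmove : δ / 4 < S ^ 2 * ∫ r in t₀..(t₀ + τ), ‖featureRate R Φ V σ (ρ r)‖ := by
      by_contra! hcon
      have h1 := hf.exponential_growth h hσ hN hδ0 hδ1
        (hσε.trans (le_of_eq (by rw [hδ]; field_simp; norm_num))) ht₀T ht₁T (by linarith) hx hFx hcon
      have e1 : δ ^ 2 / 16 = ε ^ 2 / (64 * S ^ 4) := by rw [hδ]; field_simp; norm_num
      have e2 : δ / (80 * S ^ 3) = ε / (160 * S ^ 5) := by rw [hδ]; field_simp; norm_num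
      have e3 : δ / 2 = ε / (4 * S ^ 2) := by rw [hδ]; field_simp; norm_num
      have e4 : ε / (4 * S ^ 2) * (9 * S ^ 4 * (2 * S ^ 2)) = 9 / 2 * ε * S ^ 4 := by
        field_simp; norm_num
      rw [e1, e2, e3, e4, add_sub_cancel_left] at h1
      linarith
    refine le_trans ?_ (hsub t₀ (t₀ + τ) ht₀.1 (by linarith) (by linarith [ht₀.2]))
    set I := ∫ r in t₀..(t₀ + τ), dissipation R Φ V (ρ r) with hI
    -- The weight in Young's inequality makes the second term contribute `δ / 16` over the window.
    set w : ℝ := 64 * S ^ 6 * τ / δ with hw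
    have hw0 : 0 < w := by positivity
    have hXle : ∫ r in t₀..(t₀ + τ), ‖featureRate R Φ V σ (ρ r)‖ ≤
        ∫ r in t₀..(t₀ + τ), (3 * σ * S ^ 3 + 4 * S ^ 4 / w +
          2 * S ^ 2 * w * dissipation R Φ V (ρ r)) := by
      refine intervalIntegral.integral_mono_on (by linarith)
        (hf.intervalIntegrable_featureRate h hσ ht₀T ht₁T).norm
        (intervalIntegrable_const.add ((hDi _ ht₀T _ ht₁T).const_mul _)) fun r hr => ?_
      have hr1 : r ∈ Set.Icc 0 T := ⟨ht₀T.1.trans hr.1, hr.2.trans ht₁T.2⟩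
      refine (h.norm_featureRate_le hσ (hf.mem_P₂ r hr1).2 hw0).trans ?_
      have g1 := hN r hr1
      have g2 : σ * S * ((∫ θ, ‖θ‖ ^ 2 ∂(ρ r)) + 1) ≤ σ * S * (3 * S ^ 2) := by
        refine mul_le_mul_of_nonneg_left ?_ (by positivity)
        nlinarith
      have g3 : (∫ θ, ‖θ‖ ^ 2 ∂(ρ r)) / w ≤ 2 * S ^ 2 / w := by gcongr
      have g4 := mul_le_mul_of_nonneg_left g3 (by positivity : 0 ≤ 2 * S ^ 2)
      have e : 4 * S ^ 4 / w = 2 * S ^ 2 * (2 * S ^ 2 / w) := by ring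
      rw [e]
      linarith
    rw [intervalIntegral.integral_add intervalIntegrable_const ((hDi _ ht₀T _ ht₁T).const_mul _),
      intervalIntegral.integral_const, intervalIntegral.integral_const_mul, smul_eq_mul,
      add_sub_cancel_left, ← hI] at hXle
    have f1 : S ^ 2 * (τ * (3 * σ * S ^ 3)) ≤ δ / 16 := by
      calc _ = S ^ 2 * (3 * σ * S ^ 3 * τ) := by ring
        _ ≤ S ^ 2 * (ε / (32 * S ^ 4)) := by gcongr
        _ = δ / 16 := by rw [hδ]; field_simp; norm_num
    have f2 : S ^ 2 * (τ * (4 * S ^ 4 / w)) = δ / 16 := by rw [hw]; field_simp; norm_num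
    have f3 := mul_le_mul_of_nonneg_left hXle (by positivity : 0 ≤ S ^ 2)
    have f4 : δ / 8 ≤ S ^ 2 * (2 * S ^ 2 * w * I) := by linarith
    have f5 : S ^ 2 * (2 * S ^ 2 * w * I) = I * (128 * S ^ 10 * τ / δ) := by
      rw [hw]; field_simp; ring
    rw [f5, ← div_le_iff₀ (by positivity)] at f4
    refine le_trans (le_of_eq ?_) f4
    rw [hδ]; field_simp; norm_num

/-- The convergence statement with abstract requirements on `σ`, `T` and the window length `τ`. -/
lemma IsFlowSolution.exists_objective_le (hf : IsFlowSolution R Φ V σ T ρ)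
    (h : ProblemBounds R Φ V S) (hσ : 0 ≤ σ) (hL : objective R Φ V (ρ 0) ≤ S)
    (hσT : 4 * σ * S ^ 4 * T ≤ 1) (hε : 0 < ε) (hεS : ε ≤ S) (hτ : 1 ≤ τ)
    (hT : 2 * τ * (8192 * S ^ 15 * τ / ε ^ 2 + 1) ≤ T)
    (hσε : σ ≤ ε / (4 * S ^ 2)) (hστ : 3 * σ * S ^ 3 * τ ≤ ε / (32 * S ^ 4))
    (hgrow : 9 / 2 * ε * S ^ 4 < σ * (ε ^ 2 / (64 * S ^ 4) * (ε / (160 * S ^ 5)) ^ (d + 1)) *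
      (Real.exp (ε / (4 * S ^ 2) * τ) - 1)) :
    ∃ t ∈ Set.Icc 0 T, objective R Φ V (ρ t) - optimalValue R Φ V ≤ 2 * ε := by
  by_contra! hgap
  have hτ0 : 0 < τ := by linarith
  have hS0 := h.pos
  set κ : ℝ := ε ^ 2 / (4096 * S ^ 14 * τ) with hκ
  have hκ0 : 0 < κ := by positivity
  set y : ℝ := 8192 * S ^ 15 * τ / ε ^ 2 with hy
  have hy0 : 0 ≤ y := by positivity
  set J : ℕ := ⌊y⌋₊ + 1 with hJ
  have hJ1 : y < J := by rw [hJ]; push_cast; exact Nat.lt_floor_add_one y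
  have hJ2 : (J : ℝ) ≤ y + 1 := by rw [hJ]; push_cast; linarith [Nat.floor_le hy0]
  have hJT : 2 * τ * J ≤ T := (mul_le_mul_of_nonneg_left hJ2 (by positivity)).trans hT
  have hmem : ∀ j : ℕ, j ≤ J → 2 * τ * j ∈ Set.Icc 0 T := fun j hj =>
    ⟨by positivity, le_trans (by gcongr) hJT⟩
  have hsum : ∀ j : ℕ, j ≤ J → j * κ ≤ ∫ r in (0 : ℝ)..(2 * τ * j), dissipation R Φ V (ρ r) := by
    intro j
    induction j with
    | zero => intro _; simp
    | succ j ih =>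
      intro hj
      have h1 := ih (by omega)
      have m1 := hmem j (by omega)
      have m2 := hmem (j + 1) hj
      have e : 2 * τ * ((j + 1 : ℕ) : ℝ) = 2 * τ * j + 2 * τ := by push_cast; ring
      rw [e] at m2 ⊢
      have h2 := hf.le_integral_dissipation h hσ hL hσT hε hεS hgap hσε hστ hτ hgrow m1.1 m2.2
      have hDi : ∀ x ∈ Set.Icc 0 T, ∀ y ∈ Set.Icc 0 T,
          IntervalIntegrable (fun r => dissipation R Φ V (ρ r)) volume x y := fun x hx y hy =>
        ((hf.integrableOn_dissipation h hσ).mono_set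
          (Set.uIcc_subset_Icc hx hy)).intervalIntegrable
      rw [← intervalIntegral.integral_add_adjacent_intervals
        (hDi 0 (by simpa using hmem 0 (by omega)) _ m1) (hDi _ m1 _ m2)]
      push_cast
      linarith
  have h1 := hsum J le_rfl
  have h2 := hf.objective_le h hσ hL hσT (hmem J le_rfl)
  have h3 := h.objective_nonneg (ρ (2 * τ * J))
  have h4 : y * κ = 2 * S := by rw [hy, hκ]; field_simp; norm_num
  nlinarith [mul_lt_mul_of_pos_right hJ1 hκ0]

end Windows

/-! ### Choice of the constants -/

section Constants

lemma problemBounds_of_regular {d k : ℕ} {R : Euc k → ℝ} {Φ : Euc (d + 1) → Euc k}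
    {V : Euc (d + 1) → ℝ} {M_R C_R B_Φ M_Φ b_V B_V M_V S : ℝ} (hΦ2 : TwoHomogeneous Φ)
    (hV2 : TwoHomogeneous V) (hR : LossRegular R M_R C_R) (hΦ : FeatureRegular Φ B_Φ M_Φ)
    (hV : RegularizerRegular V b_V B_V M_V) (hS : 1 ≤ S) (hk : (k : ℝ) ≤ S) (hMV : M_V ≤ S)
    (hMR : M_R ≤ S) (hMΦ : M_Φ ≤ S) (hbV : b_V⁻¹ ≤ S) (hBV : B_V ≤ S) (hCR : C_R ≤ S)
    (hBΦ : B_Φ ≤ S) : ProblemBounds R Φ V S where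
  one_le := hS
  loss := ⟨hR.convex, hR.nonneg, hR.differentiable, hR.differentiable_gradient,
    fun a => (hR.gradient_le a).trans hMR, fun a => (hR.hessian_le a).trans hCR⟩
  Φ_hom := hΦ2
  V_hom := hV2
  Φ_diff := hΦ.differentiable
  V_diff := hV.differentiable
  Φ_le := hΦ2.norm_le fun x hx => (hΦ.norm_le x hx).trans hBΦ
  le_V := hV2.le_of_sphere fun x hx =>
    (inv_le_of_inv_le₀ hV.lower_pos hbV).trans (hV.lower x hx)
  V_le := hV2.norm_le fun x hx => by
    rw [Real.norm_of_nonneg (hV.lower_pos.le.trans (hV.lower x hx))]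
    exact (hV.upper x hx).trans hBV
  fderiv_Φ_le := fun x => by
    have h0 := hΦ.lipschitz_const_nonneg
    have hlip : ∀ x ∈ Metric.sphere (0 : Euc (d + 1)) 1, ∀ y ∈ Metric.sphere (0 : Euc (d + 1)) 1,
        ‖Φ x - Φ y‖ ≤ (k * M_Φ) * ‖x - y‖ := by
      intro x hx y hy
      have h1 : ‖Φ x - Φ y‖ ≤ ∑ i, |Φ x i - Φ y i| := by
        conv_lhs => rw [← (EuclideanSpace.basisFun (Fin k) ℝ).sum_repr (Φ x - Φ y)]
        refine (norm_sum_le _ _).trans (Finset.sum_le_sum fun i _ => ?_)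
        rw [norm_smul, OrthonormalBasis.norm_eq_one, mul_one]
        simp
      refine h1.trans ((Finset.sum_le_sum fun i _ => hΦ.lipschitz i x hx y hy).trans ?_)
      simp [mul_assoc]
    refine (hΦ2.norm_fderiv_le_of_lipschitz_sphere (fun x hx => (hΦ.norm_le x hx).trans hBΦ)
      (by positivity) hlip x).trans ?_
    refine mul_le_mul_of_nonneg_right ?_ (norm_nonneg _)
    have h1 : k * M_Φ ≤ S * S := mul_le_mul hk hMΦ h0 (by linarith)
    nlinarith
  fderiv_V_le := hV2.norm_fderiv_le fun x hx => by
    rw [← norm_gradient_eq]; exact (hV.gradient_le x hx).trans hMV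

lemma pow_le_exp_nat_mul {x c : ℝ} (n : ℕ) (h0 : 0 ≤ x) (h1 : x ≤ Real.exp c) :
    x ^ n ≤ Real.exp (n * c) := by
  rw [Real.exp_nat_mul]; exact pow_le_pow_left₀ h0 h1 n

/-- The amplification factor `exp (512 y)` over one window beats the noise level `exp (-256 y)`,
the mass of the cap and the bound on the second moment. -/
lemma noise_amplification_lt {d : ℕ} {S ε z y σ : ℝ} (hd : 1 ≤ d) (hε : 0 < ε) (hS : 1 ≤ S)
    (hsmall : 2 * ε < S) (hz1 : 1 / 2 ≤ z) (hy : y = d * z) (b2z : 2 ≤ Real.exp (2 * z))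
    (bSz : S ≤ Real.exp (2 * z)) (bεz : ε⁻¹ ≤ Real.exp z) (hσ' : σ = Real.exp (-(256 * y))) :
    9 / 2 * ε * S ^ 4 < σ * (ε ^ 2 / (64 * S ^ 4) * (ε / (160 * S ^ 5)) ^ (d + 1)) *
      (Real.exp (512 * y) - 1) := by
  have hd1 : (1 : ℝ) ≤ d := by exact_mod_cast hd
  have hS0 : 0 < S := by linarith
  have hzy : z ≤ y := by nlinarith
  have hyp : 0 < y := by linarith
  have b2 : 2 ≤ Real.exp (2 * y) := b2z.trans (Real.exp_le_exp.2 (by linarith))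
  have bS : S ≤ Real.exp (2 * y) := bSz.trans (Real.exp_le_exp.2 (by linarith))
  have bε : ε⁻¹ ≤ Real.exp y := bεz.trans (Real.exp_le_exp.2 hzy)
  have c1 : Real.exp (-(22 * y)) ≤ ε ^ 2 / (64 * S ^ 4) := by
    have e : ε ^ 2 / (64 * S ^ 4) = (2 ^ 6 * (S ^ 4 * ε⁻¹ ^ 2))⁻¹ := by field_simp; norm_num
    rw [e, Real.exp_neg]
    refine inv_anti₀ (by positivity) ?_
    rw [show 22 * y = 6 * (2 * y) + (4 * (2 * y) + 2 * y) by ring, Real.exp_add, Real.exp_add]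
    gcongr
    · exact_mod_cast pow_le_exp_nat_mul 6 zero_le_two b2
    · exact_mod_cast pow_le_exp_nat_mul 4 hS0.le bS
    · exact_mod_cast pow_le_exp_nat_mul 2 (by positivity) bε
  have c2 : Real.exp (-(27 * z)) ≤ ε / (160 * S ^ 5) := by
    have e : ε / (160 * S ^ 5) = (160 * (S ^ 5 * ε⁻¹))⁻¹ := by field_simp
    rw [e, Real.exp_neg]
    refine inv_anti₀ (by positivity) ?_
    rw [show 27 * z = 8 * (2 * z) + (5 * (2 * z) + z) by ring, Real.exp_add, Real.exp_add]
    gcongr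
    · have := pow_le_exp_nat_mul 8 zero_le_two b2z
      push_cast at this
      linarith
    · exact_mod_cast pow_le_exp_nat_mul 5 hS0.le bSz
  have c3 : Real.exp (-(54 * y)) ≤ (ε / (160 * S ^ 5)) ^ (d + 1) := by
    refine le_trans ?_ (pow_le_pow_left₀ (Real.exp_pos _).le c2 (d + 1))
    rw [← Real.exp_nat_mul]
    refine Real.exp_le_exp.2 ?_
    push_cast
    rw [hy]
    nlinarith
  have c4 : Real.exp (512 * y) / 2 ≤ Real.exp (512 * y) - 1 := by
    have : Real.exp (2 * y) ≤ Real.exp (512 * y) := Real.exp_le_exp.2 (by linarith)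
    linarith
  have c5 : Real.exp (-(256 * y)) * (Real.exp (-(22 * y)) * Real.exp (-(54 * y))) *
      (Real.exp (512 * y) / 2) ≤ σ * (ε ^ 2 / (64 * S ^ 4) * (ε / (160 * S ^ 5)) ^ (d + 1)) *
      (Real.exp (512 * y) - 1) := by
    rw [hσ']
    gcongr
  have c6 : Real.exp (-(256 * y)) * (Real.exp (-(22 * y)) * Real.exp (-(54 * y))) *
      (Real.exp (512 * y) / 2) = Real.exp (180 * y) / 2 := by
    rw [← Real.exp_add, ← Real.exp_add, mul_div_assoc', ← Real.exp_add]
    congr 2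
    ring
  refine lt_of_lt_of_le ?_ (c6 ▸ c5)
  have c7 : S ^ 5 ≤ Real.exp (10 * y) := by
    have := pow_le_exp_nat_mul 5 hS0.le bS
    rwa [show ((5 : ℕ) : ℝ) * (2 * y) = 10 * y by push_cast; ring] at this
  have c8 : 8 ≤ Real.exp (6 * y) := by
    have := pow_le_exp_nat_mul 3 zero_le_two b2
    rw [show ((3 : ℕ) : ℝ) * (2 * y) = 6 * y by push_cast; ring] at this
    linarith
  have c9 : 8 * S ^ 5 ≤ Real.exp (180 * y) := by
    calc 8 * S ^ 5 ≤ Real.exp (6 * y) * Real.exp (10 * y) := by gcongr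
      _ = Real.exp (16 * y) := by rw [← Real.exp_add]; congr 1; ring
      _ ≤ _ := Real.exp_le_exp.2 (by linarith)
  have c10 : ε * S ^ 4 < S / 2 * S ^ 4 := by gcongr; linarith
  have c11 : S / 2 * S ^ 4 = S ^ 5 / 2 := by ring
  have : 0 < S ^ 5 := by positivity
  linarith

/-- Every power product of the parameters is absorbed by the exponentially small `σ`: with
`y = d ℓ S`, each of `S`, `d`, `ℓ`, `1/ε` and `2` is at most `exp (2 y)`. -/
lemma exists_objective_le_of_constants {d k : ℕ} {R : Euc k → ℝ} {Φ : Euc (d + 1) → Euc k}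
    {V : Euc (d + 1) → ℝ} {S ε ℓ σ T : ℝ} {ρ : ℝ → Measure (Euc (d + 1))} (hd : 1 ≤ d)
    (hε : 0 < ε) (hℓ : ℓ = Real.log (max (1 / ε) 2))
    (hσ : σ = Real.exp (-(d * ℓ * (256 * S))))
    (hT : T = d ^ 2 / ε ^ 4 * (2 ^ 37 * ℓ ^ 2 * S ^ 21))
    (hf : IsFlowSolution R Φ V σ T ρ) (h : ProblemBounds R Φ V S)
    (hρ : ρ 0 ∈ P₂ (d + 1)) (hL : objective R Φ V (ρ 0) ≤ S) :
    ∃ t ∈ Set.Icc 0 T, objective R Φ V (ρ t) - optimalValue R Φ V ≤ 2 * ε := by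
  have hS := h.one_le
  have hS0 := h.pos
  have hd1 : (1 : ℝ) ≤ d := by exact_mod_cast hd
  have hT0 : 0 ≤ T := by rw [hT]; positivity
  have hopt : 0 ≤ optimalValue R Φ V := by
    refine le_csInf ⟨_, ρ 0, hρ, rfl⟩ ?_
    rintro _ ⟨μ, _, rfl⟩
    exact h.objective_nonneg μ
  -- For large `ε` the initial time already satisfies the claim.
  rcases le_or_gt S (2 * ε) with hbig | hsmall
  · exact ⟨0, ⟨le_rfl, hT0⟩, by linarith⟩
  have hℓ1 : 1 / 2 ≤ ℓ := by
    rw [hℓ]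
    refine le_trans ?_ (Real.log_le_log two_pos (le_max_right _ _))
    linarith [Real.log_two_gt_d9]
  have hℓ0 : 0 < ℓ := by linarith
  have hexpℓ : ε⁻¹ ≤ Real.exp ℓ := by
    rw [hℓ, Real.exp_log (lt_max_of_lt_right two_pos), inv_eq_one_div]
    exact le_max_left _ _
  set z : ℝ := ℓ * S with hz
  have hz1 : 1 / 2 ≤ z := by nlinarith
  have hℓz : ℓ ≤ z := by nlinarith
  set y : ℝ := d * z with hy
  have hzy : z ≤ y := by nlinarith
  have hy1 : 1 / 2 ≤ y := hz1.trans hzy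
  have hyp : 0 < y := by linarith
  have hσ' : σ = Real.exp (-(256 * y)) := by rw [hσ, hy, hz]; congr 1; ring
  have b2z : 2 ≤ Real.exp (2 * z) := by
    have := Real.add_one_le_exp (2 * z); linarith
  have bSz : S ≤ Real.exp (2 * z) := by
    have := Real.add_one_le_exp (2 * z); nlinarith
  have bεz : ε⁻¹ ≤ Real.exp z := hexpℓ.trans (Real.exp_le_exp.2 hℓz)
  have b2 : 2 ≤ Real.exp (2 * y) := b2z.trans (Real.exp_le_exp.2 (by linarith))
  have bS : S ≤ Real.exp (2 * y) := bSz.trans (Real.exp_le_exp.2 (by linarith))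
  have bε : ε⁻¹ ≤ Real.exp y := bεz.trans (Real.exp_le_exp.2 hzy)
  have bℓ : ℓ ≤ Real.exp y := by
    have := Real.add_one_le_exp y; linarith
  have bd : (d : ℝ) ≤ Real.exp (2 * y) := by
    have := Real.add_one_le_exp (2 * y); nlinarith
  have hsplit : ∀ {A c : ℝ}, A ≤ Real.exp c → c ≤ 256 * y → σ * A ≤ 1 := fun {A c} h1 h2 => by
    rw [hσ']
    calc _ ≤ Real.exp (-(256 * y)) * Real.exp c := by gcongr
      _ = Real.exp (-(256 * y) + c) := (Real.exp_add _ _).symm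
      _ ≤ 1 := Real.exp_le_one_iff.2 (by linarith)
  have hσ0 : 0 ≤ σ := by rw [hσ]; exact (Real.exp_pos _).le
  -- The window length makes the exponent `ε τ / (4 S²)` of the amplification equal to `512 y`,
  -- twice the exponent of the noise level `σ = exp (-256 y)`.
  set τ : ℝ := 2048 * S ^ 2 * y / ε with hτ
  have hτ1 : 1 ≤ τ := by
    rw [hτ, le_div_iff₀ hε]
    nlinarith [mul_le_mul hy1 (one_le_pow₀ hS (n := 2)) zero_le_one hyp.le]
  refine hf.exists_objective_le h hσ0 hL ?_ hε (by linarith) hτ1 ?_ ?_ ?_ ?_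
  · have e : 4 * σ * S ^ 4 * T = σ * (2 ^ 39 * (d ^ 2 * (ℓ ^ 2 * (S ^ 25 * ε⁻¹ ^ 4)))) := by
      rw [hT]; field_simp; ring
    rw [e]
    refine hsplit (c := 39 * (2 * y) + (2 * (2 * y) + (2 * y + (25 * (2 * y) + 4 * y)))) ?_
      (by linarith)
    rw [Real.exp_add, Real.exp_add, Real.exp_add, Real.exp_add]
    gcongr
    · exact_mod_cast pow_le_exp_nat_mul 39 zero_le_two b2
    · exact_mod_cast pow_le_exp_nat_mul 2 (by positivity) bd
    · exact_mod_cast pow_le_exp_nat_mul 2 hℓ0.le bℓ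
    · exact_mod_cast pow_le_exp_nat_mul 25 hS0.le bS
    · exact_mod_cast pow_le_exp_nat_mul 4 (by positivity) bε
  · have e1 : 2 * τ * (8192 * S ^ 15 * τ / ε ^ 2) =
        d ^ 2 / ε ^ 4 * (2 ^ 36 * ℓ ^ 2 * S ^ 21) := by
      rw [hτ, hy, hz]; field_simp; norm_num
    have e2 : 2 * τ ≤ 2 * τ * (8192 * S ^ 15 * τ / ε ^ 2) := by
      refine le_mul_of_one_le_right (by positivity) ?_
      rw [le_div_iff₀ (by positivity), one_mul]
      have h1 : ε ^ 2 ≤ S ^ 2 := pow_le_pow_left₀ hε.le (by linarith) 2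
      have h2 : S ^ 2 ≤ S ^ 15 := pow_le_pow_right₀ hS (by norm_num)
      nlinarith [mul_le_mul_of_nonneg_left hτ1 (by positivity : 0 ≤ S ^ 15)]
    have e3 : T = d ^ 2 / ε ^ 4 * (2 ^ 36 * ℓ ^ 2 * S ^ 21) +
        d ^ 2 / ε ^ 4 * (2 ^ 36 * ℓ ^ 2 * S ^ 21) := by rw [hT]; ring
    rw [mul_add, mul_one, e3]
    linarith
  · have e : ε / (4 * S ^ 2) = 1 / (2 ^ 2 * (S ^ 2 * ε⁻¹)) := by field_simp; norm_num
    rw [e, le_div_iff₀ (by positivity)]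
    refine hsplit (c := 2 * (2 * y) + (2 * (2 * y) + y)) ?_ (by linarith)
    rw [Real.exp_add, Real.exp_add]
    gcongr
    · exact_mod_cast pow_le_exp_nat_mul 2 zero_le_two b2
    · exact_mod_cast pow_le_exp_nat_mul 2 hS0.le bS
  · have e : ε / (32 * S ^ 4) = 1 / (32 * S ^ 4 * ε⁻¹) := by field_simp
    rw [e, le_div_iff₀ (by positivity)]
    have e' : 3 * σ * S ^ 3 * τ * (32 * S ^ 4 * ε⁻¹) =
        σ * (3 * 2 ^ 16 * (y * (S ^ 9 * ε⁻¹ ^ 2))) := by rw [hτ]; field_simp; ring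
    rw [e']
    refine hsplit (c := 18 * (2 * y) + (y + (9 * (2 * y) + 2 * y))) ?_ (by linarith)
    rw [Real.exp_add, Real.exp_add, Real.exp_add]
    gcongr
    · have := pow_le_exp_nat_mul 18 zero_le_two b2
      push_cast at this
      linarith
    · linarith [Real.add_one_le_exp y]
    · exact_mod_cast pow_le_exp_nat_mul 9 hS0.le bS
    · exact_mod_cast pow_le_exp_nat_mul 2 (by positivity) bε
  · have hexp : ε / (4 * S ^ 2) * τ = 512 * y := by rw [hτ]; field_simp; norm_num
    rw [hexp]
    exact noise_amplification_lt hd hε hS hsmall hz1 hy b2z bSz bεz hσ'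

end Constants

end PerturbedFlow

theorem mainTheorem2 :
    ∃ (p : MvPolynomial (Fin 9) ℝ) (q : MvPolynomial (Fin 10) ℝ),
      ∀ (d k : ℕ), 1 ≤ d →
      ∀ (R : PerturbedFlow.Euc k → ℝ) (Φ : PerturbedFlow.Euc (d + 1) → PerturbedFlow.Euc k)
        (V : PerturbedFlow.Euc (d + 1) → ℝ) (M_R C_R B_Φ M_Φ b_V B_V M_V : ℝ),
      PerturbedFlow.TwoHomogeneous Φ →
      PerturbedFlow.TwoHomogeneous V →
      PerturbedFlow.LossRegular R M_R C_R →
      PerturbedFlow.FeatureRegular Φ B_Φ M_Φ →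
      PerturbedFlow.RegularizerRegular V b_V B_V M_V →
      ∀ (ε σ t_ε : ℝ) (ρ₀ : MeasureTheory.Measure (PerturbedFlow.Euc (d + 1))),
      0 < ε →
      σ = Real.exp (-((d : ℝ) * Real.log (max (1 / ε) 2) *
        MvPolynomial.eval ![(k : ℝ), M_V, M_R, M_Φ, b_V⁻¹, B_V, C_R, B_Φ,
          PerturbedFlow.objective R Φ V ρ₀] p)) →
      t_ε = (d : ℝ) ^ 2 / ε ^ 4 *
        MvPolynomial.eval ![Real.log (max (1 / ε) 2), (k : ℝ), M_V, M_R, M_Φ, b_V⁻¹, B_V, C_R, B_Φ,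
          PerturbedFlow.objective R Φ V ρ₀] q →
      ρ₀ ∈ PerturbedFlow.P₂ (d + 1) →
      ∀ ρ : ℝ → MeasureTheory.Measure (PerturbedFlow.Euc (d + 1)),
      ρ 0 = ρ₀ →
      PerturbedFlow.IsFlowSolution R Φ V σ t_ε ρ →
      ∃ t ∈ Set.Icc 0 t_ε,
        PerturbedFlow.objective R Φ V (ρ t) - PerturbedFlow.optimalValue R Φ V ≤ 2 * ε := by
  refine ⟨MvPolynomial.C 256 * (1 + ∑ i, MvPolynomial.X i),
    MvPolynomial.C (2 ^ 37) * MvPolynomial.X 0 ^ 2 * (1 + ∑ i : Fin 9, MvPolynomial.X i.succ) ^ 21,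
    ?_⟩
  intro d k hd R Φ V M_R C_R B_Φ M_Φ b_V B_V M_V hΦ2 hV2 hR hΦ hV ε σ t_ε ρ₀ hε hσ ht hρ₀ ρ hρ hf
  subst hρ
  obtain ⟨x, hx⟩ : (Metric.sphere (0 : PerturbedFlow.Euc (d + 1)) 1).Nonempty :=
    NormedSpace.sphere_nonempty.2 zero_le_one
  have p1 : (0 : ℝ) ≤ k := Nat.cast_nonneg k
  have p2 : 0 ≤ M_V := (norm_nonneg _).trans (hV.gradient_le x hx)
  have p3 : 0 ≤ M_R := (norm_nonneg _).trans (hR.gradient_le 0)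
  have p4 : 0 ≤ M_Φ := hΦ.lipschitz_const_nonneg
  have p5 : 0 ≤ b_V⁻¹ := inv_nonneg.2 hV.lower_pos.le
  have p6 : 0 ≤ B_V := hV.lower_pos.le.trans ((hV.lower x hx).trans (hV.upper x hx))
  have p7 : 0 ≤ C_R := (norm_nonneg _).trans (hR.hessian_le 0)
  have p8 : 0 ≤ B_Φ := (norm_nonneg _).trans (hΦ.norm_le x hx)
  have p9 : 0 ≤ PerturbedFlow.objective R Φ V (ρ 0) :=
    add_nonneg (hR.nonneg _) (MeasureTheory.integral_nonneg fun θ => by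
      have := hV2.le_of_sphere (b := 0)
        (fun y hy => hV.lower_pos.le.trans (hV.lower y hy)) θ
      simpa using this)
  set S : ℝ := 1 + (k + M_V + M_R + M_Φ + b_V⁻¹ + B_V + C_R + B_Φ +
    PerturbedFlow.objective R Φ V (ρ 0)) with hS
  have hsum : 1 + ∑ i, (![(k : ℝ), M_V, M_R, M_Φ, b_V⁻¹, B_V, C_R, B_Φ,
      PerturbedFlow.objective R Φ V (ρ 0)] : Fin 9 → ℝ) i = S := by
    simp only [Fin.sum_univ_succ, Fin.sum_univ_zero, Matrix.cons_val_zero, Matrix.cons_val_succ,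
      hS]
    ring
  refine PerturbedFlow.exists_objective_le_of_constants hd hε rfl (S := S) ?_ ?_ hf
    (PerturbedFlow.problemBounds_of_regular hΦ2 hV2 hR hΦ hV (by linarith) (by linarith)
      (by linarith) (by linarith) (by linarith) (by linarith) (by linarith) (by linarith)
      (by linarith)) hρ₀ (by linarith)
  · rw [hσ]
    simp only [map_mul, map_add, map_one, map_sum, MvPolynomial.eval_X, MvPolynomial.eval_C, hsum]
  · rw [ht]
    simp only [map_mul, map_add, map_one, map_sum, map_pow, MvPolynomial.eval_X,
      MvPolynomial.eval_C, Matrix.cons_val_succ, Matrix.cons_val_zero, hsum]
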